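/- An instance of the Euclidean TSP with $n\ge 3$ points is a set $V\subset\mathbb{R}^2$ of $n$ (distinct) points. A tour for $V$ is a Hamiltonian cycle of the complete graph on $V$, its length $c(T)$ is the sum of the Euclidean lengths of its edges, and an optimal tour is a tour of minimum length. For an integer $k\ge 2$, the $k$-Opt heuristic starts with an arbitrary tour and, as long as this is possible, replaces at most $k$ edges of the current tour by the same number of other edges such that the result is a strictly shorter tour; it outputs the tour reached when no such replacement exists any more. Its approximation ratio on instances with $n$ points is $$\rho_k(n)=\sup\left\{\frac{c(S)}{c(T)} : V\subset\mathbb{R}^2,\ |V|=n,\ S \text{ a possible output of } k\text{-Opt on } V,\ T \text{ an optimal tour for } V\right\}.$$ **Corollary.** For every constant $k\ge 2$, the approximation ratio $\rho_k(n)$ is finite for all $n\ge 3$, and $$\rho_k(n)=\Theta\left(\frac{\log n}{\log\log n}\right)\qquad (n\to\infty),$$ where the implied constants may depend on $k$. -/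

import Mathlib

/-- The Euclidean plane. -/
abbrev Plane : Type := EuclideanSpace ℝ (Fin 2)

namespace EuclideanTSP

/-- An edge of the complete graph on `V` is an unordered pair of points of `V`; its length is the
Euclidean distance of its endpoints. -/
noncomputable def edgeLength {V : Finset Plane} (e : Sym2 V) : ℝ :=
  Sym2.lift ⟨fun x y : V => dist (x : Plane) (y : Plane), fun _ _ => dist_comm _ _⟩ e

/-- The length of an edge set is the sum of the lengths of its edges. -/
noncomputable def length {V : Finset Plane} (T : Finset (Sym2 V)) : ℝ :=
  ∑ e ∈ T, edgeLength e

open Classical in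
/-- A tour, given by its edge set: a cycle in the complete graph on `V` that contains all
vertices. (Cycles in a simple graph have at least three vertices.) -/
def IsTour {V : Finset Plane} (T : Finset (Sym2 V)) : Prop :=
  ∃ (v : V) (p : (⊤ : SimpleGraph V).Walk v v), p.IsHamiltonianCycle ∧ ∀ e, e ∈ T ↔ e ∈ p.edges

/-- An optimal tour is a tour of minimum length. -/
def IsOptimalTour {V : Finset Plane} (T : Finset (Sym2 V)) : Prop :=
  IsTour T ∧ ∀ T' : Finset (Sym2 V), IsTour T' → length T ≤ length T'

open Classical in
/-- One iteration of the `k`-Opt heuristic: a set `R` of at most `k` edges of the tour `T` is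
replaced by a set `A` of equally many edges outside of `T`, so that the result `T'` is a strictly
shorter tour. -/
def ImprovingMove (k : ℕ) {V : Finset Plane} (T T' : Finset (Sym2 V)) : Prop :=
  IsTour T ∧ IsTour T' ∧ length T' < length T ∧
    ∃ R A : Finset (Sym2 V), R ⊆ T ∧ Disjoint A T ∧ A.card = R.card ∧ R.card ≤ k ∧
      T' = (T \ R) ∪ A

/-- A tour is `k`-optimal if the `k`-Opt heuristic cannot improve it. -/
def IsKOptimal (k : ℕ) {V : Finset Plane} (S : Finset (Sym2 V)) : Prop :=
  IsTour S ∧ ∀ S' : Finset (Sym2 V), ¬ ImprovingMove k S S'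

/-- The possible outputs of the `k`-Opt heuristic on the instance `V`: start with an arbitrary tour
`T`, perform improving moves as long as there are any, and output the tour that is reached. -/
def IsKOptOutput (k : ℕ) {V : Finset Plane} (S : Finset (Sym2 V)) : Prop :=
  ∃ T : Finset (Sym2 V), IsTour T ∧ Relation.ReflTransGen (ImprovingMove k) T S ∧ IsKOptimal k S

/-- All ratios `length S / length T`, where `S` is a possible output of the `k`-Opt heuristic and
`T` is an optimal tour, for the same instance with `n` points. -/
def kOptRatios (k n : ℕ) : Set ℝ :=
  {ρ | ∃ V : Finset Plane, V.card = n ∧ ∃ S T : Finset (Sym2 V),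
    IsKOptOutput k S ∧ IsOptimalTour T ∧ ρ = length S / length T}

/-- The (worst-case) approximation ratio of the `k`-Opt heuristic on instances with `n` points. -/
noncomputable def kOptApproxRatio (k n : ℕ) : ℝ :=
  sSup (kOptRatios k n)

end EuclideanTSP

namespace EuclideanTSP

/-! ### Cycles described by vertex lists -/

section ListTours

variable {α : Type*}

/-- The edges of the path through the points of a list. -/
def pathEdges (l : List α) : List (Sym2 α) := List.zipWith (fun x y => s(x, y)) l l.tail

/-- The edges of the closed path through the points of a list. -/
def cycEdges (l : List α) : List (Sym2 α) := List.zipWith (fun x y => s(x, y)) l (l.rotate 1)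

@[simp] lemma pathEdges_singleton (x : α) : pathEdges [x] = [] := rfl

@[simp] lemma pathEdges_cons_cons (x y : α) (l : List α) :
    pathEdges (x :: y :: l) = s(x, y) :: pathEdges (y :: l) := rfl

lemma pathEdges_append (l₁ l₂ : List α) (x y : α) :
    pathEdges ((l₁ ++ [x]) ++ y :: l₂) = pathEdges (l₁ ++ [x]) ++ s(x, y) :: pathEdges (y :: l₂) := by
  induction l₁ with
  | nil => simp
  | cons z l₁ ih =>
    cases l₁ with
    | nil => simp
    | cons w l₁ => simpa using ih

lemma cycEdges_cons (x : α) (l : List α) : cycEdges (x :: l) = pathEdges ((x :: l) ++ [x]) := by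
  simp only [cycEdges, pathEdges, List.rotate_cons_succ, List.rotate_zero, List.cons_append,
    List.tail_cons]
  rw [← List.cons_append]
  generalize hm : l ++ [x] = m
  have hlen : (x :: l).length = m.length := by simp [← hm]
  generalize hk : x :: l = k at *
  clear hm hk
  induction k generalizing m with
  | nil => cases m <;> simp_all
  | cons a k ih => cases m <;> simp_all

/-- Splitting the cycle into an arc `u` from `b` to `c` and an arc `v` from `d` to `a` isolates the
two connecting edges. Reversing `u` changes exactly these two, which is the 2-opt move. -/
lemma cycEdges_append (l₁ l₂ : List α) (a b c d : α) (u v : List α)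
    (hu : u = b :: l₁) (hu' : ∃ l, u = l ++ [c]) (hv : v = d :: l₂) (hv' : ∃ l, v = l ++ [a]) :
    cycEdges (u ++ v) = pathEdges u ++ s(c, d) :: (pathEdges v ++ [s(a, b)]) := by
  obtain ⟨u', hu'⟩ := hu'
  obtain ⟨v', hv'⟩ := hv'
  have h1 : u ++ v = b :: (l₁ ++ v) := by rw [hu]; rfl
  rw [h1, cycEdges_cons, ← List.cons_append, ← hu]
  have h2 : (u ++ v) ++ [b] = (u' ++ [c]) ++ d :: (l₂ ++ [b]) := by rw [hu', hv]; simp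
  rw [h2, pathEdges_append, ← hu']
  have h3 : d :: (l₂ ++ [b]) = (v' ++ [a]) ++ b :: [] := by rw [← hv', hv]; simp
  rw [h3, pathEdges_append, ← hv']
  simp

lemma pathEdges_reverse (l : List α) : pathEdges l.reverse = (pathEdges l).reverse := by
  induction l with
  | nil => rfl
  | cons x l ih =>
    cases l with
    | nil => rfl
    | cons y l =>
      rw [List.reverse_cons, List.reverse_cons, pathEdges_append, ← List.reverse_cons, ih,
        pathEdges_cons_cons, List.reverse_cons]
      simp [Sym2.eq_swap]

lemma mem_of_mem_pathEdges {l : List α} {e : Sym2 α} (he : e ∈ pathEdges l) {x : α} (hx : x ∈ e) :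
    x ∈ l := by
  induction l with
  | nil => simp [pathEdges] at he
  | cons y l ih =>
    cases l with
    | nil => simp at he
    | cons z l =>
      simp only [pathEdges_cons_cons, List.mem_cons] at he
      rcases he with rfl | he
      · rcases Sym2.mem_iff.1 hx with rfl | rfl <;> simp
      · exact List.mem_cons_of_mem _ (ih he)

lemma pathEdges_nodup {l : List α} (hl : l.Nodup) : (pathEdges l).Nodup := by
  induction l with
  | nil => simp [pathEdges]
  | cons y l ih =>
    cases l with
    | nil => simp
    | cons z l =>
      rw [pathEdges_cons_cons, List.nodup_cons]
      refine ⟨fun h => ?_, ih (List.nodup_cons.1 hl).2⟩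
      exact (List.nodup_cons.1 hl).1 (mem_of_mem_pathEdges h (Sym2.mem_mk_left _ _))

/-- The third vertex matters: on two vertices the closing edge would be the path edge itself. -/
lemma closing_edge_notMem {x y z : α} {l : List α} (h : (x :: y :: z :: l).Nodup) :
    s(x, y) ∉ pathEdges (y :: z :: l ++ [x]) := by
  simp only [List.cons_append, pathEdges_cons_cons, List.mem_cons, not_or]
  simp only [List.nodup_cons, List.mem_cons, not_or] at h
  refine ⟨fun he => ?_, fun he => ?_⟩
  · rcases Sym2.eq_iff.1 he with ⟨h1, h2⟩ | ⟨h1, h2⟩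
    · exact h.1.1 h1
    · exact h.1.2.1 h1
  · have := mem_of_mem_pathEdges he (Sym2.mem_mk_right x y)
    simp only [List.mem_cons, List.mem_append, List.not_mem_nil, or_false] at this
    rcases this with h' | h' | h'
    · exact h.2.1.1 h'
    · exact h.2.1.2 h'
    · exact h.1.1 h'.symm

lemma cycEdges_nodup {l : List α} (hl : l.Nodup) (h3 : 3 ≤ l.length) : (cycEdges l).Nodup := by
  match l, h3 with
  | x :: y :: z :: l, _ =>
    rw [cycEdges_cons]
    simp only [List.cons_append, pathEdges_cons_cons]
    rw [← pathEdges_cons_cons, List.nodup_cons]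
    refine ⟨closing_edge_notMem hl, pathEdges_nodup ?_⟩
    have : (y :: z :: (l ++ [x])).Perm (x :: y :: z :: l) := by
      have := List.perm_append_singleton x (y :: z :: l)
      simpa using this
    exact this.nodup_iff.2 hl

lemma cycEdges_rotate (l : List α) (k : ℕ) : cycEdges (l.rotate k) = (cycEdges l).rotate k := by
  unfold cycEdges
  rw [List.zipWith_rotate_distrib _ _ _ _ (by simp), List.rotate_rotate, List.rotate_rotate,
    Nat.add_comm]

lemma edges_eq_pathEdges {G : SimpleGraph α} {u v : α} (p : G.Walk u v) :
    p.edges = pathEdges p.support := by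
  induction p with
  | nil => rfl
  | cons h p ih =>
    rw [SimpleGraph.Walk.edges_cons, ih, SimpleGraph.Walk.support_cons]
    cases p <;> rfl

lemma exists_walk_of_list (x : α) (l : List α) (y : α) (h : (x :: l ++ [y]).Nodup) :
    ∃ p : (⊤ : SimpleGraph α).Walk x y, p.support = x :: l ++ [y] := by
  induction l generalizing x with
  | nil => exact ⟨.cons (by simpa using h) .nil, rfl⟩
  | cons z l ih =>
    have hxz : x ≠ z := by
      simp only [List.cons_append, List.nodup_cons, List.mem_cons, not_or] at h
      exact h.1.1
    obtain ⟨p, hp⟩ := ih z (List.nodup_cons.1 h).2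
    refine ⟨.cons (by simpa using hxz) p, ?_⟩
    rw [SimpleGraph.Walk.support_cons, hp]
    rfl

end ListTours

/-! ### Tours as periodic sequences and the 2-opt inequality -/

section Tours

variable {V : Finset Plane}

open Classical in
lemma isTour_of_list {l : List V} (hl : l.Nodup) (h3 : 3 ≤ l.length) (hm : ∀ v, v ∈ l) :
    IsTour (cycEdges l).toFinset := by
  match l, h3 with
  | x :: y :: z :: l, _ =>
    have hperm : (y :: z :: l ++ [x]).Perm (x :: y :: z :: l) :=
      List.perm_append_singleton x (y :: z :: l)
    have hnd : (y :: z :: l ++ [x]).Nodup := hperm.nodup_iff.2 hl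
    obtain ⟨q, hq⟩ := exists_walk_of_list y (z :: l) x hnd
    have hxy : x ≠ y := by simp at hl; exact hl.1.1
    have hqp : q.IsPath := SimpleGraph.Walk.IsPath.mk' (by rw [hq]; exact hnd)
    have hcyc : (SimpleGraph.Walk.cons (show (⊤ : SimpleGraph V).Adj x y by simpa using hxy) q).IsCycle := by
      rw [SimpleGraph.Walk.cons_isCycle_iff]
      refine ⟨hqp, ?_⟩
      rw [edges_eq_pathEdges, hq]
      exact closing_edge_notMem hl
    refine ⟨x, _, ⟨hcyc, ?_⟩, ?_⟩
    · have := hqp.isHamiltonian_of_mem (fun w => by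
        rw [hq]; exact hperm.mem_iff.2 (hm w))
      intro w
      rw [SimpleGraph.Walk.support_tail_of_not_nil _ hcyc.not_nil]
      simpa using this w
    · intro e
      rw [List.mem_toFinset, SimpleGraph.Walk.edges_cons, edges_eq_pathEdges, hq, cycEdges_cons]
      rfl

open Classical in
lemma IsTour.exists_list {T : Finset (Sym2 V)} (hT : IsTour T) :
    ∃ l : List V, l.Nodup ∧ 3 ≤ l.length ∧ (∀ v, v ∈ l) ∧ T = (cycEdges l).toFinset := by
  obtain ⟨v, p, hp, hTp⟩ := hT
  cases p with
  | nil => exact absurd hp.isCycle (by simp)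
  | cons h q =>
    rename_i w
    have hpath := (SimpleGraph.Walk.cons_isCycle_iff _ _).1 hp.isCycle
    have hs : q.support = q.support.dropLast ++ [v] := by
      conv_lhs => rw [← List.dropLast_append_getLast (SimpleGraph.Walk.support_ne_nil q)]
      simp
    have hnd : (q.support.dropLast ++ [v]).Nodup := hs ▸ hpath.1.support_nodup
    have hperm : (q.support.dropLast ++ [v]).Perm (v :: q.support.dropLast) :=
      List.perm_append_singleton v _
    refine ⟨v :: q.support.dropLast, hperm.nodup_iff.1 hnd, ?_, ?_, ?_⟩
    · have := hp.isCycle.three_le_length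
      simp at this ⊢
      omega
    · intro u
      have := hp.mem_support u
      rw [SimpleGraph.Walk.support_cons, hs, List.mem_cons, List.mem_append,
        List.mem_singleton] at this
      rw [List.mem_cons]
      tauto
    · ext e
      rw [hTp, List.mem_toFinset, edges_eq_pathEdges, SimpleGraph.Walk.support_cons, cycEdges_cons,
        hs]
      simp

/-- The length of the closed polygon through the points of a list. -/
noncomputable def cycLength (l : List Plane) : ℝ :=
  (List.zipWith (fun x y : Plane => dist x y) l (l.rotate 1)).sum

open Classical in
lemma length_cycEdges {l : List V} (hl : l.Nodup) (h3 : 3 ≤ l.length) :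
    length (cycEdges l).toFinset = cycLength (l.map ((↑) : V → Plane)) := by
  unfold length
  rw [List.sum_toFinset _ (cycEdges_nodup hl h3)]
  unfold cycLength cycEdges
  rw [List.map_zipWith, ← List.map_rotate, List.zipWith_map]
  rfl

lemma edgeLength_nonneg (e : Sym2 V) : 0 ≤ edgeLength e := by
  induction e with
  | _ x y => exact dist_nonneg (x := (x : Plane)) (y := y)

lemma length_union_sdiff [DecidableEq (Sym2 V)] {S R A : Finset (Sym2 V)} (hR : R ⊆ S)
    (hA : Disjoint A S) : length (S \ R ∪ A) = length S - length R + length A := by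
  unfold length
  rw [Finset.sum_union (Finset.disjoint_of_subset_left Finset.sdiff_subset hA.symm),
    ← Finset.sum_sdiff hR]
  ring

-- If the inequality failed, reversing the arc `u` would be an improving move with two removed
-- edges, hence available for every `k ≥ 2`. When `b = c` or `a = d` the new edges are the old ones
-- and there is nothing to prove.
open Classical in
lemma IsKOptimal.two_opt_append {k : ℕ} (hk : 2 ≤ k) {l₁ l₂ : List V} {a b c d : V} {u v : List V}
    (hu : u = b :: l₁) (hu' : ∃ l, u = l ++ [c]) (hv : v = d :: l₂) (hv' : ∃ l, v = l ++ [a])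
    (hnd : (u ++ v).Nodup) (h3 : 3 ≤ (u ++ v).length) (hm : ∀ w, w ∈ u ++ v)
    (hS : IsKOptimal k (cycEdges (u ++ v)).toFinset) :
    dist (a : Plane) b + dist (c : Plane) d ≤ dist (a : Plane) c + dist (b : Plane) d := by
  by_cases hbc : b = c
  · subst hbc; exact le_rfl
  by_cases had : a = d
  · subst had; rw [dist_comm (a : Plane) b, dist_comm (a : Plane) c, add_comm]
  have hb : b ∈ u := by simp [hu]
  have hc : c ∈ u := by obtain ⟨l, rfl⟩ := hu'; simp
  have hd : d ∈ v := by simp [hv]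
  have ha : a ∈ v := by obtain ⟨l, rfl⟩ := hv'; simp
  have hdis : ∀ x ∈ u, x ∉ v := (List.nodup_append'.1 hnd).2.2
  have hE := cycEdges_append l₁ l₂ a b c d u v hu hu' hv hv'
  have hur : ∃ l, u.reverse = c :: l := by obtain ⟨l, hl⟩ := hu'; exact ⟨l.reverse, by simp [hl]⟩
  obtain ⟨l₃, hur⟩ := hur
  have hE' := cycEdges_append l₃ l₂ a c b d u.reverse v hur ⟨l₁.reverse, by simp [hu]⟩ hv hv'
  have hP : (u.reverse ++ v).Perm (u ++ v) := (List.reverse_perm u).append_right v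
  have nu : ∀ {x y : V}, x ∈ v → s(x, y) ∉ pathEdges u := fun hx he =>
    hdis _ (mem_of_mem_pathEdges he (Sym2.mem_mk_left _ _)) hx
  have nv : ∀ {x y : V}, x ∈ u → s(x, y) ∉ pathEdges v := fun hx he =>
    hdis _ hx (mem_of_mem_pathEdges he (Sym2.mem_mk_left _ _))
  have hac : a ≠ c := fun h => hdis _ hc (h ▸ ha)
  have hab : a ≠ b := fun h => hdis _ hb (h ▸ ha)
  have hbd : b ≠ d := fun h => hdis _ hb (h ▸ hd)
  have hcd : c ≠ d := fun h => hdis _ hc (h ▸ hd)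
  have hRS : ({s(a, b), s(c, d)} : Finset (Sym2 V)) ⊆ (cycEdges (u ++ v)).toFinset := by
    intro e he
    simp only [Finset.mem_insert, Finset.mem_singleton] at he
    rw [List.mem_toFinset, hE]
    rcases he with rfl | rfl <;> simp
  have hAS : Disjoint ({s(a, c), s(b, d)} : Finset (Sym2 V)) (cycEdges (u ++ v)).toFinset := by
    rw [Finset.disjoint_left]
    intro e he
    simp only [Finset.mem_insert, Finset.mem_singleton] at he
    rw [List.mem_toFinset, hE]
    simp only [List.mem_append, List.mem_cons, List.not_mem_nil, or_false, not_or]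
    rcases he with rfl | rfl
    · refine ⟨nu ha, ?_, ?_, ?_⟩
      · rw [Sym2.eq_iff]; tauto
      · rw [Sym2.eq_swap]; exact nv hc
      · rw [Sym2.eq_iff]; tauto
    · refine ⟨?_, ?_, nv hb, ?_⟩
      · rw [Sym2.eq_swap]; exact nu hd
      · rw [Sym2.eq_iff]; tauto
      · rw [Sym2.eq_iff]; rintro (h | h)
        · exact hab h.1.symm
        · exact had h.2.symm
  have hR2 : s(a, b) ≠ s(c, d) := by rw [Ne, Sym2.eq_iff]; tauto
  have hA2 : s(a, c) ≠ s(b, d) := by rw [Ne, Sym2.eq_iff]; tauto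
  have hT' : (cycEdges (u.reverse ++ v)).toFinset =
      ((cycEdges (u ++ v)).toFinset \ {s(a, b), s(c, d)}) ∪ {s(a, c), s(b, d)} := by
    ext e
    rw [List.mem_toFinset, hE', Finset.mem_union, Finset.mem_sdiff, List.mem_toFinset, hE,
      pathEdges_reverse]
    simp only [List.mem_append, List.mem_cons, List.not_mem_nil, or_false, List.mem_reverse,
      Finset.mem_insert, Finset.mem_singleton, not_or]
    have h1 : e ∈ pathEdges u → e ≠ s(a, b) ∧ e ≠ s(c, d) := fun h =>
      ⟨fun h' => nu ha (h' ▸ h), fun h' => nu hd (by rw [Sym2.eq_swap]; exact h' ▸ h)⟩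
    have h2 : e ∈ pathEdges v → e ≠ s(a, b) ∧ e ≠ s(c, d) := fun h =>
      ⟨fun h' => nv hb (by rw [Sym2.eq_swap]; exact h' ▸ h), fun h' => nv hc (h' ▸ h)⟩
    tauto
  by_contra hlt
  push Not at hlt
  refine hS.2 (cycEdges (u.reverse ++ v)).toFinset ⟨hS.1, ?_, ?_, _, _, hRS, hAS, ?_, ?_, hT'⟩
  · exact isTour_of_list (hP.nodup_iff.2 hnd) (by rw [hP.length_eq]; exact h3)
      (fun w => hP.mem_iff.2 (hm w))
  · rw [hT', length_union_sdiff hRS hAS]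
    unfold length
    rw [Finset.sum_pair hR2, Finset.sum_pair hA2]
    change _ - (dist (a : Plane) b + dist (c : Plane) d) + (dist (a : Plane) c + dist (b : Plane) d) < _
    linarith
  · rw [Finset.card_pair hR2, Finset.card_pair hA2]
  · rw [Finset.card_pair hR2]; exact hk

open Classical in
/-- In a `k`-optimal tour no exchange of two edges shortens the tour. -/
lemma IsKOptimal.two_opt {k : ℕ} (hk : 2 ≤ k) {l : List V} (hnd : l.Nodup) (h3 : 3 ≤ l.length)
    (hm : ∀ w, w ∈ l) (hS : IsKOptimal k (cycEdges l).toFinset) {i j : ℕ} (hij : i < j)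
    (hj : j < l.length) :
    dist (l[i] : Plane) (l[(i + 1) % l.length]'(Nat.mod_lt _ (by omega))) +
      dist (l[j] : Plane) (l[(j + 1) % l.length]'(Nat.mod_lt _ (by omega))) ≤
    dist (l[i] : Plane) l[j] + dist (l[(i + 1) % l.length]'(Nat.mod_lt _ (by omega)) : Plane)
      (l[(j + 1) % l.length]'(Nat.mod_lt _ (by omega))) := by
  set n := l.length with hn
  -- After the rotation the vertices from `i + 1` to `j` come first, so the two edges in question
  -- are the one joining the two parts and the closing one.
  set l' := l.rotate (i + 1) with hl'
  have hlen : l'.length = n := by simp [hl', hn]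
  have hget : ∀ t (ht : t < l'.length), l'[t] = l[(t + (i + 1)) % n]'(Nat.mod_lt _ (by omega)) :=
    fun t ht => by simp only [hl', List.getElem_rotate]; rfl
  set u := l'.take (j - i) with hu
  set v := l'.drop (j - i) with hv
  have huv : u ++ v = l' := List.take_append_drop _ _
  have hlu : u.length = j - i := by rw [hu, List.length_take]; omega
  have hlv : v.length = n - (j - i) := by rw [hv, List.length_drop]; omega
  have hcons : ∀ (w : List V) (hw : 0 < w.length), ∃ t, w = w[0] :: t := fun w hw => by
    cases w with
    | nil => simp at hw
    | cons x t => exact ⟨t, rfl⟩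
  have hsnoc : ∀ (w : List V) (hw : 0 < w.length), ∃ t, w = t ++ [w[w.length - 1]] := fun w hw => by
    refine ⟨w.dropLast, ?_⟩
    rw [← List.getLast_eq_getElem (List.ne_nil_of_length_pos hw)]
    exact (List.dropLast_append_getLast _).symm
  obtain ⟨t₁, h₁⟩ := hcons u (by omega)
  obtain ⟨t₂, h₂⟩ := hcons v (by omega)
  have hrot : (cycEdges l').toFinset = (cycEdges l).toFinset := by
    ext e; simp [hl', cycEdges_rotate]
  have key := IsKOptimal.two_opt_append hk h₁ (hsnoc u (by omega)) h₂ (hsnoc v (by omega))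
    (by rw [huv, hl']; exact List.nodup_rotate.2 hnd) (by rw [huv, hlen]; exact h3)
    (by rw [huv, hl']; intro w; exact List.mem_rotate.2 (hm w)) (by rw [huv, hrot]; exact hS)
  have e1 : u[0]'(by omega) = l[(i + 1) % n]'(Nat.mod_lt _ (by omega)) := by
    simp only [hu, List.getElem_take, hget, Nat.zero_add]
  have e2 : u[u.length - 1]'(by omega) = l[j] := by
    simp only [hu, List.getElem_take, hget]
    congr 1
    rw [← hu, hlu, show j - i - 1 + (i + 1) = j by omega, Nat.mod_eq_of_lt hj]
  have e3 : v[0]'(by omega) = l[(j + 1) % n]'(Nat.mod_lt _ (by omega)) := by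
    simp only [hv, List.getElem_drop, hget]
    congr 2
    omega
  have e4 : v[v.length - 1]'(by omega) = l[i] := by
    simp only [hv, List.getElem_drop, hget]
    congr 1
    rw [← hv, hlv, show j - i + (n - (j - i) - 1) + (i + 1) = i + n by omega,
      Nat.add_mod_right, Nat.mod_eq_of_lt (by omega)]
  rw [e1, e2, e3, e4] at key
  exact key

lemma exists_periodic_of_list (l : List Plane) (hl : 0 < l.length) :
    ∃ f : ℕ → Plane, (∀ t, f t = l[t % l.length]'(Nat.mod_lt _ hl)) ∧
      cycLength l = ∑ t ∈ Finset.range l.length, dist (f t) (f (t + 1)) := by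
  refine ⟨fun t => l[t % l.length]'(Nat.mod_lt _ hl), fun t => rfl, ?_⟩
  unfold cycLength
  rw [Finset.sum_range, ← List.sum_ofFn]
  congr 1
  apply List.ext_getElem
  · simp
  · intro i h1 h2
    simp only [List.length_ofFn] at h2
    simp only [List.getElem_zipWith, List.getElem_rotate, List.getElem_ofFn]
    congr 2
    exact (Nat.mod_eq_of_lt h2).symm

/-- A tour as a periodic sequence of points. -/
lemma IsTour.exists_periodic {T : Finset (Sym2 V)} (hT : IsTour T) :
    ∃ f : ℕ → Plane, (∀ t, f (t + V.card) = f t) ∧ (∀ t, f t ∈ V) ∧ (∀ v ∈ V, ∃ t < V.card, f t = v) ∧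
      length T = ∑ t ∈ Finset.range V.card, dist (f t) (f (t + 1)) ∧
      ∀ k, 2 ≤ k → IsKOptimal k T → ∀ i j, i < j → j < V.card →
        dist (f i) (f (i + 1)) + dist (f j) (f (j + 1)) ≤
          dist (f i) (f j) + dist (f (i + 1)) (f (j + 1)) := by
  classical
  obtain ⟨l, hnd, h3, hm, rfl⟩ := hT.exists_list
  have hcard : V.card = l.length := by
    rw [← List.toFinset_card_of_nodup hnd, ← Fintype.card_coe, ← Finset.card_univ]
    congr 1
    ext v
    simp [hm]
  obtain ⟨f, hf, hlen⟩ := exists_periodic_of_list (l.map ((↑) : V → Plane)) (by simp; omega)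
  have hf' : ∀ t, f t = (l[t % l.length]'(Nat.mod_lt _ (by omega)) : Plane) := by
    intro t; rw [hf]; simp
  rw [hcard]
  refine ⟨f, ?_, ?_, ?_, ?_, ?_⟩
  · intro t
    rw [hf', hf']
    simp
  · intro t; rw [hf']; exact Subtype.coe_prop _
  · intro v hv
    obtain ⟨i, hi, hiv⟩ := List.getElem_of_mem (hm ⟨v, hv⟩)
    refine ⟨i, hi, ?_⟩
    rw [hf']
    simp only [Nat.mod_eq_of_lt hi, hiv]
  · rw [length_cycEdges hnd h3, hlen]; simp
  · intro k hk hS i j hij hj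
    have := IsKOptimal.two_opt hk hnd h3 hm hS hij hj
    rw [hf', hf', hf', hf']
    simp only [Nat.mod_eq_of_lt hj, Nat.mod_eq_of_lt (hij.trans hj)]
    exact this

lemma exists_isOptimalTour (h : 3 ≤ V.card) : ∃ T : Finset (Sym2 V), IsOptimalTour T := by
  classical
  have hfin : {T : Finset (Sym2 V) | IsTour T}.Finite := Set.toFinite _
  have hne : {T : Finset (Sym2 V) | IsTour T}.Nonempty :=
    ⟨_, isTour_of_list (l := (Finset.univ : Finset V).toList) (Finset.nodup_toList _)
      (by simpa using h) (by simp)⟩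
  obtain ⟨T, hT, hmin⟩ := Set.exists_min_image _ length hfin hne
  exact ⟨T, hT, hmin⟩

lemma IsOptimalTour.isKOptOutput {T : Finset (Sym2 V)} (hT : IsOptimalTour T) (k : ℕ) :
    IsKOptOutput k T :=
  ⟨T, hT.1, .refl, hT.1, fun T' h => absurd (hT.2 T' h.2.1) (not_le.2 h.2.2.1)⟩

lemma dist_le_sum_of_periodic {f : ℕ → Plane} {n : ℕ} {i j : ℕ} (hi : i < n) (hj : j < n) :
    dist (f i) (f j) ≤ ∑ t ∈ Finset.range n, dist (f t) (f (t + 1)) := by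
  wlog hij : i ≤ j generalizing i j
  · rw [dist_comm]; exact this hj hi (by omega)
  refine (dist_le_Ico_sum_dist f hij).trans ?_
  refine Finset.sum_le_sum_of_subset_of_nonneg ?_ fun _ _ _ => dist_nonneg
  intro t ht
  simp only [Finset.mem_Ico, Finset.mem_range] at ht ⊢
  omega

lemma IsTour.dist_le_length {T : Finset (Sym2 V)} (hT : IsTour T) {u v : Plane} (hu : u ∈ V)
    (hv : v ∈ V) : dist u v ≤ length T := by
  obtain ⟨f, -, -, hf, hlen, -⟩ := hT.exists_periodic
  obtain ⟨i, hi, rfl⟩ := hf u hu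
  obtain ⟨j, hj, rfl⟩ := hf v hv
  rw [hlen]
  exact dist_le_sum_of_periodic hi hj

lemma length_nonneg (T : Finset (Sym2 V)) : 0 ≤ length T :=
  Finset.sum_nonneg fun e _ => edgeLength_nonneg e

/-- No edge of `S` is longer than the whole tour `T`, because `T` visits both of its endpoints. This
crude factor suffices for finiteness of the ratio. -/
lemma IsTour.length_le_card_mul {S T : Finset (Sym2 V)} (hS : IsTour S) (hT : IsTour T) :
    length S ≤ V.card * length T := by
  obtain ⟨f, -, hf, -, hlen, -⟩ := hS.exists_periodic
  rw [hlen]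
  calc _ ≤ ∑ t ∈ Finset.range V.card, length T :=
        Finset.sum_le_sum fun t _ => hT.dist_le_length (hf _) (hf _)
    _ = _ := by simp

end Tours

lemma kOptRatios_nonempty (k : ℕ) {n : ℕ} (hn : 3 ≤ n) : (kOptRatios k n).Nonempty := by
  obtain ⟨V, -, hV⟩ := Set.Infinite.exists_subset_card_eq (s := (Set.univ : Set Plane))
    Set.infinite_univ n
  obtain ⟨T, hT⟩ := exists_isOptimalTour (V := V) (by omega)
  exact ⟨_, V, hV, T, T, hT.isKOptOutput k, hT, rfl⟩

lemma kOptRatios_bddAbove (k n : ℕ) : BddAbove (kOptRatios k n) := by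
  refine ⟨n, ?_⟩
  rintro _ ⟨V, rfl, S, T, ⟨-, -, -, hS⟩, hT, rfl⟩
  exact div_le_of_le_mul₀ (length_nonneg _) (by positivity) (hS.1.length_le_card_mul hT.1)

/-- The set of ratios is nonempty and bounded, so `sSup` is a genuine supremum and not its default
value. -/
lemma isLUB_kOptApproxRatio (k : ℕ) {n : ℕ} (hn : 3 ≤ n) :
    IsLUB (kOptRatios k n) (kOptApproxRatio k n) :=
  isLUB_csSup (kOptRatios_nonempty k hn) (kOptRatios_bddAbove k n)

end EuclideanTSP

namespace EuclideanTSP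

/-! ### Cover costs and thick balls -/

section Covers

variable {I X : Type*} [PseudoMetricSpace X]

/-- The cost of covering the indices in `U`: the diameter of their image plus a mesh size. -/
noncomputable def coverCost (γ : I → X) (η : ℝ) (U : Finset I) : ℝ :=
  Metric.diam (γ '' (U : Set I)) + η

lemma coverCost_nonneg (γ : I → X) {η : ℝ} (hη : 0 ≤ η) (U : Finset I) : 0 ≤ coverCost γ η U :=
  add_nonneg Metric.diam_nonneg hη

lemma dist_le_diam_image (γ : I → X) {U : Finset I} {s t : I} (hs : s ∈ U) (ht : t ∈ U) :
    dist (γ s) (γ t) ≤ Metric.diam (γ '' (U : Set I)) :=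
  Metric.dist_le_diam_of_mem (U.finite_toSet.image γ).isBounded (Set.mem_image_of_mem _ hs)
    (Set.mem_image_of_mem _ ht)

lemma diam_image_le (γ : I → X) {U : Finset I} {C : ℝ} (hC : 0 ≤ C)
    (h : ∀ s ∈ U, ∀ t ∈ U, dist (γ s) (γ t) ≤ C) : Metric.diam (γ '' (U : Set I)) ≤ C := by
  refine Metric.diam_le_of_forall_dist_le hC ?_
  rintro _ ⟨s, hs, rfl⟩ _ ⟨t, ht, rfl⟩
  exact h s hs t ht

/-- A chain with small steps that is covered by a family of sets is not much longer than the total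
cost of the family. -/
lemma dist_add_le_sum_coverCost [DecidableEq I] (γ : I → X) {η : ℝ} (hη : 0 ≤ η) (c : ℕ → I) (m : ℕ)
    (hstep : ∀ i < m, dist (γ (c i)) (γ (c (i + 1))) ≤ η) (𝒰 : Finset (Finset I)) :
    ∀ i ≤ m, (∀ j, i ≤ j → j ≤ m → ∃ U ∈ 𝒰, c j ∈ U) →
      dist (γ (c i)) (γ (c m)) + η ≤ ∑ U ∈ 𝒰, coverCost γ η U := by
  induction h : 𝒰.card generalizing 𝒰 with
  | zero =>
    intro i hi hcov
    obtain ⟨U, hU, -⟩ := hcov i le_rfl hi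
    simp [Finset.card_eq_zero.1 h] at hU
  | succ n ih =>
    intro i hi hcov
    obtain ⟨U, hU, hiU⟩ := hcov i le_rfl hi
    have hsum := Finset.add_sum_erase 𝒰 (coverCost γ η) hU
    have hnn : 0 ≤ ∑ W ∈ 𝒰.erase U, coverCost γ η W :=
      Finset.sum_nonneg fun W _ => coverCost_nonneg γ hη W
    -- Jump to the last index of the chain in `U`. The rest of the chain avoids `U`, so induction
    -- applies to the family without `U`, and the `η` in the cost of `U` pays for the step out of
    -- it.
    obtain ⟨k, ⟨hik, hkm, hkU⟩, hkmax⟩ : ∃ k, (i ≤ k ∧ k ≤ m ∧ c k ∈ U) ∧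
        ∀ j, k < j → j ≤ m → c j ∉ U := by
      have hne : ((Finset.range (m + 1)).filter fun j => i ≤ j ∧ c j ∈ U).Nonempty :=
        ⟨i, by simp [hiU]; omega⟩
      have hmem := Finset.max'_mem _ hne
      set k := Finset.max' _ hne with hk
      simp only [Finset.mem_filter, Finset.mem_range] at hmem
      refine ⟨k, ⟨hmem.2.1, by omega, hmem.2.2⟩, fun j hkj hjm hj => ?_⟩
      have := Finset.le_max' _ j (by
        simp only [Finset.mem_filter, Finset.mem_range]
        exact ⟨by omega, by omega, hj⟩ : j ∈ (Finset.range (m + 1)).filter fun j => i ≤ j ∧ c j ∈ U)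
      omega
    have hd := dist_le_diam_image γ hiU hkU
    rcases hkm.eq_or_lt with rfl | hlt
    · unfold coverCost at *
      linarith
    · have := ih (𝒰.erase U) (by rw [Finset.card_erase_of_mem hU, h]; rfl) (k + 1) hlt
        (fun j hj hjm => by
          obtain ⟨W, hW, hjW⟩ := hcov j (by omega) hjm
          refine ⟨W, Finset.mem_erase.2 ⟨?_, hW⟩, hjW⟩
          rintro rfl
          exact hkmax j (by omega) hjm hjW)
      have h1 := hstep k hlt
      have h2 := dist_triangle (γ (c i)) (γ (c k)) (γ (c m))
      have h3 := dist_triangle (γ (c k)) (γ (c (k + 1))) (γ (c m))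
      have h4 : coverCost γ η U = Metric.diam (γ '' (U : Set I)) + η := rfl
      linarith

/-- The ball around `x` of radius `r` is expensive to cover by sets that are small compared
with `r`. -/
def IsThick (γ : I → X) (η lam κ : ℝ) (x : X) (r : ℝ) : Prop :=
  ∀ 𝒰 : Finset (Finset I), (∀ t, dist (γ t) x ≤ r → ∃ U ∈ 𝒰, t ∈ U) →
    (∀ U ∈ 𝒰, Metric.diam (γ '' (U : Set I)) ≤ lam * r) →
    (2 + κ) * r ≤ ∑ U ∈ 𝒰, coverCost γ η U

/-- Well separated thick balls have small total radius. -/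
lemma sum_radius_le_of_isThick [Fintype I] [DecidableEq I] {E : Type*} [DecidableEq E] (γ : I → X)
    {η lam κ : ℝ} (hη : 0 ≤ η) (hlam : 0 ≤ lam) (hlam1 : lam ≤ 1) (a : E → X)
    (r : E → ℝ) (M : Finset E) (hr : ∀ e ∈ M, 0 < r e)
    (hthick : ∀ e ∈ M, IsThick γ η lam κ (a e) (r e))
    (hsep : ∀ e ∈ M, ∀ f ∈ M, e ≠ f → r e ≤ r f →
      4 * r e ≤ lam * r f ∨ r f + 2 * r e < dist (a e) (a f))
    (hsmall : ∀ e ∈ M, 2 * lam * r e + η ≤ κ / 2 * r e) :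
    ∑ e ∈ M, κ / 2 * r e ≤ Fintype.card I * η := by
  -- Balls are processed by increasing radius, starting from the cover by singletons of cost at most
  -- `card I * η`. Each ball lowers the cost by at least `κ / 2 * r`, and costs are nonnegative. The
  -- third clause keeps every set degenerate or inside a doubled ball already processed.
  suffices h : ∃ 𝒰 : Finset (Finset I), (∀ t, ∃ U ∈ 𝒰, t ∈ U) ∧
      ∑ U ∈ 𝒰, coverCost γ η U ≤ Fintype.card I * η - ∑ e ∈ M, κ / 2 * r e ∧
      ∀ U ∈ 𝒰, Metric.diam (γ '' (U : Set I)) ≤ 0 ∨ ∃ e ∈ M, ∀ t ∈ U, dist (γ t) (a e) ≤ 2 * r e by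
    obtain ⟨𝒰, -, h, -⟩ := h
    have : 0 ≤ ∑ U ∈ 𝒰, coverCost γ η U := Finset.sum_nonneg fun U _ => coverCost_nonneg γ hη U
    linarith
  induction M using Finset.induction_on_max_value r with
  | empty =>
    refine ⟨Finset.univ.image fun t : I => {t}, fun t => ⟨{t}, by simp, by simp⟩, ?_, ?_⟩
    · refine (Finset.sum_image_le_of_nonneg fun U _ => coverCost_nonneg γ hη U).trans ?_
      simp [coverCost]
    · intro U hU
      obtain ⟨t, -, rfl⟩ := Finset.mem_image.1 hU
      left; simp
  | insert f M hf hmax ih =>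
    obtain ⟨𝒰, hcov, hcost, hU⟩ := ih (fun e he => hr e (Finset.mem_insert_of_mem he))
      (fun e he => hthick e (Finset.mem_insert_of_mem he))
      (fun e he f hf => hsep e (Finset.mem_insert_of_mem he) f (Finset.mem_insert_of_mem hf))
      (fun e he => hsmall e (Finset.mem_insert_of_mem he))
    have hfM := Finset.mem_insert_self f M
    have hrf := hr f hfM
    have hlr : 0 ≤ lam * r f := by positivity
    classical
    -- The sets meeting the new ball are merged into one set `Z`. By `hsep` they are small enough
    -- for thickness to apply: doubled earlier balls are either tiny compared with `r f` or miss the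
    -- ball of `f`. So cost at least `(2 + κ) * r f` is replaced by at most `2 * (1 + lam) * r f +
    -- η`.
    set 𝒲 := 𝒰.filter fun U => ∃ t ∈ U, dist (γ t) (a f) ≤ r f with h𝒲
    have hdiam : ∀ U ∈ 𝒲, Metric.diam (γ '' (U : Set I)) ≤ lam * r f := by
      intro U hU'
      obtain ⟨hU1, t, htU, ht⟩ := Finset.mem_filter.1 hU'
      rcases hU U hU1 with h0 | ⟨e, he, hUe⟩
      · linarith
      · have hef : e ≠ f := fun h => hf (h ▸ he)
        rcases hsep e (Finset.mem_insert_of_mem he) f hfM hef (hmax e he) with h1 | h1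
        · refine diam_image_le γ hlr fun s hs t' ht' => ?_
          have := dist_triangle_right (γ s) (γ t') (a e)
          have := hUe s hs
          have := hUe t' ht'
          linarith
        · exfalso
          have := hUe t htU
          have := dist_triangle_left (a e) (a f) (γ t)
          linarith
    have hth := hthick f hfM 𝒲 (fun t ht => by
      obtain ⟨U, hU1, htU⟩ := hcov t
      exact ⟨U, Finset.mem_filter.2 ⟨hU1, t, htU, ht⟩, htU⟩) hdiam
    set Z := 𝒲.biUnion id with hZ
    have hZd : ∀ t ∈ Z, dist (γ t) (a f) ≤ (1 + lam) * r f := by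
      intro t ht
      obtain ⟨U, hU1, htU⟩ := Finset.mem_biUnion.1 ht
      obtain ⟨-, s, hsU, hs⟩ := Finset.mem_filter.1 hU1
      change t ∈ U at htU
      have := dist_le_diam_image γ htU hsU
      have := hdiam U hU1
      have := dist_triangle (γ t) (γ s) (a f)
      linarith
    have hZcost : coverCost γ η Z ≤ 2 * ((1 + lam) * r f) + η := by
      unfold coverCost
      gcongr
      refine diam_image_le γ (by positivity) fun s hs t ht => ?_
      have := hZd s hs
      have := hZd t ht
      have := dist_triangle_right (γ s) (γ t) (a f)
      linarith
    refine ⟨insert Z (𝒰 \ 𝒲), ?_, ?_, ?_⟩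
    · intro t
      obtain ⟨U, hU1, htU⟩ := hcov t
      by_cases hUW : U ∈ 𝒲
      · exact ⟨Z, Finset.mem_insert_self _ _, Finset.mem_biUnion.2 ⟨U, hUW, htU⟩⟩
      · exact ⟨U, Finset.mem_insert_of_mem (Finset.mem_sdiff.2 ⟨hU1, hUW⟩), htU⟩
    · have h1 : ∑ U ∈ insert Z (𝒰 \ 𝒲), coverCost γ η U ≤
          coverCost γ η Z + ∑ U ∈ 𝒰 \ 𝒲, coverCost γ η U := by
        by_cases hZm : Z ∈ 𝒰 \ 𝒲
        · rw [Finset.insert_eq_of_mem hZm]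
          linarith [coverCost_nonneg γ hη Z]
        · rw [Finset.sum_insert hZm]
      have h2 := Finset.sum_sdiff (f := coverCost γ η) (Finset.filter_subset _ 𝒰 : 𝒲 ⊆ 𝒰)
      rw [Finset.sum_insert hf]
      have := hsmall f hfM
      linarith
    · intro U hU'
      rcases Finset.mem_insert.1 hU' with rfl | hU'
      · right
        refine ⟨f, hfM, fun t ht => (hZd t ht).trans ?_⟩
        gcongr
        linarith
      · rcases hU U (Finset.mem_sdiff.1 hU').1 with h | ⟨e, he, h⟩
        · exact Or.inl h
        · exact Or.inr ⟨e, Finset.mem_insert_of_mem he, h⟩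

end Covers

/-! ### Straight arcs and overlapping forward edges -/

section Arcs

variable {X : Type*} [PseudoMetricSpace X]

/-- The part of a bi-infinite chain between its first exits from the ball around `g 0`. -/
structure IsArc (g : ℤ → X) (r : ℝ) (im ip : ℤ) : Prop where
  im_pos : 0 < im
  ip_pos : 0 < ip
  mem : ∀ j, -im < j → j < ip → dist (g j) (g 0) ≤ r
  exit_right : r < dist (g ip) (g 0)
  exit_left : r < dist (g (-im)) (g 0)

/-- Up to the error `δ`, the chain moves along a straight line between `-im` and `ip`. -/
def IsStraight (g : ℤ → X) (δ : ℝ) (im ip : ℤ) : Prop :=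
  ∀ i j k, -im ≤ i → i ≤ j → j ≤ k → k ≤ ip →
    dist (g i) (g j) + dist (g j) (g k) ≤ dist (g i) (g k) + δ

/-- The chain through `g 0` is straight near `g 0`, and passes close to `b` in positive
direction. -/
def IsForward (g : ℤ → X) (b : X) (r δ ε : ℝ) : Prop :=
  ∃ im ip, IsArc g r im ip ∧ IsStraight g δ im ip ∧ ∃ j, 0 < j ∧ j < ip ∧ dist b (g j) ≤ ε

/-- If the ball around a point of a closed chain is not thick and the chain is straight there, then
all points of the chain in the smaller ball are close to the arc through the center. -/
lemma exists_arc_point_near {N : ℕ} [NeZero N] (γ : ZMod N → X) {η : ℝ} (hη : 0 ≤ η)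
    (hstep : ∀ t, dist (γ t) (γ (t + 1)) ≤ η) {τ : ZMod N} {r σ s κ lam : ℝ} {im ip : ℤ}
    (harc : IsArc (fun j : ℤ => γ (τ + j)) r im ip)
    (hstr : IsStraight (fun j : ℤ => γ (τ + j)) (σ * r) im ip)
    (hthin : ¬ IsThick γ η lam κ (γ τ) r) (hr : 0 < r) (hs0 : 0 ≤ s) (hs1 : s ≤ 1) (hlam : lam ≤ s / 2)
    (hpar : (κ + σ) * r + 3 * η ≤ s / 2 * r) {t₀ : ZMod N} (ht₀ : dist (γ t₀) (γ τ) ≤ r / 2) :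
    ∃ j : ℤ, -im < j ∧ j < ip ∧ dist (γ t₀) (γ (τ + j)) ≤ s * r := by
  by_contra! hfar
  unfold IsThick at hthin
  push Not at hthin
  obtain ⟨𝒰, hcov, hdiam, hcost⟩ := hthin
  have him := harc.im_pos
  have hip := harc.ip_pos
  have hball : ∀ j : ℤ, -im < j → j < ip → dist (γ (τ + j)) (γ τ) ≤ r := by
    intro j h1 h2; simpa using harc.mem j h1 h2
  have hsr : s * r ≤ r := by nlinarith
  -- the strand through `t₀`
  obtain ⟨k, hk1, hkout, hkin⟩ : ∃ k : ℕ, 1 ≤ k ∧ s / 2 * r < dist (γ (t₀ + k)) (γ t₀) ∧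
      ∀ i < k, dist (γ (t₀ + (i : ℕ))) (γ t₀) ≤ s / 2 * r := by
    have hex : ∃ k : ℕ, s / 2 * r < dist (γ (t₀ + k)) (γ t₀) := by
      refine ⟨(τ + (ip : ZMod N) - t₀).val, ?_⟩
      rw [ZMod.natCast_zmod_val, add_sub_cancel]
      have h1 := harc.exit_right
      have h2 := dist_triangle (γ (τ + ip)) (γ t₀) (γ τ)
      simp only [Int.cast_zero, add_zero] at h1
      linarith
    classical
    refine ⟨Nat.find hex, ?_, Nat.find_spec hex, fun i hi => not_lt.1 (Nat.find_min hex hi)⟩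
    by_contra! h0
    have h1 := Nat.find_spec hex
    rw [Nat.lt_one_iff.1 h0] at h1
    simp only [Nat.cast_zero, add_zero, dist_self] at h1
    have : 0 ≤ s / 2 * r := by positivity
    linarith
  classical
  -- The strand runs from `γ t₀` to within one step of leaving the ball of radius `s / 2 * r`; the
  -- sets it meets therefore cost more than `s / 2 * r`.
  have key1 := dist_add_le_sum_coverCost γ hη (fun i : ℕ => t₀ + (i : ℕ)) (k - 1)
    (fun i _ => by simpa [add_assoc] using hstep (t₀ + i))
    (𝒰.filter fun U => ∃ i < k, t₀ + (i : ℕ) ∈ U) 0 (by omega) (fun j _ hj => by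
      have h1 := hkin j (by omega)
      have h2 := dist_triangle (γ (t₀ + (j : ℕ))) (γ t₀) (γ τ)
      obtain ⟨U, hU, hjU⟩ := hcov (t₀ + (j : ℕ)) (by linarith)
      exact ⟨U, Finset.mem_filter.2 ⟨hU, j, by omega, hjU⟩, hjU⟩)
  have hlast : dist (γ (t₀ + (k - 1 : ℕ))) (γ (t₀ + k)) ≤ η := by
    have := hstep (t₀ + (k - 1 : ℕ))
    have hc : (t₀ + (k - 1 : ℕ) : ZMod N) + 1 = t₀ + k := by
      rw [Nat.cast_sub hk1]; push_cast; ring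
    rwa [hc] at this
  -- the arc through `τ`
  set c : ℕ → ZMod N := fun i => τ + ((-im + 1 + (i : ℤ) : ℤ) : ZMod N) with hc
  -- By straightness the exits of the arc are at least `(2 - σ) * r` apart, so the sets met by the
  -- arc cost at least `(2 - σ) * r - η`.
  have key2 := dist_add_le_sum_coverCost γ hη c (im + ip - 2).toNat
    (fun i _ => by
      have := hstep (c i)
      have hc' : c i + 1 = c (i + 1) := by simp only [hc]; push_cast; ring
      rwa [hc'] at this)
    (𝒰.filter fun U => ∃ j : ℤ, -im < j ∧ j < ip ∧ τ + (j : ZMod N) ∈ U) 0 (by omega)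
    (fun j _ hj => by
      obtain ⟨U, hU, hjU⟩ := hcov (c j) (hball _ (by omega) (by omega))
      exact ⟨U, Finset.mem_filter.2 ⟨hU, _, by omega, by omega, hjU⟩, hjU⟩)
  have hc0 : c 0 = τ + ((-im : ℤ) : ZMod N) + 1 := by simp only [hc]; push_cast; ring
  have hcl : c (im + ip - 2).toNat + 1 = τ + (ip : ZMod N) := by
    simp only [hc]
    rw [Int.toNat_of_nonneg (by omega)]
    push_cast; ring
  have hs1' := hstep (τ + ((-im : ℤ) : ZMod N))
  have hs2' := hstep (c (im + ip - 2).toNat)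
  rw [← hc0] at hs1'
  rw [hcl] at hs2'
  have hstr' := hstr (-im) 0 ip le_rfl (by omega) (by omega) le_rfl
  have hex1 := harc.exit_left
  have hex2 := harc.exit_right
  simp only [Int.cast_zero, add_zero] at hstr' hex1 hex2
  rw [dist_comm (γ τ) (γ (τ + ip))] at hstr'
  -- the two subfamilies are disjoint
  have hdisj : Disjoint (𝒰.filter fun U => ∃ i < k, t₀ + (i : ℕ) ∈ U)
      (𝒰.filter fun U => ∃ j : ℤ, -im < j ∧ j < ip ∧ τ + (j : ZMod N) ∈ U) := by
    rw [Finset.disjoint_left]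
    intro U h1 h2
    obtain ⟨hU, i, hi, hiU⟩ := Finset.mem_filter.1 h1
    obtain ⟨-, j, hj1, hj2, hjU⟩ := Finset.mem_filter.1 h2
    have h3 := dist_le_diam_image γ hiU hjU
    have h4 := hdiam U hU
    have h5 := hfar j hj1 hj2
    have h6 := hkin i hi
    have h7 := dist_triangle_left (γ t₀) (γ (τ + j)) (γ (t₀ + (i : ℕ)))
    have : lam * r ≤ s / 2 * r := by gcongr
    linarith
  -- No set is counted twice, so the two costs add up to more than `(2 + s / 2 - σ) * r - η`, which
  -- by `hpar` exceeds the cost of a cover witnessing that the ball is not thick.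
  have hsum : ∑ U ∈ 𝒰.filter (fun U => ∃ i < k, t₀ + (i : ℕ) ∈ U), coverCost γ η U +
      ∑ U ∈ 𝒰.filter (fun U => ∃ j : ℤ, -im < j ∧ j < ip ∧ τ + (j : ZMod N) ∈ U), coverCost γ η U ≤
      ∑ U ∈ 𝒰, coverCost γ η U := by
    rw [← Finset.sum_union hdisj]
    exact Finset.sum_le_sum_of_subset_of_nonneg
      (Finset.union_subset (Finset.filter_subset _ _) (Finset.filter_subset _ _))
      fun U _ _ => coverCost_nonneg γ hη U
  have e1 := dist_triangle (γ (t₀ + k)) (γ (t₀ + (k - 1 : ℕ))) (γ t₀)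
  rw [dist_comm] at hlast
  simp only [Nat.cast_zero, add_zero] at key1
  rw [dist_comm (γ t₀)] at key1
  have e2 := dist_triangle4 (γ (τ + ((-im : ℤ) : ZMod N))) (γ (c 0)) (γ (c (im + ip - 2).toNat))
    (γ (τ + ip))
  linarith

/-- Two forward edges of comparable length that start on a common piece of the chain violate the
two-opt inequality. -/
lemma IsForward.not_overlap {g : ℤ → X} {o y : ℤ} {b d : X} {ℓe ℓf δ ε : ℝ}
    (he : IsForward g b (8 * ℓe) δ ε) (hf : IsForward (fun j => g (o + j)) d (8 * ℓf) δ ε)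
    (hℓe : dist (g 0) b = ℓe) (hℓf : dist (g o) d = ℓf) (hfe : ℓf ≤ ℓe)
    (hδ : δ ≤ ℓf / 100) (hε : ε ≤ ℓf / 20) (hf0 : 0 < ℓf)
    (hy0 : 0 ≤ y) (hyo : o ≤ y) (hye : ∀ x, 0 ≤ x → x ≤ y → dist (g x) (g 0) < ℓe / 2)
    (hyf : ∀ x, o ≤ x → x ≤ y → dist (g x) (g o) < ℓf / 2)
    (hopt : ℓe + ℓf ≤ dist (g 0) (g o) + dist b d) : False := by
  obtain ⟨im, ip, hae, hse, jb, hjb0, hjb1, hjb⟩ := he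
  obtain ⟨imf, ipf, haf, hsf, jd, hjd0, hjd1, hjd⟩ := hf
  have hexr := hae.exit_right
  have hexl := hae.exit_left
  have hip := hae.ip_pos
  have him := hae.im_pos
  have himf := haf.im_pos
  simp only [IsStraight] at hsf
  -- `o` and `o + jd` lie on the arc
  have ho : -im < o := by
    by_contra! h
    have h1 := hyf (-im) h (by omega)
    have h2 := hyf 0 (by omega) hy0
    have h3 := dist_triangle_right (g (-im)) (g 0) (g o)
    linarith
  have hcd : dist (g o) (g (o + jd)) ≤ ℓf + ε := by
    have := dist_triangle (g o) d (g (o + jd))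
    linarith
  have hcd' : ℓf - ε ≤ dist (g o) (g (o + jd)) := by
    have := dist_triangle_right (g o) d (g (o + jd))
    linarith
  have hab : dist (g 0) (g jb) ≤ ℓe + ε := by
    have := dist_triangle (g 0) b (g jb)
    linarith
  have hab' : ℓe - ε ≤ dist (g 0) (g jb) := by
    have := dist_triangle_right (g 0) b (g jb)
    linarith
  -- Otherwise the chain would leave the ball of radius `8 * ℓe` between `g o` and `g (o + jd)`,
  -- although these are only about `ℓf ≤ ℓe` apart: too large a detour for the arc of `f`.
  have hd : o + jd < ip := by
    by_contra! h
    have hyip : y < ip := by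
      by_contra! h'
      have := hye ip hip.le h'
      linarith
    have h1 := hsf 0 (ip - o) jd (by omega) (by omega) (by omega) hjd1.le
    simp only [add_zero, add_sub_cancel] at h1
    have h2 := dist_triangle4 (g ip) (g o) (g y) (g 0)
    have h3 := hyf y hyo le_rfl
    have h4 := hye y hy0 le_rfl
    have h5 : 0 ≤ dist (g ip) (g (o + jd)) := dist_nonneg
    rw [dist_comm (g o) (g ip)] at h1
    rw [dist_comm (g o) (g y)] at h2
    linarith
  have hbd : dist b d ≤ ε + dist (g jb) (g (o + jd)) + ε := by
    have := dist_triangle4 b (g jb) (g (o + jd)) d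
    rw [dist_comm (g (o + jd)) d] at this
    linarith
  -- Tails and heads now lie nearly on a line, and only their order matters. If the edges are
  -- nested, the new edges have total length about the difference of `ℓe` and `ℓf`. If they
  -- interleave, about twice their overlap is saved, and `y` forces this overlap to be about half an
  -- edge or more. Either way `hopt` fails.
  rcases le_or_gt 0 o with ho0 | ho0
  · have hac := hye o ho0 hyo
    rw [dist_comm] at hac
    rcases le_or_gt jb o with hjo | hjo
    · have h1 := hse 0 jb o (by omega) hjb0.le hjo (by omega)
      have h2 : 0 ≤ dist (g jb) (g o) := dist_nonneg
      linarith
    have h1 := hse 0 o jb (by omega) ho0 hjo.le hjb1.le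
    rcases le_or_gt (o + jd) jb with hle | hle
    · have h2 := hse o (o + jd) jb (by omega) (by omega) hle hjb1.le
      rw [dist_comm (g jb)] at hbd
      linarith
    · have h2 := hse o jb (o + jd) (by omega) hjo.le hle.le hd.le
      have h3 := dist_triangle (g 0) (g o) (g jb)
      linarith
  · have hac := hyf 0 ho0.le hy0
    rcases le_or_gt (o + jd) 0 with hle | hle
    · have h1 := hse o (o + jd) 0 (by omega) (by omega) hle (by omega)
      have h2 : 0 ≤ dist (g (o + jd)) (g 0) := dist_nonneg
      rw [dist_comm (g o) (g 0)] at h1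
      linarith
    have h1 := hse o 0 (o + jd) (by omega) ho0.le hle.le hd.le
    rw [dist_comm (g o) (g 0)] at h1
    rcases le_or_gt (o + jd) jb with hle' | hle'
    · have h2 := hse 0 (o + jd) jb (by omega) hle.le hle' hjb1.le
      have h3 := dist_triangle (g o) (g 0) (g (o + jd))
      rw [dist_comm (g o) (g 0)] at h3
      rw [dist_comm (g jb)] at hbd
      linarith
    · have h2 := hse 0 jb (o + jd) (by omega) hjb0.le hle'.le hd.le
      linarith

end Arcs

end EuclideanTSP

namespace EuclideanTSP

/-! ### Excess of a coarse polygon -/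

section Excess

variable {X : Type*} [PseudoMetricSpace X] {N : ℕ}

/-- The excess of the polygon with `m` chords of `q` steps over the chord of its endpoints. -/
noncomputable def excess (γ : ZMod N → X) (q m : ℕ) (t : ZMod N) : ℝ :=
  ∑ v ∈ Finset.range m, dist (γ (t + (v * q : ℕ))) (γ (t + ((v + 1) * q : ℕ))) -
    dist (γ t) (γ (t + (m * q : ℕ)))

lemma excess_nonneg (γ : ZMod N → X) (q m : ℕ) (t : ZMod N) : 0 ≤ excess γ q m t := by
  have := dist_le_range_sum_dist (fun v : ℕ => γ (t + (v * q : ℕ))) m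
  simp only [Nat.zero_mul, Nat.cast_zero, add_zero] at this
  unfold excess
  linarith

lemma dist_le_mul_step (γ : ZMod N → X) {η : ℝ} (hstep : ∀ t, dist (γ t) (γ (t + 1)) ≤ η) (t : ZMod N)
    (k : ℕ) : dist (γ t) (γ (t + k)) ≤ k * η := by
  have := dist_le_range_sum_of_dist_le (f := fun v : ℕ => γ (t + (v : ℕ))) k (d := fun _ => η)
    (fun {v} _ => by simpa [add_assoc] using hstep (t + v))
  simpa using this

/-- A detour of the chain shows up in the excess at all suitable scales. -/
lemma detour_le_excess (γ : ZMod N → X) {η δ : ℝ} (hη : 0 ≤ η)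
    (hstep : ∀ t, dist (γ t) (γ (t + 1)) ≤ η) {q m : ℕ} (hq : 0 < q) (t : ZMod N) {i j k : ℕ}
    (hij : i ≤ j) (hjk : j ≤ k) (hk : k < m * q)
    (h : dist (γ (t + i)) (γ (t + k)) + δ < dist (γ (t + i)) (γ (t + j)) + dist (γ (t + j)) (γ (t + k))) :
    δ - 6 * (q * η) ≤ excess γ q m t := by
  set p : ℕ → X := fun v => γ (t + (v * q : ℕ)) with hp
  -- Rounding an index down to a multiple of `q` moves the point by at most `q * η`. Each of the
  -- three points enters two distances, hence the loss `6 * (q * η)`.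
  have hnear : ∀ i : ℕ, dist (γ (t + i)) (p (i / q)) ≤ q * η := by
    intro i
    have h1 := dist_le_mul_step γ hstep (t + (i / q * q : ℕ)) (i % q)
    have h2 : t + (i / q * q : ℕ) + (i % q : ℕ) = t + (i : ZMod N) := by
      rw [add_assoc, ← Nat.cast_add, Nat.div_add_mod']
    rw [h2, dist_comm] at h1
    refine h1.trans ?_
    gcongr
    exact (Nat.mod_lt _ hq).le
  have e1 := dist_le_Ico_sum_dist p (Nat.zero_le (i / q))
  have e2 := dist_le_Ico_sum_dist p (Nat.div_le_div_right (c := q) hij)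
  have e3 := dist_le_Ico_sum_dist p (Nat.div_le_div_right (c := q) hjk)
  have hkm : k / q ≤ m := ((Nat.div_lt_iff_lt_mul hq).2 hk).le
  have e4 := dist_le_Ico_sum_dist p hkm
  have hs : ∑ v ∈ Finset.range m, dist (p v) (p (v + 1)) =
      ∑ v ∈ Finset.Ico 0 (i / q), dist (p v) (p (v + 1)) +
      ∑ v ∈ Finset.Ico (i / q) (j / q), dist (p v) (p (v + 1)) +
      ∑ v ∈ Finset.Ico (j / q) (k / q), dist (p v) (p (v + 1)) +
      ∑ v ∈ Finset.Ico (k / q) m, dist (p v) (p (v + 1)) := by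
    rw [Finset.sum_Ico_consecutive _ (Nat.zero_le _) (Nat.div_le_div_right hij),
      Finset.sum_Ico_consecutive _ (Nat.zero_le _) (Nat.div_le_div_right hjk),
      Finset.sum_Ico_consecutive _ (Nat.zero_le _) hkm, Finset.range_eq_Ico]
  have hex : excess γ q m t = ∑ v ∈ Finset.range m, dist (p v) (p (v + 1)) - dist (p 0) (p m) := by
    simp [excess, hp]
  have t1 := dist_triangle4 (γ (t + i)) (p (i / q)) (p (j / q)) (γ (t + j))
  have t2 := dist_triangle4 (γ (t + j)) (p (j / q)) (p (k / q)) (γ (t + k))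
  have t3 := dist_triangle4 (p (i / q)) (γ (t + i)) (γ (t + k)) (p (k / q))
  have t4 := dist_triangle4 (p 0) (p (i / q)) (p (k / q)) (p m)
  have n1 := hnear i
  have n2 := hnear j
  have n3 := hnear k
  rw [dist_comm (p (i / q)) (γ (t + i))] at t3
  rw [dist_comm (p (j / q)) (γ (t + j))] at t1
  rw [dist_comm (p (k / q)) (γ (t + k))] at t2
  rw [hex, hs]
  linarith

end Excess

/-! ### Detours charged to drops of the average speed -/

section Detours

variable {X : Type*} [PseudoMetricSpace X] {N : ℕ} [NeZero N]

/-- The total length of all chords of a closed chain that span `q` steps. -/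
noncomputable def chordSum (γ : ZMod N → X) (q : ℕ) : ℝ := ∑ t, dist (γ t) (γ (t + q))

lemma chordSum_nonneg (γ : ZMod N → X) (q : ℕ) : 0 ≤ chordSum γ q :=
  Finset.sum_nonneg fun _ _ => dist_nonneg

lemma sum_shift (f : ZMod N → ℝ) (s : ZMod N) : ∑ t, f (t + s) = ∑ t, f t :=
  Equiv.sum_comp (Equiv.addRight s) f

lemma chordSum_two_mul_le (γ : ZMod N → X) (q : ℕ) : chordSum γ (2 * q) ≤ 2 * chordSum γ q := by
  have h : 2 * chordSum γ q = ∑ t, (dist (γ t) (γ (t + q)) + dist (γ (t + q)) (γ (t + q + q))) := by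
    rw [Finset.sum_add_distrib, sum_shift (fun t => dist (γ t) (γ (t + q))) (q : ZMod N)]
    unfold chordSum; ring
  rw [h]
  refine Finset.sum_le_sum fun t _ => ?_
  have : t + ((2 * q : ℕ) : ZMod N) = t + q + q := by push_cast; ring
  rw [this]
  exact dist_triangle _ _ _

/-- The average speed of the chain at scale `2 ^ u`. -/
noncomputable def chordMean (γ : ZMod N → X) (u : ℕ) : ℝ := chordSum γ (2 ^ u) / 2 ^ u

lemma chordMean_nonneg (γ : ZMod N → X) (u : ℕ) : 0 ≤ chordMean γ u :=
  div_nonneg (chordSum_nonneg _ _) (by positivity)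

/-- A chord of `2 * q` steps is at most the sum of its halves; summing over all starting points
gives monotonicity. The drop between two scales measures how much the chain bends there. -/
lemma chordMean_antitone (γ : ZMod N → X) : Antitone (chordMean γ) := by
  refine antitone_nat_of_succ_le fun u => ?_
  unfold chordMean
  rw [div_le_div_iff₀ (by positivity) (by positivity), pow_succ, pow_succ]
  have := chordSum_two_mul_le γ (2 ^ u)
  rw [mul_comm 2 (2 ^ u : ℕ)] at this
  nlinarith [pow_pos (two_pos : (0 : ℝ) < 2) u]

lemma chordMean_zero_le (γ : ZMod N → X) {η : ℝ} (hstep : ∀ t, dist (γ t) (γ (t + 1)) ≤ η) :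
    chordMean γ 0 ≤ N * η := by
  unfold chordMean chordSum
  simp only [pow_zero, Nat.cast_one, div_one]
  refine (Finset.sum_le_sum fun t _ => hstep t).trans ?_
  simp [ZMod.card]

/-- Each difference is a sum of `w` consecutive drops; summed over `u` first, each of the `w` sums
telescopes. Thus all scales together cost only `w * φ 0`, independently of `K`. -/
lemma sum_sub_shift_le {φ : ℕ → ℝ} (hφ : Antitone φ) (h0 : ∀ u, 0 ≤ φ u) (w K : ℕ) :
    ∑ u ∈ Finset.range K, (φ u - φ (u + w)) ≤ w * φ 0 := by
  have h1 : ∀ u, φ u - φ (u + w) = ∑ v ∈ Finset.range w, (φ (u + v) - φ (u + (v + 1))) := by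
    intro u
    rw [Finset.sum_range_sub' (fun v => φ (u + v))]
    simp
  simp_rw [h1]
  rw [Finset.sum_comm]
  calc _ ≤ ∑ v ∈ Finset.range w, φ 0 := by
        refine Finset.sum_le_sum fun v _ => ?_
        have := Finset.sum_range_sub' (fun u => φ (u + v)) K
        simp only [← add_assoc, add_right_comm _ v 1] at this ⊢
        rw [this]
        have := hφ (Nat.zero_le (0 + v))
        have := h0 (K + v)
        linarith
    _ = _ := by simp

/-- As `t` varies, every chord position runs through all chords of `q` steps. The total excess is
thus a drop of chord sums. -/
lemma sum_excess (γ : ZMod N → X) (q m : ℕ) :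
    ∑ t, excess γ q m t = m * chordSum γ q - chordSum γ (m * q) := by
  unfold excess
  rw [Finset.sum_sub_distrib, Finset.sum_comm]
  congr 1
  have : ∀ v : ℕ, ∑ t : ZMod N, dist (γ (t + (v * q : ℕ))) (γ (t + ((v + 1) * q : ℕ))) =
      chordSum γ q := by
    intro v
    rw [chordSum, ← sum_shift (fun t => dist (γ t) (γ (t + q))) ((v * q : ℕ) : ZMod N)]
    refine Finset.sum_congr rfl fun t _ => ?_
    have : t + ((v + 1) * q : ℕ) = t + (v * q : ℕ) + q := by push_cast; ring
    rw [this]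
  rw [Finset.sum_congr rfl fun v _ => this v]
  simp

/-- At a single scale, the total size of the detours is bounded by the drop of `chordSum`. -/
lemma sum_detour_le {E : Type*} (γ : ZMod N → X) {η : ℝ} (hη : 0 ≤ η)
    (hstep : ∀ t, dist (γ t) (γ (t + 1)) ≤ η) {q m h P : ℕ} (hq : 0 < q) (hm : m * q = 2 * h)
    (hhN : h ≤ N) (M : Finset E) (τ : E → ZMod N) (δ : E → ℝ)
    (hδ : ∀ e ∈ M, 12 * (q * η) ≤ δ e)
    (hdet : ∀ e ∈ M, ∃ i j k : ℕ, i ≤ j ∧ j ≤ k ∧ k ≤ h ∧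
      dist (γ (τ e + i)) (γ (τ e + k)) + δ e <
        dist (γ (τ e + i)) (γ (τ e + j)) + dist (γ (τ e + j)) (γ (τ e + k)))
    (hP : ∀ t, ∀ M' ⊆ M, (∀ e ∈ M', ∃ s < h, τ e = t + (s : ℕ)) → M'.card ≤ P) :
    h * ∑ e ∈ M, δ e ≤ 2 * P * (m * chordSum γ q - chordSum γ (m * q)) := by
  classical
  rw [← sum_excess]
  have h1 : ∀ e ∈ M, ∀ s ∈ Finset.range h, δ e ≤ 2 * excess γ q m (τ e - (s : ℕ)) := by
    intro e he s hs
    obtain ⟨i, j, k, hij, hjk, hk, hd⟩ := hdet e he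
    have := detour_le_excess (δ := δ e) γ hη hstep (m := m) hq (τ e - (s : ℕ)) (i := i + s)
      (j := j + s) (k := k + s) (by omega) (by omega)
      (by have := Finset.mem_range.1 hs; omega) (by
        have : ∀ i : ℕ, τ e - (s : ℕ) + ((i + s : ℕ) : ZMod N) = τ e + i := by
          intro i; push_cast; ring
        rw [this, this, this]; exact hd)
    have := hδ e he
    linarith
  have h2 : h * ∑ e ∈ M, δ e ≤ ∑ e ∈ M, ∑ s ∈ Finset.range h, 2 * excess γ q m (τ e - (s : ℕ)) := by
    rw [Finset.mul_sum]
    refine Finset.sum_le_sum fun e he => ?_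
    have := Finset.sum_le_sum (h1 e he)
    simpa using this
  refine h2.trans ?_
  -- As `h ≤ N`, the starting points of one edge are distinct. The double sum can be reordered by
  -- starting point, and each point then serves at most `P` edges.
  have h3 : ∀ e ∈ M, ∑ s ∈ Finset.range h, 2 * excess γ q m (τ e - (s : ℕ)) =
      ∑ t, if ∃ s < h, τ e = t + (s : ℕ) then 2 * excess γ q m t else 0 := by
    intro e _
    rw [← Finset.sum_filter]
    symm
    have : (Finset.univ.filter fun t => ∃ s < h, τ e = t + ((s : ℕ) : ZMod N)) =
        (Finset.range h).image fun s : ℕ => τ e - (s : ℕ) := by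
      ext t
      simp only [Finset.mem_filter, Finset.mem_univ, true_and, Finset.mem_image, Finset.mem_range]
      refine exists_congr fun s => and_congr_right fun _ => ?_
      rw [sub_eq_iff_eq_add]
    rw [this, Finset.sum_image]
    intro s hs s' hs' hss
    simp only [Finset.coe_range, Set.mem_Iio] at hs hs'
    have := sub_right_injective hss
    have := congrArg ZMod.val this
    rwa [ZMod.val_natCast_of_lt (by omega), ZMod.val_natCast_of_lt (by omega)] at this
  rw [Finset.sum_congr rfl h3, Finset.sum_comm, Finset.mul_sum]
  refine Finset.sum_le_sum fun t _ => ?_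
  rw [← Finset.sum_filter, Finset.sum_const, nsmul_eq_mul]
  have := hP t (M.filter fun e => ∃ s < h, τ e = t + (s : ℕ)) (Finset.filter_subset _ _)
    (fun e he => (Finset.mem_filter.1 he).2)
  have h4 : ((M.filter fun e => ∃ s < h, τ e = t + ((s : ℕ) : ZMod N)).card : ℝ) ≤ P := by
    exact_mod_cast this
  have := excess_nonneg γ q m t
  nlinarith

end Detours

/-! ### Packing of 2-optimal edges -/

section Packing

/-- The grid cells have side `x / 2`, hence diameter `x / √2 < x`. -/
lemma dist_lt_of_floor_eq {p q : Plane} {x : ℝ} (hx : 0 < x)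
    (h : ∀ i, ⌊2 * p i / x⌋ = ⌊2 * q i / x⌋) : dist p q < x := by
  have hc : ∀ i, |p i - q i| < x / 2 := by
    intro i
    have := Int.abs_sub_lt_one_of_floor_eq_floor (h i)
    rw [← sub_div, abs_div, abs_of_pos hx, div_lt_one hx, ← mul_sub, abs_mul, abs_two] at this
    linarith
  rw [EuclideanSpace.dist_eq, Fin.sum_univ_two, Real.sqrt_lt' hx]
  have h0 := hc 0
  have h1 := hc 1
  rw [Real.dist_eq, Real.dist_eq]
  have := abs_nonneg (p 0 - q 0)
  have := abs_nonneg (p 1 - q 1)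
  nlinarith

lemma floor_mem_Icc {p q : Plane} {x : ℝ} (hx : 0 < x) {C : ℕ} (h : dist p q ≤ C * x) (i : Fin 2) :
    ⌊2 * p i / x⌋ ∈ Finset.Icc (⌊2 * q i / x⌋ - (2 * C + 1)) (⌊2 * q i / x⌋ + (2 * C + 1)) := by
  have h1 : |p i - q i| ≤ C * x := by
    have := PiLp.norm_apply_le (p - q) i
    rw [← dist_eq_norm] at this
    exact le_trans (by simpa using this) h
  have h2 : |2 * p i / x - 2 * q i / x| ≤ 2 * C := by
    rw [← sub_div, abs_div, abs_of_pos hx, div_le_iff₀ hx, ← mul_sub, abs_mul, abs_two]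
    linarith
  rw [abs_le] at h2
  have a1 := Int.floor_le (2 * p i / x)
  have a2 := Int.lt_floor_add_one (2 * p i / x)
  have b1 := Int.floor_le (2 * q i / x)
  have b2 := Int.lt_floor_add_one (2 * q i / x)
  rw [Finset.mem_Icc]
  constructor
  · have : ((⌊2 * q i / x⌋ - (2 * C + 1) : ℤ) : ℝ) < (⌊2 * p i / x⌋ : ℝ) + 1 := by
      push_cast; linarith
    have : ⌊2 * q i / x⌋ - (2 * C + 1) < ⌊2 * p i / x⌋ + 1 := by exact_mod_cast this
    omega
  · have : ((⌊2 * p i / x⌋ : ℤ) : ℝ) < ((⌊2 * q i / x⌋ + (2 * C + 1) : ℤ) : ℝ) + 1 := by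
      push_cast; linarith
    have : ⌊2 * p i / x⌋ < ⌊2 * q i / x⌋ + (2 * C + 1) + 1 := by exact_mod_cast this
    omega

/-- Packing: only few edges of a two-optimal tour that have length at least `x` lie in a ball whose
radius is a multiple of `x`. -/
lemma card_le_of_two_opt {E : Type*} {a b : E → Plane} {x : ℝ} (hx : 0 < x) {C : ℕ} (p : Plane)
    (M : Finset E)
    (hopt : ∀ e ∈ M, ∀ f ∈ M, e ≠ f →
      dist (a e) (b e) + dist (a f) (b f) ≤ dist (a e) (a f) + dist (b e) (b f))
    (hlen : ∀ e ∈ M, x ≤ dist (a e) (b e)) (ha : ∀ e ∈ M, dist (a e) p ≤ C * x)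
    (hb : ∀ e ∈ M, dist (b e) p ≤ C * x) : M.card ≤ (4 * C + 3) ^ 4 := by
  classical
  let B : Fin 2 → Finset ℤ := fun i =>
    Finset.Icc (⌊2 * p i / x⌋ - (2 * C + 1)) (⌊2 * p i / x⌋ + (2 * C + 1))
  have hB : ∀ i, (B i).card = 4 * C + 3 := by
    intro i; simp only [B, Int.card_Icc]; omega
  let F : E → (ℤ × ℤ) × (ℤ × ℤ) := fun e =>
    ((⌊2 * a e 0 / x⌋, ⌊2 * a e 1 / x⌋), (⌊2 * b e 0 / x⌋, ⌊2 * b e 1 / x⌋))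
  have hF : ∀ e ∈ M, F e ∈ (B 0 ×ˢ B 1) ×ˢ (B 0 ×ˢ B 1) := by
    intro e he
    simp only [Finset.mem_product, F]
    exact ⟨⟨floor_mem_Icc hx (ha e he) 0, floor_mem_Icc hx (ha e he) 1⟩,
      ⟨floor_mem_Icc hx (hb e he) 0, floor_mem_Icc hx (hb e he) 1⟩⟩
  -- Two edges with tails in a common cell and heads in a common cell could be exchanged for edges
  -- of total length below `2 * x`, so pairs of cells count edges.
  have hinj : Set.InjOn F M := by
    intro e he f hf hef
    by_contra hne
    simp only [F, Prod.mk.injEq] at hef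
    have h1 : dist (a e) (a f) < x := dist_lt_of_floor_eq hx fun i => by
      fin_cases i
      · exact hef.1.1
      · exact hef.1.2
    have h2 : dist (b e) (b f) < x := dist_lt_of_floor_eq hx fun i => by
      fin_cases i
      · exact hef.2.1
      · exact hef.2.2
    have := hopt e he f hf hne
    have := hlen e he
    have := hlen f hf
    linarith
  refine (Finset.card_le_card_of_injOn F hF hinj).trans ?_
  simp only [Finset.card_product, hB]
  apply le_of_eq; ring

end Packing

end EuclideanTSP

namespace EuclideanTSP

/-! ### Forward edges occupy disjoint stretches -/

section Forward

variable {X : Type*} [PseudoMetricSpace X]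

lemma IsForward.mono {g : ℤ → X} {b : X} {r δ ε δ' ε' : ℝ} (h : IsForward g b r δ ε) (hδ : δ ≤ δ')
    (hε : ε ≤ ε') : IsForward g b r δ' ε' := by
  obtain ⟨im, ip, ha, hs, j, h0, h1, hj⟩ := h
  exact ⟨im, ip, ha, fun i j k hi hij hjk hk => (hs i j k hi hij hjk hk).trans (by linarith),
    j, h0, h1, hj.trans hε⟩

/-- Forward edges of comparable length occupy disjoint parts of the chain. -/
lemma sum_forward_le {N : ℕ} [NeZero N] {E : Type*} (γ : ZMod N → X) {η Q : ℝ} (hη : 0 ≤ η)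
    (hstep : ∀ t, dist (γ t) (γ (t + 1)) ≤ η) (hQ : 1 ≤ Q) (M : Finset E) (τ : E → ZMod N)
    (b : E → X) (ℓ : E → ℝ) (hℓ : ∀ e ∈ M, dist (γ (τ e)) (b e) = ℓ e) (hpos : ∀ e ∈ M, 0 < ℓ e)
    (hfor : ∀ e ∈ M, IsForward (fun j : ℤ => γ (τ e + j)) (b e) (8 * ℓ e) (ℓ e / (100 * Q))
      (ℓ e / (20 * Q)))
    (hratio : ∀ e ∈ M, ∀ f ∈ M, ℓ e ≤ Q * ℓ f)
    (hopt : ∀ e ∈ M, ∀ f ∈ M, e ≠ f →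
      ℓ e + ℓ f ≤ dist (γ (τ e)) (γ (τ f)) + dist (b e) (b f)) :
    ∑ e ∈ M, ℓ e ≤ 2 * N * η := by
  classical
  have hex : ∀ e ∈ M, ∃ k : ℕ, ℓ e / 2 ≤ dist (γ (τ e + k)) (γ (τ e)) := by
    intro e he
    obtain ⟨im, ip, ha, -⟩ := hfor e he
    have h1 := ha.exit_right
    have h2 := ha.ip_pos
    have h3 := hpos e he
    refine ⟨ip.toNat, ?_⟩
    have : ((ip.toNat : ℕ) : ZMod N) = (ip : ZMod N) := by
      rw [← Int.cast_natCast, Int.toNat_of_nonneg h2.le]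
    rw [this]
    simp only [Int.cast_zero, add_zero] at h1
    linarith
  choose! k hk using fun e he => Nat.find_spec (hex e he) |> fun h => (⟨Nat.find (hex e he), h,
    fun i hi => not_le.1 (Nat.find_min (hex e he) hi)⟩ : ∃ k : ℕ,
      ℓ e / 2 ≤ dist (γ (τ e + k)) (γ (τ e)) ∧
      ∀ i < k, dist (γ (τ e + (i : ℕ))) (γ (τ e)) < ℓ e / 2)
  -- `J e` is the stretch before the chain first gets `ℓ e / 2` away from the tail; it has at least
  -- `ℓ e / (2 * η)` steps. A common index of two stretches is the point `y` of
  -- `IsForward.not_overlap`.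
  let J : E → Finset (ZMod N) := fun e => (Finset.range (k e)).image fun i : ℕ => τ e + (i : ℕ)
  have hkN : ∀ e ∈ M, k e ≤ N := by
    intro e he
    by_contra! h
    have h1 := (hk e he).2 ((k e : ZMod N).val) ((ZMod.val_lt _).trans h)
    rw [ZMod.natCast_zmod_val] at h1
    linarith [(hk e he).1]
  have hJcard : ∀ e ∈ M, (J e).card = k e := by
    intro e he
    rw [Finset.card_image_of_injOn, Finset.card_range]
    intro i hi j hj hij
    simp only [Finset.coe_range, Set.mem_Iio] at hi hj
    have := congrArg ZMod.val (add_left_cancel hij)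
    have := hkN e he
    rwa [ZMod.val_natCast_of_lt (by omega), ZMod.val_natCast_of_lt (by omega)] at *
  have hJlen : ∀ e ∈ M, ℓ e ≤ 2 * η * (J e).card := by
    intro e he
    rw [hJcard e he]
    have h1 := dist_le_mul_step γ hstep (τ e) (k e)
    rw [dist_comm] at h1
    linarith [(hk e he).1]
  have main : ∀ e ∈ M, ∀ f ∈ M, e ≠ f → ℓ f ≤ ℓ e → Disjoint (J e) (J f) := by
    intro e he f hf hef hle
    rw [Finset.disjoint_left]
    intro t hte htf
    obtain ⟨i, hi, rfl⟩ := Finset.mem_image.1 hte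
    obtain ⟨j, hj, hij⟩ := Finset.mem_image.1 htf
    rw [Finset.mem_range] at hi hj
    have hτ : τ f = τ e + (((i : ℤ) - j : ℤ) : ZMod N) := by
      push_cast
      rw [← add_sub_assoc, ← hij]; ring
    have hr := hratio e he f hf
    have hf0 := hpos f hf
    have hle1 : ℓ e / Q ≤ ℓ f := by rw [div_le_iff₀ (by linarith)]; linarith
    have hle2 : ℓ f / Q ≤ ℓ f := div_le_self hf0.le hQ
    have c1 : ℓ e / (100 * Q) ≤ ℓ f / 100 := by
      rw [mul_comm, ← div_div]; gcongr
    have c2 : ℓ e / (20 * Q) ≤ ℓ f / 20 := by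
      rw [mul_comm, ← div_div]; gcongr
    have c3 : ℓ f / (100 * Q) ≤ ℓ f / 100 := by
      rw [mul_comm, ← div_div]; gcongr
    have c4 : ℓ f / (20 * Q) ≤ ℓ f / 20 := by
      rw [mul_comm, ← div_div]; gcongr
    have he' := (hfor e he).mono c1 c2
    have hf' := (hfor f hf).mono c3 c4
    have hfun : (fun x : ℤ => γ (τ f + x)) =
        fun x : ℤ => (fun y : ℤ => γ (τ e + y)) (((i : ℤ) - j) + x) := by
      funext x
      simp only [hτ]
      push_cast
      congr 1; ring
    rw [hfun] at hf'
    refine he'.not_overlap (y := i) hf' ?_ ?_ hle le_rfl le_rfl hf0 (by omega) (by omega) ?_ ?_ ?_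
    · simpa using hℓ e he
    · rw [← hτ]; exact hℓ f hf
    · intro x hx0 hxi
      obtain ⟨x, rfl⟩ := Int.eq_ofNat_of_zero_le hx0
      have := (hk e he).2 x (by omega)
      simpa using this
    · intro x hx0 hxi
      obtain ⟨x', hx'⟩ := Int.eq_ofNat_of_zero_le (sub_nonneg.2 hx0)
      have := (hk f hf).2 x' (by omega)
      rw [← hτ]
      have hx : τ e + (x : ZMod N) = τ f + (x' : ZMod N) := by
        have : x = (i - j) + (x' : ℤ) := by omega
        rw [hτ, this]; push_cast; ring
      rw [hx]
      exact this
    · have := hopt e he f hf hef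
      simp only [Int.cast_zero, add_zero]
      rw [← hτ]
      exact this
  have hdisj : (M : Set E).PairwiseDisjoint J := by
    intro e he f hf hef
    rcases le_total (ℓ f) (ℓ e) with h | h
    · exact main e he f hf hef h
    · exact (main f hf e he hef.symm h).symm
  calc ∑ e ∈ M, ℓ e ≤ ∑ e ∈ M, 2 * η * (J e).card := Finset.sum_le_sum hJlen
    _ = 2 * η * ((M.biUnion J).card : ℝ) := by
        rw [Finset.card_biUnion hdisj, ← Finset.mul_sum]; push_cast; rfl
    _ ≤ 2 * η * N := by
        have : (M.biUnion J).card ≤ N := by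
          simpa [ZMod.card] using Finset.card_le_univ (M.biUnion J)
        gcongr
    _ = _ := by ring

lemma IsArc.reverse {g : ℤ → X} {r : ℝ} {im ip : ℤ} (h : IsArc g r im ip) :
    IsArc (fun j => g (-j)) r ip im where
  im_pos := h.ip_pos
  ip_pos := h.im_pos
  mem j h1 h2 := by simpa using h.mem (-j) (by omega) (by omega)
  exit_right := by simpa using h.exit_left
  exit_left := by simpa using h.exit_right

lemma IsStraight.reverse {g : ℤ → X} {δ : ℝ} {im ip : ℤ} (h : IsStraight g δ im ip) :
    IsStraight (fun j => g (-j)) δ ip im := by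
  intro i j k hi hij hjk hk
  have := h (-k) (-j) (-i) (by omega) (by omega) (by omega) (by omega)
  rw [dist_comm (g (-i)) (g (-j)), dist_comm (g (-j)) (g (-k)), dist_comm (g (-i)) (g (-k))]
  linarith

end Forward

/-! ### Existence of arcs -/

section ExistsArc

variable {X : Type*} [PseudoMetricSpace X]

/-- A closed chain leaves a ball that does not contain all of it; the number of steps on the arc
through the center is bounded by the number of indices in the ball. -/
lemma exists_isArc {N : ℕ} [NeZero N] (γ : ZMod N → X) (τ t₀ : ZMod N) {r : ℝ} (hr : 0 ≤ r)
    (ht₀ : r < dist (γ t₀) (γ τ)) :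
    ∃ im ip : ℤ, IsArc (fun j : ℤ => γ (τ + j)) r im ip ∧
      im + ip ≤ Nat.card {t // dist (γ t) (γ τ) ≤ r} + 1 := by
  classical
  have key : ∀ ε : ℤ, ε = 1 ∨ ε = -1 → ∃ k : ℕ, 0 < k ∧
      r < dist (γ (τ + ((ε * k : ℤ) : ZMod N))) (γ τ) ∧
      ∀ i < k, dist (γ (τ + ((ε * i : ℤ) : ZMod N))) (γ τ) ≤ r := by
    intro ε hε
    have hex : ∃ k : ℕ, r < dist (γ (τ + ((ε * k : ℤ) : ZMod N))) (γ τ) := by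
      refine ⟨(ε * (t₀ - τ) : ZMod N).val, ?_⟩
      have : τ + ((ε * ((ε * (t₀ - τ) : ZMod N).val : ℤ) : ℤ) : ZMod N) = t₀ := by
        push_cast
        rw [ZMod.natCast_zmod_val]
        rcases hε with rfl | rfl <;> push_cast <;> ring
      rwa [this]
    refine ⟨Nat.find hex, ?_, Nat.find_spec hex, fun i hi => not_lt.1 (Nat.find_min hex hi)⟩
    rw [Nat.find_pos]
    simpa using hr
  obtain ⟨p, hp0, hp1, hp2⟩ := key 1 (Or.inl rfl)
  obtain ⟨m, hm0, hm1, hm2⟩ := key (-1) (Or.inr rfl)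
  have hin : ∀ j : ℤ, -(m : ℤ) < j → j < p → dist (γ (τ + j)) (γ τ) ≤ r := by
    intro j h1 h2
    rcases le_or_gt 0 j with h0 | h0
    · obtain ⟨i, rfl⟩ := Int.eq_ofNat_of_zero_le h0
      simpa using hp2 i (by omega)
    · obtain ⟨i, hi⟩ := Int.eq_ofNat_of_zero_le (neg_nonneg.2 h0.le)
      have : j = -1 * (i : ℤ) := by omega
      rw [this]
      exact hm2 i (by omega)
  refine ⟨m, p, ⟨by omega, by omega, ?_, ?_, ?_⟩, ?_⟩
  · intro j h1 h2; simpa using hin j h1 h2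
  · simpa using hp1
  · simpa using hm1
  · have hinj : ∀ i j : ℤ, -(m : ℤ) < i → j < p → i ≤ j → (i : ZMod N) = j → i = j := by
      intro i j hi hj hij h
      by_contra hne
      have hdvd : (N : ℤ) ∣ j - i := (ZMod.intCast_eq_intCast_iff_dvd_sub i j N).1 h
      have hle := Int.le_of_dvd (by omega) hdvd
      have hval := ZMod.val_lt (t₀ - τ - (i : ZMod N))
      have h1 := hin (i + (t₀ - τ - (i : ZMod N)).val) (by omega) (by omega)
      have h2 : τ + ((i + ((t₀ - τ - (i : ZMod N)).val : ℤ) : ℤ) : ZMod N) = t₀ := by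
        push_cast
        rw [ZMod.natCast_zmod_val]; ring
      rw [h2] at h1
      linarith
    have hcard := Finset.card_le_card_of_injOn (s := Finset.Ioo (-(m : ℤ)) p)
      (t := Finset.univ.filter fun t => dist (γ t) (γ τ) ≤ r) (fun j => τ + (j : ZMod N))
      (fun j hj => by
        have := Finset.mem_Ioo.1 hj
        simpa using hin j this.1 this.2)
      (fun i hi j hj hij => by
        have h1 := Finset.mem_Ioo.1 hi
        have h2 := Finset.mem_Ioo.1 hj
        have h3 := add_left_cancel hij
        rcases le_total i j with h | h
        · exact hinj i j h1.1 h2.2 h h3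
        · exact (hinj j i h2.1 h1.2 h h3.symm).symm)
    rw [Int.card_Ioo] at hcard
    rw [Nat.card_eq_fintype_card, Fintype.card_subtype]
    omega

end ExistsArc

end EuclideanTSP

namespace EuclideanTSP

/-! ### Dyadic length scales -/

section Scale

/-- The dyadic scale of the length `ℓ`, relative to the unit `η`. -/
noncomputable def lengthScale (η ℓ : ℝ) : ℕ := Nat.log 2 ⌊ℓ / η⌋₊

variable {η ℓ : ℝ}

/-- Lengths below `η` get the default scale 0, for which only the upper bound on `ℓ` holds; hence
the hypothesis `η ≤ ℓ`. -/
lemma two_pow_lengthScale_mul_le (hη : 0 < η) (h : η ≤ ℓ) : 2 ^ lengthScale η ℓ * η ≤ ℓ := by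
  have h1 : ⌊ℓ / η⌋₊ ≠ 0 := by
    rw [Nat.ne_zero_iff_zero_lt, Nat.floor_pos, one_le_div hη]; exact h
  have h2 : (2 ^ lengthScale η ℓ : ℝ) ≤ ⌊ℓ / η⌋₊ := by exact_mod_cast Nat.pow_log_le_self 2 h1
  have h3 := Nat.floor_le (div_nonneg (hη.le.trans h) hη.le)
  rw [← le_div_iff₀ hη]
  linarith

lemma lt_two_pow_lengthScale_mul (hη : 0 < η) (ℓ : ℝ) : ℓ < 2 ^ lengthScale η ℓ * η * 2 := by
  have h2 : ((⌊ℓ / η⌋₊ + 1 : ℕ) : ℝ) ≤ (2 ^ (lengthScale η ℓ + 1) : ℕ) := by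
    exact_mod_cast Nat.lt_pow_succ_log_self (by norm_num) _
  have h3 := Nat.lt_floor_add_one (ℓ / η)
  push_cast at h2
  rw [div_lt_iff₀ hη] at h3
  calc ℓ < (⌊ℓ / η⌋₊ + 1) * η := h3
    _ ≤ 2 ^ (lengthScale η ℓ + 1) * η := by gcongr
    _ = _ := by ring

lemma lengthScale_le (hη : 0 < η) {n : ℕ} (h : ℓ ≤ n * η) : lengthScale η ℓ ≤ Nat.log 2 n := by
  refine Nat.log_mono_right (Nat.floor_le_of_le ?_)
  rwa [div_le_iff₀ hη]

lemma le_lengthScale (hη : 0 < η) {u : ℕ} (h : 2 ^ u * η ≤ ℓ) : u ≤ lengthScale η ℓ := by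
  have h1 := lt_two_pow_lengthScale_mul hη ℓ
  have h2 : (2 : ℝ) ^ u < 2 ^ (lengthScale η ℓ + 1) := by
    rw [pow_succ]
    nlinarith
  have := (pow_lt_pow_iff_right₀ (by norm_num : (1 : ℝ) < 2)).1 h2
  omega

end Scale

/-! ### Heavy, huge and detour edges -/

section Classes

/-- No two of the given directed edges can be exchanged profitably. -/
def IsTwoOpt {E : Type*} (a b : E → Plane) (M : Finset E) : Prop :=
  ∀ e ∈ M, ∀ f ∈ M, e ≠ f →
    dist (a e) (b e) + dist (a f) (b f) ≤ dist (a e) (a f) + dist (b e) (b f)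

lemma IsTwoOpt.subset {E : Type*} {a b : E → Plane} {M M' : Finset E} (h : IsTwoOpt a b M)
    (hM : M' ⊆ M) : IsTwoOpt a b M' :=
  fun e he f hf => h e (hM he) f (hM hf)

/-- Packing for one dyadic scale: heads are at most `2 * x` away from tails, so tails near `p`
suffice after replacing `C` by `C + 2`. -/
lemma IsTwoOpt.card_le {E : Type*} {a b : E → Plane} {M : Finset E} (h : IsTwoOpt a b M) {x : ℝ}
    (hx : 0 < x) (C : ℕ) (p : Plane) (hlo : ∀ e ∈ M, x ≤ dist (a e) (b e))
    (hhi : ∀ e ∈ M, dist (a e) (b e) ≤ x * 2) (ha : ∀ e ∈ M, dist (a e) p ≤ C * x) :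
    M.card ≤ (4 * (C + 2) + 3) ^ 4 := by
  refine card_le_of_two_opt hx p M h hlo (fun e he => (ha e he).trans ?_) (fun e he => ?_)
  · push_cast; nlinarith
  · have h1 := dist_triangle_left (b e) p (a e)
    have := hhi e he
    have := ha e he
    push_cast; linarith

variable {N : ℕ} [NeZero N] {E : Type*} {γ : ZMod N → Plane} {η : ℝ} {M : Finset E}
  {τ β : E → ZMod N}

/-- Edges whose surroundings contain a large part of the chain. -/
lemma sum_heavy_le (hη : 0 < η) (hM : IsTwoOpt (fun e => γ (τ e)) (fun e => γ (β e)) M) {n : ℕ}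
    (hlo : ∀ e ∈ M, η ≤ dist (γ (τ e)) (γ (β e)))
    (hhi : ∀ e ∈ M, dist (γ (τ e)) (γ (β e)) ≤ n * η) {Q : ℝ}
    (hheavy : ∀ e ∈ M, 8 * Q * dist (γ (τ e)) (γ (β e)) ≤
      η * Nat.card {t // dist (γ t) (γ (τ e)) ≤ 8 * dist (γ (τ e)) (γ (β e))}) :
    8 * Q * ∑ e ∈ M, dist (γ (τ e)) (γ (β e)) ≤ N * η * ((Nat.log 2 n + 1) * 75 ^ 4) := by
  classical
  set ℓ : E → ℝ := fun e => dist (γ (τ e)) (γ (β e)) with hℓ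
  -- Double counting of pairs of an edge and an index in its ball. At the scale with unit `x` the
  -- radius is `8 * ℓ < 16 * x`, so packing with `C = 16` allows `(4 * 18 + 3) ^ 4` edges.
  have hcount : ∀ t : ZMod N, (M.filter fun e => dist (γ t) (γ (τ e)) ≤ 8 * ℓ e).card ≤
      (Nat.log 2 n + 1) * 75 ^ 4 := by
    intro t
    rw [Finset.card_eq_sum_card_fiberwise (f := fun e => lengthScale η (ℓ e))
      (t := Finset.range (Nat.log 2 n + 1))]
    · refine (Finset.sum_le_card_nsmul _ _ (75 ^ 4) fun u _ => ?_).trans (by simp)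
      have hx : (0 : ℝ) < 2 ^ u * η := by positivity
      refine (hM.subset (M' := _) ?_).card_le hx 16 (γ t) ?_ ?_ ?_
      · exact (Finset.filter_subset _ _).trans (Finset.filter_subset _ _)
      · intro e he
        simp only [Finset.mem_filter] at he
        rw [← he.2]
        exact two_pow_lengthScale_mul_le hη (hlo e he.1.1)
      · intro e he
        simp only [Finset.mem_filter] at he
        rw [← he.2]
        exact (lt_two_pow_lengthScale_mul hη _).le
      · intro e he
        simp only [Finset.mem_filter] at he
        have h1 := lt_two_pow_lengthScale_mul hη (ℓ e)
        rw [he.2] at h1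
        rw [dist_comm]
        refine he.1.2.trans ?_
        push_cast; linarith
    · intro e he
      simp only [Finset.coe_filter, Set.mem_ofPred_eq] at he
      simp only [Finset.coe_range, Set.mem_Iio, Nat.lt_succ_iff]
      exact lengthScale_le hη (hhi e he.1)
  calc 8 * Q * ∑ e ∈ M, ℓ e ≤ ∑ e ∈ M, η * Nat.card {t // dist (γ t) (γ (τ e)) ≤ 8 * ℓ e} := by
        rw [Finset.mul_sum]; exact Finset.sum_le_sum hheavy
    _ = η * ((∑ e ∈ M, (Finset.univ.filter fun t => dist (γ t) (γ (τ e)) ≤ 8 * ℓ e).card : ℕ) : ℝ) := by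
        rw [← Finset.mul_sum]
        push_cast
        congr 1
        refine Finset.sum_congr rfl fun e _ => ?_
        rw [Nat.card_eq_fintype_card, Fintype.card_subtype]
    _ = η * ((∑ t : ZMod N, (M.filter fun e => dist (γ t) (γ (τ e)) ≤ 8 * ℓ e).card : ℕ) : ℝ) := by
        simp only [Finset.card_filter]
        rw [Finset.sum_comm]
    _ ≤ η * ((∑ t : ZMod N, (Nat.log 2 n + 1) * 75 ^ 4 : ℕ) : ℝ) := by
        gcongr with t; exact hcount t
    _ = _ := by simp [ZMod.card]; ring

lemma dist_le_card_mul (hη : 0 ≤ η) (hstep : ∀ t, dist (γ t) (γ (t + 1)) ≤ η) (s t : ZMod N) :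
    dist (γ s) (γ t) ≤ N * η := by
  have h := dist_le_mul_step γ hstep s (t - s).val
  rw [ZMod.natCast_zmod_val, add_sub_cancel] at h
  refine h.trans ?_
  gcongr
  exact (ZMod.val_lt _).le

/-- Edges whose length is comparable to the length of the chain. -/
lemma card_huge_le (hη : 0 < η) (hstep : ∀ t, dist (γ t) (γ (t + 1)) ≤ η)
    (hM : IsTwoOpt (fun e => γ (τ e)) (fun e => γ (β e)) M) {Q : ℕ} (hQ : 0 < Q)
    (hhuge : ∀ e ∈ M, N * η ≤ 32 * Q * dist (γ (τ e)) (γ (β e))) :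
    M.card ≤ (128 * Q + 3) ^ 4 := by
  have hN : (0 : ℝ) < N := by exact_mod_cast Nat.pos_of_ne_zero (NeZero.ne N)
  have hQ' : (0 : ℝ) < Q := by exact_mod_cast hQ
  -- At this mesh the whole chain lies in a ball of radius `32 * Q` meshes, so packing applies to
  -- all huge edges at once.
  have hx : 0 < N * η / (32 * Q) := by positivity
  have hC : ((32 * Q : ℕ) : ℝ) * (N * η / (32 * Q)) = N * η := by push_cast; field_simp
  refine (card_le_of_two_opt hx (C := 32 * Q) (γ 0) M hM (fun e he => ?_) (fun e he => ?_)
    (fun e he => ?_)).trans (le_of_eq (by ring))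
  · rw [div_le_iff₀ (by positivity)]; linarith [hhuge e he]
  · rw [hC]; exact dist_le_card_mul hη.le hstep _ _
  · rw [hC]; exact dist_le_card_mul hη.le hstep _ _

/-- The chain through an edge that is neither heavy nor huge leaves the ball around its tail
quickly. -/
lemma exists_isArc_of_not_heavy {τ β : ZMod N} (hη : 0 < η) {m : ℕ}
    (hheavy : η * Nat.card {t // dist (γ t) (γ τ) ≤ 8 * dist (γ τ) (γ β)} <
      8 * 2 ^ m * dist (γ τ) (γ β))
    (hhuge : 32 * 2 ^ m * dist (γ τ) (γ β) < N * η) :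
    ∃ im ip : ℤ, IsArc (fun j : ℤ => γ (τ + j)) (8 * dist (γ τ) (γ β)) im ip ∧
      im + ip ≤ (2 ^ (lengthScale η (dist (γ τ) (γ β)) + m + 4) : ℕ) := by
  set ℓ := dist (γ τ) (γ β) with hℓ
  -- A ball containing the whole chain contains `N` indices; being not heavy then contradicts being
  -- not huge.
  have hout : ∃ t₀, 8 * ℓ < dist (γ t₀) (γ τ) := by
    by_contra! hall
    have : Nat.card {t // dist (γ t) (γ τ) ≤ 8 * ℓ} = N := by
      rw [Nat.card_congr (Equiv.subtypeUnivEquiv hall), Nat.card_eq_fintype_card, ZMod.card]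
    rw [this] at hheavy
    have : 0 ≤ 2 ^ m * ℓ := by positivity
    nlinarith
  obtain ⟨t₀, ht₀⟩ := hout
  obtain ⟨im, ip, harc, hcard⟩ := exists_isArc γ τ t₀ (by positivity) ht₀
  refine ⟨im, ip, harc, hcard.trans ?_⟩
  have h1 := lt_two_pow_lengthScale_mul hη ℓ
  have h2 : (Nat.card {t // dist (γ t) (γ τ) ≤ 8 * ℓ} : ℝ) < (2 ^ (lengthScale η ℓ + m + 4) : ℕ) := by
    have h3 : 8 * 2 ^ m * ℓ ≤ η * (2 ^ (lengthScale η ℓ + m + 4) : ℕ) := by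
      calc 8 * 2 ^ m * ℓ ≤ 8 * 2 ^ m * (2 ^ lengthScale η ℓ * η * 2) := by gcongr
        _ = _ := by push_cast; ring
    exact lt_of_mul_lt_mul_left (hheavy.trans_le h3) hη.le
  have h4 := Nat.succ_le_of_lt (Nat.cast_lt.1 h2)
  exact_mod_cast h4

/-- Edges whose surroundings contain a detour of the chain. -/
lemma sum_detour_edges_le (hη : 0 < η) (hstep : ∀ t, dist (γ t) (γ (t + 1)) ≤ η)
    (hM : IsTwoOpt (fun e => γ (τ e)) (fun e => γ (β e)) M) {n m : ℕ}
    (hlo : ∀ e ∈ M, 2 ^ (m + 12) * η ≤ dist (γ (τ e)) (γ (β e)))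
    (hhi : ∀ e ∈ M, dist (γ (τ e)) (γ (β e)) ≤ n * η)
    (hhuge : ∀ e ∈ M, 32 * 2 ^ m * dist (γ (τ e)) (γ (β e)) < N * η)
    (hdet : ∀ e ∈ M, ∃ im ip : ℤ, 0 < im ∧
      im + ip ≤ (2 ^ (lengthScale η (dist (γ (τ e)) (γ (β e))) + m + 4) : ℕ) ∧ 0 < ip ∧
      ¬ IsStraight (fun j : ℤ => γ (τ e + j)) (dist (γ (τ e)) (γ (β e)) / (250 * 2 ^ m)) im ip) :
    ∑ e ∈ M, dist (γ (τ e)) (γ (β e)) ≤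
      1000 * 2 ^ m * (256 * 2 ^ m + 11) ^ 4 * (2 * m + 18) * (N * η) := by
  classical
  set ℓ : E → ℝ := fun e => dist (γ (τ e)) (γ (β e)) with hℓ
  have hlo' : ∀ e ∈ M, η ≤ ℓ e := fun e he => le_trans (by
    have : (1 : ℝ) ≤ 2 ^ (m + 12) := one_le_pow₀ (by norm_num)
    nlinarith) (hlo e he)
  choose! im ip him hsum hip hns using hdet
  set P : ℕ := (256 * 2 ^ m + 11) ^ 4 with hP
  have hscale : ∀ v : ℕ, ∑ e ∈ M.filter (fun e => lengthScale η (ℓ e) = v + (m + 12)),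
      ℓ e / (250 * 2 ^ m) ≤ 4 * P * (chordMean γ v - chordMean γ (v + (2 * m + 18))) := by
    intro v
    set M' := M.filter (fun e => lengthScale η (ℓ e) = v + (m + 12)) with hM'
    rcases M'.eq_empty_or_nonempty with hem | ⟨e₀, he₀⟩
    · rw [hem, Finset.sum_empty]
      have := chordMean_antitone γ (Nat.le_add_right v (2 * m + 18))
      have : (0 : ℝ) ≤ P := Nat.cast_nonneg _
      nlinarith
    set u := v + (m + 12) with hu
    set h : ℕ := 2 ^ (u + m + 5) with hh
    have hmem : ∀ e ∈ M', e ∈ M ∧ lengthScale η (ℓ e) = u := fun e he => Finset.mem_filter.1 he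
    have hlow : ∀ e ∈ M', 2 ^ u * η ≤ ℓ e := fun e he => by
      rw [← (hmem e he).2]; exact two_pow_lengthScale_mul_le hη (hlo' e (hmem e he).1)
    have hupp : ∀ e ∈ M', ℓ e < 2 ^ u * η * 2 := fun e he => by
      rw [← (hmem e he).2]; exact lt_two_pow_lengthScale_mul hη _
    have hhN : h ≤ N := by
      have h1 := hhuge e₀ (hmem e₀ he₀).1
      have h2 := hlow e₀ he₀
      have h3 : (h : ℝ) * η ≤ N * η := by
        calc (h : ℝ) * η = 32 * 2 ^ m * (2 ^ u * η) := by rw [hh]; push_cast; ring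
          _ ≤ 32 * 2 ^ m * ℓ e₀ := by gcongr
          _ ≤ _ := h1.le
      exact_mod_cast le_of_mul_le_mul_right h3 hη
    have hlen : ∀ e ∈ M', im e + ip e ≤ h := fun e he => by
      have h1 := hsum e (hmem e he).1
      have h2 := (hmem e he).2
      simp only [hℓ] at h2
      rw [h2] at h1
      refine h1.trans ?_
      rw [hh]
      exact_mod_cast Nat.pow_le_pow_right (by norm_num) (by omega)
    -- The chords of `2 ^ v` steps, with `v = u - (m + 12)`, are short compared with a detour of
    -- size `ℓ / (250 * 2 ^ m)`, and `2 ^ (2 * m + 18)` of them span `2 * h` steps. Indices are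
    -- counted from the left end `τ e - im e` of the arc to make them nonnegative.
    have hres := sum_detour_le γ hη.le hstep (q := 2 ^ v) (m := 2 ^ (2 * m + 18)) (h := h) (P := P)
      (by positivity) (by rw [hh, hu]; ring) hhN M' (fun e => τ e - (im e : ZMod N))
      (fun e => ℓ e / (250 * 2 ^ m)) ?_ ?_ ?_
    · have e1 : chordSum γ (2 ^ v) = 2 ^ v * chordMean γ v := by
        unfold chordMean; field_simp
      have e2 : chordSum γ (2 ^ (2 * m + 18) * 2 ^ v) =
          2 ^ (2 * m + 18) * 2 ^ v * chordMean γ (v + (2 * m + 18)) := by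
        unfold chordMean
        rw [← pow_add, add_comm (2 * m + 18) v, ← pow_add, add_comm (2 * m + 18) v]
        field_simp
      rw [e1, e2] at hres
      have e3 : (2 : ℝ) ^ (2 * m + 18) * 2 ^ v = 2 * h := by
        rw [hh, hu]; push_cast; ring
      have h0 : (0 : ℝ) < h := by rw [hh]; positivity
      refine le_of_mul_le_mul_left (hres.trans (le_of_eq ?_)) h0
      push_cast
      rw [← mul_assoc ((2 : ℝ) ^ (2 * m + 18)), e3]
      ring
    · intro e he
      have := hlow e he
      rw [le_div_iff₀ (by positivity)]
      push_cast
      calc 12 * (2 ^ v * η) * (250 * 2 ^ m) = 3000 * (2 ^ v * 2 ^ m * η) := by ring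
        _ ≤ 4096 * (2 ^ v * 2 ^ m * η) := by gcongr; norm_num
        _ = 2 ^ u * η := by rw [hu]; ring
        _ ≤ ℓ e := this
    · intro e he
      have h1 := hns e (hmem e he).1
      unfold IsStraight at h1
      push Not at h1
      obtain ⟨i, j, k, hi, hij, hjk, hk, hlt⟩ := h1
      have h2 := hlen e he
      refine ⟨(i + im e).toNat, (j + im e).toNat, (k + im e).toNat, by omega, by omega, by omega, ?_⟩
      have hcast : ∀ x : ℤ, 0 ≤ x + im e →
          τ e - (im e : ZMod N) + (((x + im e).toNat : ℕ) : ZMod N) = τ e + x := by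
        intro x hx
        rw [← Int.cast_natCast, Int.toNat_of_nonneg hx]
        push_cast; ring
      rw [hcast i (by omega), hcast j (by omega), hcast k (by omega)]
      exact hlt
    · intro t M'' hM'' hs
      have hx : (0 : ℝ) < 2 ^ u * η := by positivity
      refine ((hM.subset (hM''.trans (Finset.filter_subset _ _))).card_le hx (64 * 2 ^ m) (γ t)
        (fun e he => hlow e (hM'' he)) (fun e he => (hupp e (hM'' he)).le) (fun e he => ?_)).trans
        (le_of_eq (by rw [hP]; ring))
      obtain ⟨s, hs, hτ⟩ := hs e he
      have h1 := hlen e (hM'' he)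
      have h2 := him e (hmem e (hM'' he)).1
      have h3 := hip e (hmem e (hM'' he)).1
      have h4 : τ e = t + ((s + (im e).toNat : ℕ) : ZMod N) := by
        have : (((im e).toNat : ℕ) : ZMod N) = (im e : ZMod N) := by
          rw [← Int.cast_natCast, Int.toNat_of_nonneg h2.le]
        rw [Nat.cast_add, this, ← add_assoc, ← hτ, sub_add_cancel]
      have h5 := dist_le_mul_step γ hstep t (s + (im e).toNat)
      rw [← h4, dist_comm] at h5
      refine h5.trans ?_
      have h6 : s + (im e).toNat ≤ 2 * h := by omega
      calc ((s + (im e).toNat : ℕ) : ℝ) * η ≤ ((2 * h : ℕ) : ℝ) * η := by gcongr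
        _ = _ := by rw [hh]; push_cast; ring
  -- Summed over the scales the drops telescope, so no factor `log n` appears.
  have htot : ∑ e ∈ M, ℓ e / (250 * 2 ^ m) ≤ 4 * P * ((2 * m + 18) * (N * η)) := by
    calc ∑ e ∈ M, ℓ e / (250 * 2 ^ m) = ∑ v ∈ Finset.range (Nat.log 2 n + 1),
        ∑ e ∈ M.filter (fun e => lengthScale η (ℓ e) - (m + 12) = v), ℓ e / (250 * 2 ^ m) := by
          rw [Finset.sum_fiberwise_of_maps_to]
          intro e he
          have := lengthScale_le hη (hhi e he)
          simp only [Finset.mem_range, hℓ]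
          omega
      _ = ∑ v ∈ Finset.range (Nat.log 2 n + 1),
        ∑ e ∈ M.filter (fun e => lengthScale η (ℓ e) = v + (m + 12)), ℓ e / (250 * 2 ^ m) := by
          refine Finset.sum_congr rfl fun v _ => Finset.sum_congr ?_ fun _ _ => rfl
          refine Finset.filter_congr fun e he => ?_
          have := le_lengthScale hη (hlo e he)
          simp only [hℓ]
          omega
      _ ≤ ∑ v ∈ Finset.range (Nat.log 2 n + 1),
          4 * P * (chordMean γ v - chordMean γ (v + (2 * m + 18))) :=
          Finset.sum_le_sum fun v _ => hscale v
      _ ≤ _ := by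
          rw [← Finset.mul_sum]
          refine mul_le_mul_of_nonneg_left ?_ (by positivity)
          refine (sum_sub_shift_le (chordMean_antitone γ) (chordMean_nonneg γ) _ _).trans ?_
          push_cast
          exact mul_le_mul_of_nonneg_left (chordMean_zero_le γ hstep) (by positivity)
  rw [← Finset.sum_div, div_le_iff₀ (by positivity)] at htot
  refine htot.trans (le_of_eq ?_)
  rw [hP]; push_cast; ring

end Classes

end EuclideanTSP

namespace EuclideanTSP

/-! ### Thick edges, forward edges and the total bound -/

section Selection

/-- A maximal subset of pairwise unrelated elements. -/
lemma exists_maximal_independent {E : Type*} (M : Finset E) (R : E → E → Prop)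
    (hR : ∀ e f, R e f → R f e) :
    ∃ S ⊆ M, (∀ e ∈ S, ∀ f ∈ S, e ≠ f → ¬ R e f) ∧ ∀ e ∈ M, ∃ f ∈ S, e = f ∨ R e f := by
  classical
  induction M using Finset.induction_on with
  | empty => exact ⟨∅, by simp⟩
  | insert x M hx ih =>
    obtain ⟨S, hS, hind, hdom⟩ := ih
    by_cases h : ∃ f ∈ S, R x f
    · refine ⟨S, hS.trans (Finset.subset_insert _ _), hind, fun e he => ?_⟩
      rcases Finset.mem_insert.1 he with rfl | he
      · obtain ⟨f, hf, hr⟩ := h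
        exact ⟨f, hf, Or.inr hr⟩
      · exact hdom e he
    · push Not at h
      refine ⟨insert x S, Finset.insert_subset_insert _ hS, ?_, fun e he => ?_⟩
      · intro e he f hf hef
        rcases Finset.mem_insert.1 he with rfl | he' <;>
          rcases Finset.mem_insert.1 hf with rfl | hf'
        · exact absurd rfl hef
        · exact h f hf'
        · exact fun hr => h e he' (hR _ _ hr)
        · exact hind e he' f hf' hef
      · rcases Finset.mem_insert.1 he with rfl | he
        · exact ⟨e, Finset.mem_insert_self _ _, Or.inl rfl⟩
        · obtain ⟨f, hf, hr⟩ := hdom e he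
          exact ⟨f, Finset.mem_insert_of_mem hf, hr⟩

variable {N : ℕ} [NeZero N] {E : Type*} {γ : ZMod N → Plane} {η : ℝ} {M : Finset E}
  {τ β : E → ZMod N}

/-- Edges around which the chain is thick. -/
lemma sum_thick_le (hη : 0 < η) (hM : IsTwoOpt (fun e => γ (τ e)) (fun e => γ (β e)) M) {m : ℕ}
    (hlo : ∀ e ∈ M, 500 * 2 ^ m * η ≤ dist (γ (τ e)) (γ (β e)))
    (hthick : ∀ e ∈ M, IsThick γ η (1 / (8000 * 2 ^ m)) (1 / (1000 * 2 ^ m)) (γ (τ e))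
      (8 * dist (γ (τ e)) (γ (β e)))) :
    ∑ e ∈ M, dist (γ (τ e)) (γ (β e)) ≤ 2 * 203 ^ 4 * (m + 16) * (250 * 2 ^ m) * (N * η) := by
  classical
  set ℓ : E → ℝ := fun e => dist (γ (τ e)) (γ (β e)) with hℓ
  set sc : E → ℕ := fun e => lengthScale η (ℓ e) with hsc
  have h2m : (1 : ℝ) ≤ 2 ^ m := one_le_pow₀ (by norm_num)
  have hlo' : ∀ e ∈ M, η ≤ ℓ e := fun e he => le_trans (by nlinarith) (hlo e he)
  have hlow : ∀ e ∈ M, 2 ^ sc e * η ≤ ℓ e := fun e he => two_pow_lengthScale_mul_le hη (hlo' e he)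
  have hupp : ∀ e, ℓ e < 2 ^ sc e * η * 2 := fun e => lt_two_pow_lengthScale_mul hη _
  -- Edges of one scale are thinned out until their tails are separated. The radii are `8 * ℓ < 16 *
  -- 2 ^ sc * η`, so 48 units exceed `r f + 2 * r e`.
  obtain ⟨S, hSM, hind, hdom⟩ := exists_maximal_independent M
    (fun e f => sc e = sc f ∧ dist (γ (τ e)) (γ (τ f)) ≤ 48 * (2 ^ sc f * η)) (by
      rintro e f ⟨h1, h2⟩
      exact ⟨h1.symm, by rw [dist_comm, h1]; exact h2⟩)
  -- Within a residue class modulo `m + 16`, different scales are at least a factor `2 ^ (m + 16)`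
  -- apart, which makes the smaller ball negligible at the tolerance `1 / (8000 * 2 ^ m)`.
  have hclass : ∀ c : ℕ, ∑ e ∈ S.filter (fun e => sc e % (m + 16) = c), ℓ e ≤
      250 * 2 ^ m * (N * η) := by
    intro c
    have h := sum_radius_le_of_isThick γ hη.le (lam := 1 / (8000 * 2 ^ m))
      (κ := 1 / (1000 * 2 ^ m)) (by positivity)
      (by rw [div_le_one (by positivity)]; nlinarith) (fun e => γ (τ e)) (fun e => 8 * ℓ e)
      (S.filter (fun e => sc e % (m + 16) = c)) ?_ ?_ ?_ ?_
    · rw [← Finset.mul_sum, ← Finset.mul_sum, ZMod.card] at h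
      have h3 : 1 / (1000 * 2 ^ m) / 2 * (8 * ∑ e ∈ S.filter (fun e => sc e % (m + 16) = c), ℓ e) =
          (∑ e ∈ S.filter (fun e => sc e % (m + 16) = c), ℓ e) / (250 * 2 ^ m) := by
        field_simp; ring
      rw [h3, div_le_iff₀ (by positivity)] at h
      linarith
    · intro e he
      have := hlo' e (hSM (Finset.mem_filter.1 he).1)
      linarith
    · intro e he
      exact hthick e (hSM (Finset.mem_filter.1 he).1)
    · intro e he f hf hef hle
      obtain ⟨heS, hec⟩ := Finset.mem_filter.1 he
      obtain ⟨hfS, hfc⟩ := Finset.mem_filter.1 hf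
      by_cases hs : sc e = sc f
      · right
        have h1 := hind e heS f hfS hef
        have h2 : 48 * (2 ^ sc f * η) < dist (γ (τ e)) (γ (τ f)) := by
          by_contra! h3; exact h1 ⟨hs, h3⟩
        have h3 := hupp e
        have h4 := hupp f
        rw [hs] at h3
        linarith
      · left
        have hlt : sc e < sc f := by
          by_contra! h1
          have h2 : sc f + 1 ≤ sc e := by omega
          have h3 := hlow e (hSM heS)
          have h4 := hupp f
          have h5 : (2 : ℝ) ^ (sc f + 1) ≤ 2 ^ sc e := pow_le_pow_right₀ (by norm_num) h2
          rw [pow_succ] at h5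
          nlinarith
        have hW : sc e + (m + 16) ≤ sc f := by
          by_contra! h1
          have h2 : (sc f - sc e) % (m + 16) = 0 :=
            Nat.sub_mod_eq_zero_of_mod_eq (hfc.trans hec.symm)
          rw [Nat.mod_eq_of_lt (by omega)] at h2
          omega
        have h3 := hlow f (hSM hfS)
        have h4 := hupp e
        have h5 : (2 : ℝ) ^ (sc e + (m + 16)) ≤ 2 ^ sc f := pow_le_pow_right₀ (by norm_num) hW
        rw [div_mul_eq_mul_div, le_div_iff₀ (by positivity)]
        calc 4 * (8 * ℓ e) * (8000 * 2 ^ m) = 8 * (32000 * 2 ^ m * ℓ e) := by ring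
          _ ≤ 8 * (32000 * 2 ^ m * (2 ^ sc e * η * 2)) := by gcongr
          _ ≤ 8 * (32768 * 2 ^ m * (2 ^ sc e * η * 2)) := by gcongr; norm_num
          _ = 8 * (2 ^ (sc e + (m + 16)) * η) := by ring
          _ ≤ 8 * (2 ^ sc f * η) := by gcongr
          _ ≤ 1 * (8 * ℓ f) := by linarith
    · intro e he
      have := hlo e (hSM (Finset.mem_filter.1 he).1)
      have h1 : η ≤ ℓ e / (500 * 2 ^ m) := by rw [le_div_iff₀ (by positivity)]; linarith
      have h2 : 1 / (1000 * 2 ^ m) / 2 * (8 * ℓ e) - 2 * (1 / (8000 * 2 ^ m)) * (8 * ℓ e) =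
        ℓ e / (500 * 2 ^ m) := by field_simp; ring
      linarith
  have hS : ∑ e ∈ S, ℓ e ≤ (m + 16) * (250 * 2 ^ m * (N * η)) := by
    calc ∑ e ∈ S, ℓ e = ∑ c ∈ Finset.range (m + 16),
          ∑ e ∈ S.filter (fun e => sc e % (m + 16) = c), ℓ e := by
          rw [Finset.sum_fiberwise_of_maps_to]
          intro e _
          exact Finset.mem_range.2 (Nat.mod_lt _ (by omega))
      _ ≤ ∑ c ∈ Finset.range (m + 16), 250 * 2 ^ m * (N * η) :=
          Finset.sum_le_sum fun c _ => hclass c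
      _ = _ := by simp
  choose! g hgS hg using hdom
  calc ∑ e ∈ M, ℓ e = ∑ f ∈ S, ∑ e ∈ M.filter (fun e => g e = f), ℓ e := by
        rw [Finset.sum_fiberwise_of_maps_to hgS]
    -- Every edge is charged to a selected edge of its own scale whose tail is within 48 units.
    -- Packing bounds the charges by `(4 * (48 + 2) + 3) ^ 4`, and lengths of one scale differ by a
    -- factor of at most 2.
    _ ≤ ∑ f ∈ S, 203 ^ 4 * (2 * ℓ f) := by
        refine Finset.sum_le_sum fun f hf => ?_
        have hx : (0 : ℝ) < 2 ^ sc f * η := by positivity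
        have hscale : ∀ e ∈ M.filter (fun e => g e = f), sc e = sc f := by
          intro e he
          obtain ⟨heM, rfl⟩ := Finset.mem_filter.1 he
          rcases hg e heM with h | h
          · rw [← h]
          · exact h.1
        have hcard := (hM.subset (Finset.filter_subset (fun e => g e = f) M)).card_le hx 48 (γ (τ f))
          (fun e he => by
            rw [← hscale e he]; exact hlow e (Finset.mem_filter.1 he).1)
          (fun e he => by
            rw [← hscale e he]; exact (hupp e).le)
          (fun e he => by
            obtain ⟨heM, rfl⟩ := Finset.mem_filter.1 he
            rcases hg e heM with h | h
            · rw [← h, dist_self]; positivity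
            · exact_mod_cast h.2)
        have hterm : ∀ e ∈ M.filter (fun e => g e = f), ℓ e ≤ 2 * ℓ f := by
          intro e he
          have h1 := hupp e
          have h2 := hlow f (hSM hf)
          rw [hscale e he] at h1
          linarith
        have h0 : 0 ≤ ℓ f := dist_nonneg
        calc _ ≤ ((M.filter (fun e => g e = f)).card : ℝ) * (2 * ℓ f) := by
              rw [← nsmul_eq_mul]; exact Finset.sum_le_card_nsmul _ _ _ hterm
          _ ≤ ((4 * (48 + 2) + 3) ^ 4 : ℕ) * (2 * ℓ f) := by gcongr
          _ = _ := by norm_num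
    _ = 2 * 203 ^ 4 * ∑ f ∈ S, ℓ f := by
        rw [Finset.mul_sum]
        exact Finset.sum_congr rfl fun _ _ => by ring
    _ ≤ 2 * 203 ^ 4 * ((m + 16) * (250 * 2 ^ m * (N * η))) := by gcongr
    _ = _ := by ring

/-- Edges along which the chain is directed. -/
lemma sum_forward_edges_le (hη : 0 < η) (hstep : ∀ t, dist (γ t) (γ (t + 1)) ≤ η)
    (hM : IsTwoOpt (fun e => γ (τ e)) (fun e => γ (β e)) M) {n m : ℕ} (hm : 0 < m)
    (hlo : ∀ e ∈ M, η ≤ dist (γ (τ e)) (γ (β e)))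
    (hhi : ∀ e ∈ M, dist (γ (τ e)) (γ (β e)) ≤ n * η)
    (hfor : ∀ e ∈ M, IsForward (fun j : ℤ => γ (τ e + j)) (γ (β e))
      (8 * dist (γ (τ e)) (γ (β e))) (dist (γ (τ e)) (γ (β e)) / (100 * 2 ^ m))
      (dist (γ (τ e)) (γ (β e)) / (20 * 2 ^ m))) :
    ∑ e ∈ M, dist (γ (τ e)) (γ (β e)) ≤ (Nat.log 2 n / m + 1 : ℕ) * (2 * (N * η)) := by
  classical
  set ℓ : E → ℝ := fun e => dist (γ (τ e)) (γ (β e)) with hℓ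
  set sc : E → ℕ := fun e => lengthScale η (ℓ e) with hsc
  -- Windows of `m` consecutive scales: lengths in one window are within a factor `2 ^ m`, so each
  -- window costs only `2 * (N * η)`.
  calc ∑ e ∈ M, ℓ e = ∑ c ∈ Finset.range (Nat.log 2 n / m + 1),
        ∑ e ∈ M.filter (fun e => sc e / m = c), ℓ e := by
        rw [Finset.sum_fiberwise_of_maps_to]
        intro e he
        rw [Finset.mem_range, Nat.lt_succ_iff]
        exact Nat.div_le_div_right (lengthScale_le hη (hhi e he))
    _ ≤ ∑ c ∈ Finset.range (Nat.log 2 n / m + 1), 2 * (N * η) := by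
        refine Finset.sum_le_sum fun c _ => ?_
        have hsub : M.filter (fun e => sc e / m = c) ⊆ M := Finset.filter_subset _ _
        refine (sum_forward_le γ hη.le hstep (Q := 2 ^ m) (one_le_pow₀ (by norm_num)) _ τ
          (fun e => γ (β e)) ℓ (fun _ _ => rfl) (fun e he => hη.trans_le (hlo e (hsub he)))
          (fun e he => hfor e (hsub he)) ?_ (hM.subset hsub)).trans (le_of_eq (by ring))
        intro e he f hf
        obtain ⟨heM, hec⟩ := Finset.mem_filter.1 he
        obtain ⟨hfM, hfc⟩ := Finset.mem_filter.1 hf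
        have h1 : sc e + 1 ≤ m + sc f := by
          have h2 := Nat.div_add_mod (sc e) m
          have h3 := Nat.div_add_mod (sc f) m
          have := Nat.mod_lt (sc e) hm
          rw [hec] at h2
          rw [hfc] at h3
          omega
        have h2 : ℓ e < 2 ^ sc e * η * 2 := lt_two_pow_lengthScale_mul hη _
        have h3 : 2 ^ sc f * η ≤ ℓ f := two_pow_lengthScale_mul_le hη (hlo f hfM)
        calc ℓ e ≤ 2 ^ (sc e + 1) * η := by rw [pow_succ]; linarith
          _ ≤ 2 ^ (m + sc f) * η := by gcongr; norm_num
          _ = 2 ^ m * (2 ^ sc f * η) := by ring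
          _ ≤ _ := by gcongr
    _ = _ := by simp

/-- An edge whose surroundings are neither thick nor contain a detour is directed along the
chain, or along the reversed chain. -/
lemma isForward_or_isForward_reverse (hη : 0 < η) (hstep : ∀ t, dist (γ t) (γ (t + 1)) ≤ η)
    {τ β : ZMod N} {m : ℕ} (hlo : 2 ^ (m + 14) * η ≤ dist (γ τ) (γ β)) {im ip : ℤ}
    (harc : IsArc (fun j : ℤ => γ (τ + j)) (8 * dist (γ τ) (γ β)) im ip)
    (hstr : IsStraight (fun j : ℤ => γ (τ + j)) (dist (γ τ) (γ β) / (250 * 2 ^ m)) im ip)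
    (hthin : ¬ IsThick γ η (1 / (8000 * 2 ^ m)) (1 / (1000 * 2 ^ m)) (γ τ)
      (8 * dist (γ τ) (γ β))) :
    IsForward (fun j : ℤ => γ (τ + j)) (γ β) (8 * dist (γ τ) (γ β))
      (dist (γ τ) (γ β) / (100 * 2 ^ m)) (dist (γ τ) (γ β) / (20 * 2 ^ m)) ∨
    IsForward (fun j : ℤ => γ (-(-τ + j))) (γ β) (8 * dist (γ τ) (γ β))
      (dist (γ τ) (γ β) / (100 * 2 ^ m)) (dist (γ τ) (γ β) / (20 * 2 ^ m)) := by
  set ℓ := dist (γ τ) (γ β) with hℓ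
  have h2m : (1 : ℝ) ≤ 2 ^ m := one_le_pow₀ (by norm_num)
  have hℓ0 : 0 < ℓ := lt_of_lt_of_le (by positivity) hlo
  have hη' : η ≤ ℓ / (16384 * 2 ^ m) := by
    rw [le_div_iff₀ (by positivity)]
    calc η * (16384 * 2 ^ m) = 2 ^ (m + 14) * η := by ring
      _ ≤ ℓ := hlo
  have hA : ℓ / (250 * 2 ^ m) = (1 / (2000 * 2 ^ m)) * (8 * ℓ) := by field_simp; norm_num
  have hstr' := hstr
  rw [hA] at hstr'
  -- The head `γ β` is itself a point of the chain, at distance `ℓ` from the center of a ball of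
  -- radius `8 * ℓ`, so it must be near the arc. The sign of `j` gives the direction.
  obtain ⟨j, hj1, hj2, hj⟩ := exists_arc_point_near γ hη.le hstep (s := 1 / (200 * 2 ^ m)) harc hstr'
    hthin (by positivity) (by positivity) (by rw [div_le_one (by positivity)]; nlinarith)
    (by rw [div_div]; gcongr ?_ / ?_ <;> linarith)
    (by
      have h1 : 1 / (200 * 2 ^ m) / 2 * (8 * ℓ) - (1 / (1000 * 2 ^ m) + 1 / (2000 * 2 ^ m)) * (8 * ℓ) =
        8 * (ℓ / (1000 * 2 ^ m)) := by field_simp; norm_num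
      have h2 : ℓ / (16384 * 2 ^ m) ≤ ℓ / (1000 * 2 ^ m) := by gcongr; norm_num
      have h3 : 0 ≤ ℓ / (1000 * 2 ^ m) := by positivity
      linarith) (t₀ := β) (by rw [dist_comm, ← hℓ]; linarith)
  have hj' : dist (γ β) (γ (τ + j)) ≤ ℓ / (20 * 2 ^ m) := by
    refine hj.trans ?_
    have : 1 / (200 * 2 ^ m) * (8 * ℓ) = ℓ / (25 * 2 ^ m) := by field_simp; norm_num
    rw [this]
    gcongr; norm_num
  have hδ : ℓ / (250 * 2 ^ m) ≤ ℓ / (100 * 2 ^ m) := by gcongr; norm_num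
  have hj0 : j ≠ 0 := by
    rintro rfl
    rw [Int.cast_zero, add_zero, dist_comm, ← hℓ, le_div_iff₀ (by positivity)] at hj'
    nlinarith
  rcases lt_or_gt_of_ne hj0 with h0 | h0
  · right
    have hrev : (fun j : ℤ => γ (-(-τ + j))) = fun j : ℤ => (fun i : ℤ => γ (τ + i)) (-j) := by
      funext j
      simp only
      congr 1; push_cast; ring
    rw [hrev]
    refine ⟨ip, im, harc.reverse, fun i j k hi hij hjk hk =>
      (hstr.reverse i j k hi hij hjk hk).trans (by linarith), -j, by omega, by omega, ?_⟩
    simpa using hj'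
  · left
    exact ⟨im, ip, harc, fun i j k hi hij hjk hk => (hstr i j k hi hij hjk hk).trans (by linarith),
      j, h0, hj2, hj'⟩

/-- The total length of the edges of a 2-optimal family of directed edges between points of a
closed chain. -/
theorem sum_dist_le_of_isTwoOpt (hη : 0 < η) (hstep : ∀ t, dist (γ t) (γ (t + 1)) ≤ η)
    (hM : IsTwoOpt (fun e => γ (τ e)) (fun e => γ (β e)) M) {n m : ℕ} (hm : 0 < m)
    (hN : N ≤ 2 * n) (hcard : M.card ≤ n) (hhi : ∀ e ∈ M, dist (γ (τ e)) (γ (β e)) ≤ n * η) :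
    ∑ e ∈ M, dist (γ (τ e)) (γ (β e)) ≤ n * η * (2 ^ (m + 14)
      + (Nat.log 2 n + 1) * 75 ^ 4 / 2 ^ m + (128 * 2 ^ m + 3) ^ 4
      + 2000 * 2 ^ m * (256 * 2 ^ m + 11) ^ 4 * (2 * m + 18)
      + 1000 * 203 ^ 4 * (m + 16) * 2 ^ m + 8 * (Nat.log 2 n / m + 1 : ℕ)) := by
  classical
  set ℓ : E → ℝ := fun e => dist (γ (τ e)) (γ (β e)) with hℓ
  have h2m : (1 : ℝ) ≤ 2 ^ m := one_le_pow₀ (by norm_num)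
  have hN' : (N : ℝ) * η ≤ 2 * (n * η) := by
    have : (N : ℝ) ≤ 2 * n := by exact_mod_cast hN
    nlinarith
  have hη1 : η ≤ 2 ^ (m + 14) * η := by
    have : (1 : ℝ) ≤ 2 ^ (m + 14) := one_le_pow₀ (by norm_num)
    nlinarith
  -- Every edge is assigned to the first of these classes that applies. What survives all of them is
  -- forward for the reversed chain.
  let ptiny : E → Prop := fun e => ℓ e < 2 ^ (m + 14) * η
  let pheavy : E → Prop := fun e => 8 * 2 ^ m * ℓ e ≤
    η * Nat.card {t // dist (γ t) (γ (τ e)) ≤ 8 * ℓ e}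
  let phuge : E → Prop := fun e => N * η ≤ 32 * 2 ^ m * ℓ e
  let pdet : E → Prop := fun e => ∃ im ip : ℤ, 0 < im ∧
      im + ip ≤ (2 ^ (lengthScale η (ℓ e) + m + 4) : ℕ) ∧ 0 < ip ∧
      ¬ IsStraight (fun j : ℤ => γ (τ e + j)) (ℓ e / (250 * 2 ^ m)) im ip
  let pthick : E → Prop := fun e =>
    IsThick γ η (1 / (8000 * 2 ^ m)) (1 / (1000 * 2 ^ m)) (γ (τ e)) (8 * ℓ e)
  let pfor : E → Prop := fun e => IsForward (fun j : ℤ => γ (τ e + j)) (γ (β e)) (8 * ℓ e)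
    (ℓ e / (100 * 2 ^ m)) (ℓ e / (20 * 2 ^ m))
  set M0 := M.filter fun e => ¬ ptiny e with hM0
  set M1 := M0.filter fun e => ¬ pheavy e with hM1
  set M2 := M1.filter fun e => ¬ phuge e with hM2
  set M3 := M2.filter fun e => ¬ pdet e with hM3
  set M4 := M3.filter fun e => ¬ pthick e with hM4
  have s0 : M0 ⊆ M := Finset.filter_subset _ _
  have s1 : M1 ⊆ M := (Finset.filter_subset _ _).trans s0
  have s2 : M2 ⊆ M := (Finset.filter_subset _ _).trans s1
  have s3 : M3 ⊆ M := (Finset.filter_subset _ _).trans s2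
  have s4 : M4 ⊆ M := (Finset.filter_subset _ _).trans s3
  have l0 : ∀ e ∈ M0, 2 ^ (m + 14) * η ≤ ℓ e := fun e he => not_lt.1 (Finset.mem_filter.1 he).2
  have l1 : ∀ e ∈ M1, 2 ^ (m + 14) * η ≤ ℓ e := fun e he => l0 e (Finset.mem_filter.1 he).1
  have l2 : ∀ e ∈ M2, 2 ^ (m + 14) * η ≤ ℓ e := fun e he => l1 e (Finset.mem_filter.1 he).1
  have l3 : ∀ e ∈ M3, 2 ^ (m + 14) * η ≤ ℓ e := fun e he => l2 e (Finset.mem_filter.1 he).1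
  have l4 : ∀ e ∈ M4, 2 ^ (m + 14) * η ≤ ℓ e := fun e he => l3 e (Finset.mem_filter.1 he).1
  have f1 := Finset.sum_filter_add_sum_filter_not M ptiny ℓ
  have f2 := Finset.sum_filter_add_sum_filter_not M0 pheavy ℓ
  have f3 := Finset.sum_filter_add_sum_filter_not M1 phuge ℓ
  have f4 := Finset.sum_filter_add_sum_filter_not M2 pdet ℓ
  have f5 := Finset.sum_filter_add_sum_filter_not M3 pthick ℓ
  have f6 := Finset.sum_filter_add_sum_filter_not M4 pfor ℓ
  have b1 : ∑ e ∈ M.filter ptiny, ℓ e ≤ n * η * 2 ^ (m + 14) := by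
    calc ∑ e ∈ M.filter ptiny, ℓ e ≤ (M.filter ptiny).card • (2 ^ (m + 14) * η) :=
          Finset.sum_le_card_nsmul _ _ _ fun e he => (Finset.mem_filter.1 he).2.le
      _ ≤ n • (2 ^ (m + 14) * η) :=
          nsmul_le_nsmul_left (by positivity) ((Finset.card_filter_le _ _).trans hcard)
      _ = _ := by rw [nsmul_eq_mul]; ring
  have b2 : ∑ e ∈ M0.filter pheavy, ℓ e ≤ n * η * ((Nat.log 2 n + 1) * 75 ^ 4 / 2 ^ m) := by
    have hs : M0.filter pheavy ⊆ M0 := Finset.filter_subset _ _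
    have := sum_heavy_le hη (hM.subset (hs.trans s0)) (n := n) (Q := 2 ^ m)
      (fun e he => hη1.trans (l0 e (hs he))) (fun e he => hhi e (s0 (hs he)))
      (fun e he => (Finset.mem_filter.1 he).2)
    rw [← mul_div_assoc, le_div_iff₀ (by positivity)]
    have h3 : (N : ℝ) * η * ((Nat.log 2 n + 1) * 75 ^ 4) ≤
      2 * (n * η) * ((Nat.log 2 n + 1) * 75 ^ 4) := by gcongr
    have h4 : 0 ≤ n * η * ((Nat.log 2 n + 1 : ℝ) * 75 ^ 4) := by positivity
    linarith
  have b3 : ∑ e ∈ M1.filter phuge, ℓ e ≤ n * η * (128 * 2 ^ m + 3) ^ 4 := by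
    have hs : M1.filter phuge ⊆ M1 := Finset.filter_subset _ _
    have := card_huge_le hη hstep (hM.subset (hs.trans s1)) (Q := 2 ^ m) (by positivity)
      (fun e he => by push_cast; exact (Finset.mem_filter.1 he).2)
    calc ∑ e ∈ M1.filter phuge, ℓ e ≤ (M1.filter phuge).card • (n * η) :=
          Finset.sum_le_card_nsmul _ _ _ fun e he => hhi e (s1 (hs he))
      _ ≤ (128 * 2 ^ m + 3) ^ 4 • (n * η) := nsmul_le_nsmul_left (by positivity) this
      _ = _ := by rw [nsmul_eq_mul]; push_cast; ring
  have b4 : ∑ e ∈ M2.filter pdet, ℓ e ≤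
      n * η * (2000 * 2 ^ m * (256 * 2 ^ m + 11) ^ 4 * (2 * m + 18)) := by
    have hs : M2.filter pdet ⊆ M2 := Finset.filter_subset _ _
    refine (sum_detour_edges_le hη hstep (hM.subset (hs.trans s2)) (n := n) (m := m)
      (fun e he => le_trans ?_ (l2 e (hs he))) (fun e he => hhi e (s2 (hs he)))
      (fun e he => not_le.1 (Finset.mem_filter.1 (hs he)).2)
      (fun e he => (Finset.mem_filter.1 he).2)).trans ?_
    · gcongr <;> norm_num
    · calc _ ≤ 1000 * 2 ^ m * (256 * 2 ^ m + 11) ^ 4 * (2 * m + 18) * (2 * (n * η)) := by gcongr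
        _ = _ := by ring
  have b5 : ∑ e ∈ M3.filter pthick, ℓ e ≤ n * η * (1000 * 203 ^ 4 * (m + 16) * 2 ^ m) := by
    have hs : M3.filter pthick ⊆ M3 := Finset.filter_subset _ _
    refine (sum_thick_le hη (hM.subset (hs.trans s3)) (m := m)
      (fun e he => le_trans ?_ (l3 e (hs he)))
      (fun e he => (Finset.mem_filter.1 he).2)).trans ?_
    · rw [pow_add]
      have : 0 ≤ 2 ^ m * η := by positivity
      nlinarith
    · calc _ ≤ 2 * 203 ^ 4 * (m + 16) * (250 * 2 ^ m) * (2 * (n * η)) := by gcongr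
        _ = _ := by ring
  -- Stated for any chain through the same endpoints, to serve both `γ` and its reversal;
  -- 2-optimality does not depend on the orientation of the chain.
  have bfor : ∀ (γ' : ZMod N → Plane) (τ' β' : E → ZMod N) (M' : Finset E), M' ⊆ M4 →
      (∀ t, dist (γ' t) (γ' (t + 1)) ≤ η) → (∀ e, γ' (τ' e) = γ (τ e)) →
      (∀ e, γ' (β' e) = γ (β e)) → (∀ e ∈ M', IsForward (fun j : ℤ => γ' (τ' e + j)) (γ (β e))
        (8 * ℓ e) (ℓ e / (100 * 2 ^ m)) (ℓ e / (20 * 2 ^ m))) →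
      ∑ e ∈ M', ℓ e ≤ n * η * (4 * (Nat.log 2 n / m + 1 : ℕ)) := by
    intro γ' τ' β' M' hs hst h1 h2 h3
    have h := sum_forward_edges_le (γ := γ') (τ := τ') (β := β') (M := M') (n := n) (m := m) hη hst
    simp only [h1, h2] at h
    refine (h (hM.subset (hs.trans s4)) hm (fun e he => hη1.trans (l4 e (hs he)))
      (fun e he => hhi e (s4 (hs he))) h3).trans ?_
    calc _ ≤ (Nat.log 2 n / m + 1 : ℕ) * (2 * (2 * (n * η))) := by gcongr
      _ = _ := by ring
  have b6 : ∑ e ∈ M4.filter pfor, ℓ e ≤ n * η * (4 * (Nat.log 2 n / m + 1 : ℕ)) :=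
    bfor γ τ β _ (Finset.filter_subset _ _) hstep (fun _ => rfl) (fun _ => rfl)
      fun e he => (Finset.mem_filter.1 he).2
  have b7 : ∑ e ∈ M4.filter (fun e => ¬ pfor e), ℓ e ≤ n * η * (4 * (Nat.log 2 n / m + 1 : ℕ)) := by
    refine bfor (fun t => γ (-t)) (fun e => -τ e) (fun e => -β e) _ (Finset.filter_subset _ _) ?_
      (fun _ => by simp only [neg_neg]) (fun _ => by simp only [neg_neg]) fun e he => ?_
    · intro t
      have := hstep (-(t + 1))
      rw [neg_add, neg_add_cancel_right, ← neg_add, dist_comm] at this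
      exact this
    · obtain ⟨he4, hnf⟩ := Finset.mem_filter.1 he
      obtain ⟨he3, hnt⟩ := Finset.mem_filter.1 he4
      obtain ⟨he2, hnd⟩ := Finset.mem_filter.1 he3
      obtain ⟨he1, hnhuge⟩ := Finset.mem_filter.1 he2
      obtain ⟨he0, hnheavy⟩ := Finset.mem_filter.1 he1
      obtain ⟨im, ip, harc, hlen⟩ := exists_isArc_of_not_heavy hη (not_le.1 hnheavy)
        (not_le.1 hnhuge)
      have hstr : IsStraight (fun j : ℤ => γ (τ e + j)) (ℓ e / (250 * 2 ^ m)) im ip := by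
        by_contra hns
        exact hnd ⟨im, ip, harc.im_pos, hlen, harc.ip_pos, hns⟩
      exact (isForward_or_isForward_reverse hη hstep (l4 e he4) harc hstr hnt).resolve_left hnf
  push_cast at b6 b7 ⊢
  linarith

end Selection

end EuclideanTSP

namespace EuclideanTSP

/-! ### Subdividing the optimal tour -/

section Subdivision

/-- A polygon can be subdivided into steps of length at most `η`. -/
lemma exists_subdivision (f : ℕ → Plane) {η : ℝ} (hη : 0 < η) (n : ℕ) :
    ∃ (N : ℕ) (g : ℕ → Plane), n ≤ N ∧ (N : ℝ) ≤ ∑ t ∈ Finset.range n, (dist (f t) (f (t + 1)) / η + 1) ∧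
      g 0 = f 0 ∧ g N = f n ∧ (∀ i < N, dist (g i) (g (i + 1)) ≤ η) ∧
      ∀ t ≤ n, ∃ s ≤ N, g s = f t := by
  induction n with
  | zero => exact ⟨0, fun _ => f 0, le_rfl, by simp, rfl, rfl, by simp, fun t ht => ⟨0, le_rfl, by simp_all⟩⟩
  | succ n ih =>
    obtain ⟨N, g, hnN, hN, h0, hend, hstep, hmem⟩ := ih
    -- The extra 1 makes the pieces no longer than `η`; over all edges it adds only `n` steps,
    -- whence `N ≤ 2 * n` for `η = length T / n`.
    set c : ℕ := ⌊dist (f n) (f (n + 1)) / η⌋₊ + 1 with hc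
    have hc0 : (0 : ℝ) < c := by rw [hc]; positivity
    have hc1 : (c : ℝ) ≤ dist (f n) (f (n + 1)) / η + 1 := by
      rw [hc]; push_cast
      have := Nat.floor_le (div_nonneg (dist_nonneg (x := f n) (y := f (n + 1))) hη.le)
      linarith
    have hc2 : dist (f n) (f (n + 1)) / c ≤ η := by
      have := Nat.lt_floor_add_one (dist (f n) (f (n + 1)) / η)
      rw [div_le_iff₀ hc0, ← div_le_iff₀' hη, hc]
      push_cast; exact this.le
    let q : ℕ → Plane := fun i => AffineMap.lineMap (f n) (f (n + 1)) (((i : ℝ) - N) / c)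
    let g' : ℕ → Plane := fun i => if i ≤ N then g i else q i
    have hg' : ∀ i, N ≤ i → g' i = q i := by
      intro i hi
      rcases hi.eq_or_lt with rfl | hi
      · simp [g', q, hend]
      · simp [g', not_le.2 hi]
    refine ⟨N + c, g', by omega, ?_, ?_, ?_, ?_, ?_⟩
    · rw [Finset.sum_range_succ]; push_cast; linarith
    · simp [g', h0]
    · rw [hg' _ (by omega)]
      simp [q]
    · intro i hi
      rcases lt_or_ge i N with h | h
      · simp only [g', if_pos h.le, if_pos (Nat.succ_le_of_lt h)]
        exact hstep i h
      · rw [hg' i h, hg' (i + 1) (by omega), dist_lineMap_lineMap]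
        refine le_trans (le_of_eq ?_) hc2
        rw [Real.dist_eq, ← sub_div]
        push_cast
        rw [sub_sub_sub_cancel_right, sub_add_cancel_left, abs_div, abs_neg, abs_one, abs_of_pos hc0]
        ring
    · intro t ht
      rcases Nat.le_succ_iff.1 ht with h | rfl
      · obtain ⟨s, hs, hst⟩ := hmem t h
        exact ⟨s, by omega, by simp only [g', if_pos hs, hst]⟩
      · refine ⟨N + c, le_rfl, ?_⟩
        rw [hg' _ (by omega)]
        simp [q]

lemma exists_closed_subdivision (f : ℕ → Plane) {η : ℝ} (hη : 0 < η) {n : ℕ} (hn : 0 < n)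
    (hf : f n = f 0) :
    ∃ (N : ℕ) (_ : NeZero N) (γ : ZMod N → Plane),
      (N : ℝ) ≤ ∑ t ∈ Finset.range n, (dist (f t) (f (t + 1)) / η + 1) ∧
      (∀ t, dist (γ t) (γ (t + 1)) ≤ η) ∧ ∀ t < n, ∃ s, γ s = f t := by
  obtain ⟨N, g, hnN, hN, h0, hend, hstep, hmem⟩ := exists_subdivision f hη n
  have hN0 : NeZero N := ⟨by omega⟩
  have hg : g N = g 0 := by rw [hend, h0, hf]
  refine ⟨N, hN0, fun s => g s.val, hN, fun t => ?_, fun t ht => ?_⟩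
  · have hlt := ZMod.val_lt t
    have h1 : g (t + 1).val = g (t.val + 1) := by
      rcases Nat.lt_or_ge (t.val + 1) N with h | h
      · rw [← ZMod.val_natCast_of_lt h]
        congr 2
        push_cast
        rw [ZMod.natCast_zmod_val]
      · have h2 : t.val + 1 = N := by omega
        have h3 : t + 1 = 0 := by
          have : ((t.val + 1 : ℕ) : ZMod N) = 0 := by rw [h2]; simp
          rwa [Nat.cast_add, ZMod.natCast_zmod_val, Nat.cast_one] at this
        rw [h3, h2, hg, ZMod.val_zero]
    have h2 := hstep _ hlt
    rw [← h1] at h2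
    exact h2
  · obtain ⟨s, hs, hst⟩ := hmem t ht.le
    rcases hs.eq_or_lt with rfl | hs
    · exact ⟨0, by simp only [ZMod.val_zero]; rw [← hg, hst]⟩
    · exact ⟨(s : ZMod N), by simp only; rw [ZMod.val_natCast_of_lt hs, hst]⟩

end Subdivision

/-- With mesh `length T / n`, every vertex of `S` is a point of the chain, and no edge of `S` is
longer than `n * η = length T`. The parameter `m` stays free for the final optimization. -/
lemma length_le_of_isKOptimal {k : ℕ} (hk : 2 ≤ k) {V : Finset Plane} (h3 : 3 ≤ V.card)
    {S T : Finset (Sym2 V)} (hS : IsKOptimal k S) (hT : IsTour T) {m : ℕ} (hm : 0 < m) :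
    length S ≤ length T * (2 ^ (m + 14)
      + (Nat.log 2 V.card + 1) * 75 ^ 4 / 2 ^ m + (128 * 2 ^ m + 3) ^ 4
      + 2000 * 2 ^ m * (256 * 2 ^ m + 11) ^ 4 * (2 * m + 18)
      + 1000 * 203 ^ 4 * (m + 16) * 2 ^ m + 8 * (Nat.log 2 V.card / m + 1 : ℕ)) := by
  set n := V.card with hn
  have hn0 : (0 : ℝ) < n := by exact_mod_cast (by omega : 0 < n)
  obtain ⟨f, hfper, hfV, hfsurj, hflen, -⟩ := hT.exists_periodic
  obtain ⟨g, hgper, hgV, hgsurj, hglen, hopt⟩ := hS.1.exists_periodic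
  have hL : 0 < length T := by
    obtain ⟨u, hu, v, hv, huv⟩ := Finset.one_lt_card.1 (by omega : 1 < V.card)
    exact (dist_pos.2 huv).trans_le (hT.dist_le_length hu hv)
  set η := length T / n with hη
  have hη0 : 0 < η := div_pos hL hn0
  have hnη : n * η = length T := by rw [hη]; field_simp
  obtain ⟨N, hN0, γ, hN, hstep, hγ⟩ := exists_closed_subdivision f hη0 (by omega : 0 < n)
    (by simpa using hfper 0)
  have hN2 : N ≤ 2 * n := by
    rw [Finset.sum_add_distrib, ← Finset.sum_div, ← hflen, ← hnη, mul_div_assoc, div_self hη0.ne'] at hN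
    simp only [Finset.sum_const, Finset.card_range, nsmul_eq_mul, mul_one] at hN
    have : (N : ℝ) ≤ (2 * n : ℕ) := by push_cast; linarith
    exact_mod_cast this
  have hpre : ∀ i, ∃ s, γ s = g i := by
    intro i
    obtain ⟨t, ht, hti⟩ := hfsurj (g i) (hgV i)
    obtain ⟨s, hs⟩ := hγ t ht
    exact ⟨s, hs.trans hti⟩
  choose τ hτ using hpre
  have h := sum_dist_le_of_isTwoOpt (M := Finset.range n) (τ := τ) (β := fun i => τ (i + 1)) hη0 hstep
    ?_ hm hN2 (by simp) ?_
  · simp only [hτ, hnη] at h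
    rw [hglen]
    exact h
  · intro i hi j hj hij
    simp only [hτ]
    rw [Finset.mem_range] at hi hj
    rcases lt_or_gt_of_ne hij with h | h
    · exact hopt k hk hS i j h hj
    · have := hopt k hk hS j i h hi
      rw [dist_comm (g i) (g j), dist_comm (g (i + 1)) (g (j + 1))]
      linarith
  · intro i _
    simp only [hτ, hnη]
    exact hT.dist_le_length (hgV _) (hgV _)

/-! ### Choice of the parameter in the upper bound -/

section UpperBound

/-- Put `Q = 2 ^ m`. As `m ≤ Q`, all terms except the heavy and the forward one are bounded by
polynomials in `Q` of degree at most 6, and `Q ^ 8 ≤ D` gives `Q ^ 6 ≤ D / m`. The heavy term is of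
order `D / Q ≤ D / m`. -/
lemma upper_bound_terms_le {D m : ℕ} (hm : 0 < m) (hD : 2 ^ (8 * m) ≤ D) :
    (2 : ℝ) ^ (m + 14) + (D + 1) * 75 ^ 4 / 2 ^ m + (128 * 2 ^ m + 3) ^ 4
      + 2000 * 2 ^ m * (256 * 2 ^ m + 11) ^ 4 * (2 * m + 18)
      + 1000 * 203 ^ 4 * (m + 16) * 2 ^ m + 8 * (D / m + 1 : ℕ) ≤
    (16384 + 2 * 75 ^ 4 + 131 ^ 4 + 40000 * 267 ^ 4 + 17000 * 203 ^ 4 + 16) * (D / m) := by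
  set Q : ℝ := 2 ^ m with hQ
  have hQ1 : 1 ≤ Q := one_le_pow₀ (by norm_num)
  have hm1 : (1 : ℝ) ≤ m := by exact_mod_cast hm
  have hmQ : (m : ℝ) ≤ Q := by
    rw [hQ]; exact_mod_cast Nat.lt_two_pow_self.le
  have hD' : Q ^ 8 ≤ D := by
    rw [hQ, ← pow_mul, mul_comm]; exact_mod_cast hD
  have hD1 : (1 : ℝ) ≤ D := (one_le_pow₀ hQ1).trans hD'
  set x : ℝ := D / m with hx
  have hx6 : Q ^ 6 ≤ x := by
    rw [hx, le_div_iff₀ (by linarith)]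
    calc Q ^ 6 * m ≤ Q ^ 6 * Q := by gcongr
      _ = Q ^ 7 := by ring
      _ ≤ Q ^ 8 := pow_le_pow_right₀ hQ1 (by norm_num)
      _ ≤ D := hD'
  have hpow : ∀ i ≤ 6, Q ^ i ≤ x := fun i hi => (pow_le_pow_right₀ hQ1 hi).trans hx6
  have t1 : (2 : ℝ) ^ (m + 14) ≤ 16384 * x := by
    rw [pow_add, ← hQ]
    have := hpow 1 (by norm_num)
    linarith
  have t2 : (D + 1) * 75 ^ 4 / Q ≤ 2 * 75 ^ 4 * x := by
    rw [hx, mul_div_assoc', div_le_div_iff₀ (by linarith) (by linarith)]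
    calc ((D : ℝ) + 1) * 75 ^ 4 * m ≤ (D + D) * 75 ^ 4 * Q := by gcongr
      _ = _ := by ring
  have t3 : (128 * Q + 3) ^ 4 ≤ 131 ^ 4 * x := by
    calc (128 * Q + 3) ^ 4 ≤ (131 * Q) ^ 4 := by gcongr; linarith
      _ = 131 ^ 4 * Q ^ 4 := by ring
      _ ≤ _ := by gcongr; exact hpow 4 (by norm_num)
  have t4 : 2000 * Q * (256 * Q + 11) ^ 4 * (2 * m + 18) ≤ 40000 * 267 ^ 4 * x := by
    calc 2000 * Q * (256 * Q + 11) ^ 4 * (2 * m + 18) ≤ 2000 * Q * (267 * Q) ^ 4 * (20 * Q) := by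
          gcongr <;> linarith
      _ = 40000 * 267 ^ 4 * Q ^ 6 := by ring
      _ ≤ _ := by gcongr
  have t5 : 1000 * 203 ^ 4 * (m + 16) * Q ≤ 17000 * 203 ^ 4 * x := by
    calc 1000 * 203 ^ 4 * (m + 16) * Q ≤ 1000 * 203 ^ 4 * (17 * Q) * Q := by gcongr; linarith
      _ = 17000 * 203 ^ 4 * Q ^ 2 := by ring
      _ ≤ _ := by gcongr; exact hpow 2 (by norm_num)
  have t6 : (8 : ℝ) * (D / m + 1 : ℕ) ≤ 16 * x := by
    have h1 : ((D / m : ℕ) : ℝ) ≤ x := Nat.cast_div_le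
    have h2 := hpow 0 (by norm_num)
    rw [pow_zero] at h2
    push_cast; linarith
  linarith

/-- The chosen `m` is the largest with `2 ^ (8 * m) ≤ log₂ n`, hence comparable to `log log n`. The
factor 32 collects `D ≤ 2 * log n` and `log log n ≤ 16 * m`. -/
lemma log_div_le {n : ℕ} (hn : 2 ^ 2 ^ 8 ≤ n) :
    (Nat.log 2 n : ℝ) / (Nat.log 2 (Nat.log 2 n) / 8 : ℕ) ≤
      32 * (Real.log n / Real.log (Real.log n)) := by
  set D := Nat.log 2 n with hD
  set m := Nat.log 2 D / 8 with hm
  have hn0 : n ≠ 0 := by rintro rfl; simp at hn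
  have hD8 : 2 ^ 8 ≤ D := Nat.le_log_of_pow_le (by norm_num) hn
  have hD0 : D ≠ 0 := by intro h; rw [h] at hD8; simp at hD8
  have hm0 : 0 < m := Nat.div_pos (Nat.le_log_of_pow_le (by norm_num) hD8) (by norm_num)
  have hDn : (2 : ℝ) ^ D ≤ n := by exact_mod_cast Nat.pow_log_le_self 2 hn0
  have hnD : (n : ℝ) < 2 ^ (D + 1) := by exact_mod_cast Nat.lt_pow_succ_log_self (by norm_num) n
  have hDm : (D : ℝ) < 2 ^ (8 * m + 8) := by
    have h1 : D < 2 ^ (Nat.log 2 D + 1) := Nat.lt_pow_succ_log_self (by norm_num) D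
    have h2 : Nat.log 2 D + 1 ≤ 8 * m + 8 := by omega
    exact_mod_cast h1.trans_le (Nat.pow_le_pow_right (by norm_num) h2)
  have hD3 : (256 : ℝ) ≤ D := by exact_mod_cast hD8
  have hnpos : (0 : ℝ) < n := by exact_mod_cast Nat.pos_of_ne_zero hn0
  have l1 : D * Real.log 2 ≤ Real.log n := by
    rw [← Real.log_pow]; exact Real.log_le_log (by positivity) hDn
  have l2 : Real.log n ≤ (D + 1) * Real.log 2 := by
    have := Real.log_le_log hnpos hnD.le
    rw [Real.log_pow] at this
    push_cast at this; exact this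
  have g1 := Real.log_two_gt_d9
  have g2 := Real.log_two_lt_d9
  have hlogn : Real.log n ≤ D := by nlinarith
  have hlogn' : (D : ℝ) ≤ 2 * Real.log n := by nlinarith
  have hlog3 : 128 ≤ Real.log n := by linarith
  have hll0 : 0 < Real.log (Real.log n) := Real.log_pos (by linarith)
  have hm1 : (1 : ℝ) ≤ m := by exact_mod_cast hm0
  have hll : Real.log (Real.log n) ≤ 16 * m := by
    have h1 := Real.log_le_log (by linarith) (hlogn.trans hDm.le)
    rw [Real.log_pow] at h1
    push_cast at h1
    nlinarith
  rw [mul_div_assoc', div_le_div_iff₀ (by linarith) hll0]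
  calc D * Real.log (Real.log n) ≤ 2 * Real.log n * (16 * m) := by gcongr
    _ = _ := by ring

/-- The approximation ratio of `k`-Opt is `O(log n / log log n)`. -/
theorem exists_kOptApproxRatio_le : ∃ C : ℝ, 0 < C ∧ ∀ n : ℕ, 2 ^ 2 ^ 8 ≤ n → ∀ k : ℕ, 2 ≤ k →
    kOptApproxRatio k n ≤ C * (Real.log n / Real.log (Real.log n)) := by
  refine ⟨(16384 + 2 * 75 ^ 4 + 131 ^ 4 + 40000 * 267 ^ 4 + 17000 * 203 ^ 4 + 16) * 32, by norm_num,
    fun n hn k hk => ?_⟩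
  have h3 : 3 ≤ n := le_trans (by norm_num) hn
  refine csSup_le (kOptRatios_nonempty k h3) ?_
  rintro _ ⟨V, hV, S, T, ⟨-, -, -, hS⟩, hT, rfl⟩
  set D := Nat.log 2 n with hD
  set m := Nat.log 2 D / 8 with hm
  have hD8 : 2 ^ 8 ≤ D := Nat.le_log_of_pow_le (by norm_num) hn
  have hm0 : 0 < m := Nat.div_pos (Nat.le_log_of_pow_le (by norm_num) hD8) (by norm_num)
  have hmD : 2 ^ (8 * m) ≤ D :=
    (Nat.pow_le_pow_right (by norm_num) (Nat.mul_div_le _ _)).trans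
      (Nat.pow_log_le_self 2 (by intro h; rw [h] at hD8; simp at hD8))
  have h1 := length_le_of_isKOptimal hk (by omega) hS hT.1 hm0
  rw [hV, ← hD] at h1
  have h2 := upper_bound_terms_le hm0 hmD
  have h4 := log_div_le hn
  rw [← hD, ← hm] at h4
  refine div_le_of_le_mul₀ (length_nonneg _) ?_ ?_
  · refine mul_nonneg (by norm_num) (le_trans (by positivity) (mul_le_mul_of_nonneg_left h4
      (by norm_num : (0 : ℝ) ≤ 1 / 32)) |>.trans (by linarith))
  · refine h1.trans ?_
    rw [mul_comm]
    refine mul_le_mul_of_nonneg_right (h2.trans ?_) (length_nonneg _)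
    rw [mul_assoc]
    exact mul_le_mul_of_nonneg_left h4 (by norm_num)

end UpperBound

end EuclideanTSP

namespace EuclideanTSP

/-! ### Lattice distances, degrees and crossing parity -/

section Lattice

/-- The embedding of the integer lattice in the plane. -/
noncomputable def latticePoint (p : ℤ × ℤ) : Plane := !₂[(p.1 : ℝ), (p.2 : ℝ)]

lemma latticePoint_injective : Function.Injective latticePoint := by
  intro p q h
  have h0 := congrArg (fun v : Plane => v 0) h
  have h1 := congrArg (fun v : Plane => v 1) h
  simp only [latticePoint, PiLp.toLp_apply, Matrix.cons_val_zero, Matrix.cons_val_one,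
    Int.cast_inj] at h0 h1
  exact Prod.ext h0 h1

/-- The Euclidean distance of two lattice points. -/
noncomputable def latticeDist (p q : ℤ × ℤ) : ℝ := dist (latticePoint p) (latticePoint q)

lemma latticeDist_eq_sqrt (p q : ℤ × ℤ) :
    latticeDist p q = Real.sqrt ((|p.1 - q.1| : ℤ) ^ 2 + (|p.2 - q.2| : ℤ) ^ 2 : ℝ) := by
  rw [latticeDist, EuclideanSpace.dist_eq, Fin.sum_univ_two]
  simp [latticePoint, Real.dist_eq]

lemma abs_fst_sub_le_latticeDist (p q : ℤ × ℤ) : ((|p.1 - q.1| : ℤ) : ℝ) ≤ latticeDist p q := by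
  rw [latticeDist_eq_sqrt]
  refine Real.le_sqrt_of_sq_le ?_
  nlinarith [sq_nonneg ((|p.2 - q.2| : ℤ) : ℝ)]

lemma one_le_latticeDist {p q : ℤ × ℤ} (h : p ≠ q) : 1 ≤ latticeDist p q := by
  rw [latticeDist_eq_sqrt]
  refine Real.le_sqrt_of_sq_le ?_
  have h1 : 1 ≤ |p.1 - q.1| ∨ 1 ≤ |p.2 - q.2| := by
    by_contra! hc
    exact h (Prod.ext (by have := abs_nonneg (p.1 - q.1); have := abs_eq_zero.1 (by omega : |p.1 - q.1| = 0); omega)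
      (by have := abs_nonneg (p.2 - q.2); have := abs_eq_zero.1 (by omega : |p.2 - q.2| = 0); omega))
  rcases h1 with h1 | h1
  · have h2 : (1 : ℝ) ≤ (|p.1 - q.1| : ℤ) := by exact_mod_cast h1
    nlinarith [sq_nonneg ((|p.2 - q.2| : ℤ) : ℝ)]
  · have h2 : (1 : ℝ) ≤ (|p.2 - q.2| : ℤ) := by exact_mod_cast h1
    nlinarith [sq_nonneg ((|p.1 - q.1| : ℤ) : ℝ)]

lemma latticeDist_of_snd_eq {p q : ℤ × ℤ} (h : p.2 = q.2) :
    latticeDist p q = (|p.1 - q.1| : ℤ) := by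
  rw [latticeDist_eq_sqrt, h]
  simp [Real.sqrt_sq_eq_abs]

lemma latticeDist_of_fst_eq {p q : ℤ × ℤ} (h : p.1 = q.1) :
    latticeDist p q = (|p.2 - q.2| : ℤ) := by
  rw [latticeDist_eq_sqrt, h]
  simp [Real.sqrt_sq_eq_abs]

/-- Minkowski's inequality for the total extents of a family of segments. -/
lemma sqrt_le_sum_latticeDist {ι : Type*} (A : Finset ι) (p q : ι → ℤ × ℤ) :
    Real.sqrt ((∑ e ∈ A, |(p e).1 - (q e).1| : ℤ) ^ 2 + (∑ e ∈ A, |(p e).2 - (q e).2| : ℤ) ^ 2 : ℝ) ≤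
      ∑ e ∈ A, latticeDist (p e) (q e) := by
  have h := norm_sum_le A fun e =>
    (!₂[((|(p e).1 - (q e).1| : ℤ) : ℝ), ((|(p e).2 - (q e).2| : ℤ) : ℝ)] : Plane)
  refine le_trans (le_of_eq ?_) (h.trans (le_of_eq (Finset.sum_congr rfl fun e _ => ?_)))
  · rw [EuclideanSpace.norm_eq, Fin.sum_univ_two]
    simp
  · rw [latticeDist_eq_sqrt, EuclideanSpace.norm_eq, Fin.sum_univ_two]
    simp

/-- Two families of edges have the same degrees. -/
def SameDegrees {ι : Type*} (p q : ι → ℤ × ℤ) (R A : Finset ι) : Prop :=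
  ∀ φ : ℤ × ℤ → ℤ, ∑ e ∈ R, (φ (p e) + φ (q e)) = ∑ e ∈ A, (φ (p e) + φ (q e))

/-- The unit gap between `g` and `g + 1` lies between `x` and `y`. -/
def Crosses (g x y : ℤ) : Prop := min x y ≤ g ∧ g < max x y

instance (g x y : ℤ) : Decidable (Crosses g x y) := inferInstanceAs (Decidable (_ ∧ _))

lemma crosses_iff_mem (g x y : ℤ) : Crosses g x y ↔ g ∈ Finset.Ico (min x y) (max x y) :=
  Finset.mem_Ico.symm

lemma card_crosses (x y : ℤ) : ((Finset.Ico (min x y) (max x y)).card : ℤ) = |x - y| := by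
  rw [Int.card_Ico, Int.toNat_of_nonneg (by omega), abs_sub_comm, max_sub_min_eq_abs]

variable {ι : Type*} {p q : ι → ℤ × ℤ} {R A : Finset ι}

lemma SameDegrees.card_eq (h : SameDegrees p q R A) : R.card = A.card := by
  have := h fun _ => 1
  simp only [Finset.sum_const, nsmul_eq_mul] at this
  push_cast at this
  omega

/-- An edge crosses the line exactly when one of its endpoints lies in the left half-plane. Modulo 2
the crossings count the degrees there, which both families share. -/
lemma SameDegrees.crosses_parity (h : SameDegrees p q R A) (g : ℤ) :
    (R.filter fun e => Crosses g (p e).1 (q e).1).card % 2 =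
      (A.filter fun e => Crosses g (p e).1 (q e).1).card % 2 := by
  have key : ∀ B : Finset ι, ((B.filter fun e => Crosses g (p e).1 (q e).1).card : ℤ) % 2 =
      (∑ e ∈ B, ((if (p e).1 ≤ g then 1 else 0) + (if (q e).1 ≤ g then 1 else 0))) % 2 := by
    intro B
    have h1 : ∀ e, ((if (p e).1 ≤ g then 1 else 0) + (if (q e).1 ≤ g then 1 else 0) : ℤ) =
        (if Crosses g (p e).1 (q e).1 then 1 else 0) +
          2 * (if max (p e).1 (q e).1 ≤ g then 1 else 0) := by
      intro e
      unfold Crosses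
      split_ifs <;> omega
    rw [Finset.sum_congr rfl fun e _ => h1 e, Finset.sum_add_distrib, ← Finset.mul_sum,
      Int.add_mul_emod_self_left, Finset.sum_boole]
  have := h fun v => if v.1 ≤ g then 1 else 0
  have h1 := key R
  have h2 := key A
  omega

/-- Families with the same degrees split along a set of points that no edge leaves. -/
lemma SameDegrees.split (h : SameDegrees p q R A) (P : ℤ × ℤ → Prop) [DecidablePred P]
    (hR : ∀ e ∈ R, (P (p e) ↔ P (q e))) (hA : ∀ e ∈ A, (P (p e) ↔ P (q e))) :
    SameDegrees p q (R.filter fun e => P (p e)) (A.filter fun e => P (p e)) := by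
  intro φ
  have key : ∀ B : Finset ι, (∀ e ∈ B, (P (p e) ↔ P (q e))) →
      ∑ e ∈ B.filter (fun e => P (p e)), (φ (p e) + φ (q e)) =
      ∑ e ∈ B, ((if P (p e) then φ (p e) else 0) + (if P (q e) then φ (q e) else 0)) := by
    intro B hB
    rw [Finset.sum_filter]
    refine Finset.sum_congr rfl fun e he => ?_
    by_cases hp : P (p e)
    · simp [hp, (hB e he).1 hp]
    · simp [hp, mt (hB e he).2 hp]
  rw [key R hR, key A hA]
  exact h fun v => if P v then φ v else 0

/-- Endpoints of `A` are endpoints of `R`: a point of degree zero in `R` has degree zero in `A`. -/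
lemma SameDegrees.forall_mem (h : SameDegrees p q R A) {P : ℤ × ℤ → Prop}
    (hR : ∀ e ∈ R, P (p e) ∧ P (q e)) : ∀ e ∈ A, P (p e) ∧ P (q e) := by
  classical
  have h1 := h fun v => if P v then 0 else 1
  rw [Finset.sum_eq_zero fun e he => by simp [hR e he], eq_comm,
    Finset.sum_eq_zero_iff_of_nonneg fun e _ => by split_ifs <;> norm_num] at h1
  intro e he
  have := h1 e he
  constructor <;> by_contra hP <;> simp only [if_neg hP] at this <;> split_ifs at this <;> omega

/-- Vertical lines that meet exactly one removed edge are met by the added edges. -/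
lemma SameDegrees.card_le_sum_crosses (h : SameDegrees p q R A) (G : Finset ℤ)
    (hG : ∀ g ∈ G, (R.filter fun e => Crosses g (p e).1 (q e).1).card = 1) :
    G.card ≤ ∑ e ∈ A, (G.filter fun g => Crosses g (p e).1 (q e).1).card := by
  simp only [Finset.card_filter]
  rw [Finset.sum_comm]
  simp only [← Finset.card_filter]
  rw [Finset.card_eq_sum_ones]
  refine Finset.sum_le_sum fun g hg => ?_
  have := h.crosses_parity g
  rw [hG g hg] at this
  omega

end Lattice

end EuclideanTSP

namespace EuclideanTSP

/-! ### No profitable exchange in the staircase -/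

section Levels

/-- The short edges of the staircase polygon. -/
def IsUnitEdge (M : ℤ) (v w : ℤ × ℤ) : Prop :=
  (v.1 = w.1 ∧ |v.2 - w.2| = 1 ∧ (v.1 ≤ 0 ∨ v.1 = M)) ∨
    (v.2 = w.2 ∧ |v.1 - w.1| = 1 ∧ ((v.1 ≤ 0 ∧ w.1 ≤ 0) ∨ v.2 = 0))

/-- The edges of length `ℓ` at height `z` of the staircase polygon. -/
def IsLevelEdge (ℓ z : ℤ) (v w : ℤ × ℤ) : Prop :=
  v.2 = z ∧ w.2 = z ∧ |v.1 - w.1| = ℓ ∧ ℓ ∣ v.1 ∧ 0 ≤ v.1 ∧ 0 ≤ w.1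

lemma IsUnitEdge.latticeDist_eq {M : ℤ} {v w : ℤ × ℤ} (h : IsUnitEdge M v w) :
    latticeDist v w = 1 := by
  rcases h with ⟨h1, h2, -⟩ | ⟨h1, h2, -⟩
  · rw [latticeDist_of_fst_eq h1, h2, Int.cast_one]
  · rw [latticeDist_of_snd_eq h1, h2, Int.cast_one]

lemma IsLevelEdge.latticeDist_eq {ℓ z : ℤ} {v w : ℤ × ℤ} (h : IsLevelEdge ℓ z v w) :
    latticeDist v w = ℓ := by
  rw [latticeDist_of_snd_eq (h.1.trans h.2.1.symm), h.2.2.1]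

lemma IsLevelEdge.exists_min_eq {ℓ z : ℤ} {v w : ℤ × ℤ} (h : IsLevelEdge ℓ z v w) :
    ∃ i, 0 ≤ i ∧ min v.1 w.1 = ℓ * i ∧ max v.1 w.1 = ℓ * i + ℓ := by
  obtain ⟨-, -, h3, ⟨i, hi⟩, h5, h6⟩ := h
  have hℓ : 0 ≤ ℓ := by rw [← h3]; exact abs_nonneg _
  rcases hℓ.eq_or_lt with rfl | hℓ
  · have := abs_eq_zero.1 h3
    exact ⟨0, le_rfl, by omega, by omega⟩
  rcases le_total v.1 w.1 with hvw | hvw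
  · rw [abs_of_nonpos (by omega)] at h3
    refine ⟨i, ?_, by omega, by omega⟩
    by_contra! hneg
    nlinarith
  · rw [abs_of_nonneg (by omega)] at h3
    refine ⟨i - 1, ?_, by rw [mul_sub]; omega, by rw [mul_sub]; omega⟩
    by_contra! hneg
    nlinarith

/-- Level edges span aligned intervals of length `ℓ`, so a vertical line determines the edge that it
meets on a given level. -/
lemma IsLevelEdge.min_eq_of_crosses {ℓ z g : ℤ} {v w : ℤ × ℤ} (h : IsLevelEdge ℓ z v w)
    (hg : Crosses g v.1 w.1) : min v.1 w.1 = ℓ * (g / ℓ) := by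
  obtain ⟨i, -, hi, hi'⟩ := h.exists_min_eq
  have hℓ : 0 < ℓ := by have := hg.1.trans_lt hg.2; omega
  have h1 := hg.1
  have h2 := hg.2
  rw [hi] at h1
  rw [hi'] at h2
  have : g / ℓ = i := by
    rw [Int.ediv_eq_iff_of_pos hℓ]
    constructor <;> nlinarith
  rw [this, hi]

lemma IsLevelEdge.sym2_eq {ℓ z : ℤ} {v w v' w' : ℤ × ℤ} (h : IsLevelEdge ℓ z v w)
    (h' : IsLevelEdge ℓ z v' w') (hmin : min v.1 w.1 = min v'.1 w'.1) : s(v, w) = s(v', w') := by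
  obtain ⟨i, -, hi, hi'⟩ := h.exists_min_eq
  obtain ⟨j, -, hj, hj'⟩ := h'.exists_min_eq
  have hmax : max v.1 w.1 = max v'.1 w'.1 := by omega
  obtain ⟨h1, h2, -⟩ := h
  obtain ⟨h1', h2', -⟩ := h'
  rw [Sym2.eq_iff]
  simp only [Prod.ext_iff]
  omega

variable {ι : Type*} {p q : ι → ℤ × ℤ} {R A : Finset ι}

/-- Long edges on one line and short edges that do not meet the relevant vertical lines cannot be
replaced profitably. -/
lemma SameDegrees.sum_le_of_level {ℓ z M : ℤ} (hℓ : 1 ≤ ℓ) (hM : ℓ ∣ M) (h : SameDegrees p q R A)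
    (hloop : ∀ e ∈ A, p e ≠ q e)
    (hR : ∀ e ∈ R, IsUnitEdge M (p e) (q e) ∨ IsLevelEdge ℓ z (p e) (q e))
    (hy : ∀ e ∈ R, 0 < (p e).2)
    (hinj : ∀ e ∈ R, ∀ f ∈ R, s(p e, q e) = s(p f, q f) → e = f) :
    ∑ e ∈ R, latticeDist (p e) (q e) ≤ ∑ e ∈ A, latticeDist (p e) (q e) := by
  classical
  set L := R.filter fun e => IsLevelEdge ℓ z (p e) (q e) with hL
  have hLmem : ∀ e ∈ L, e ∈ R ∧ IsLevelEdge ℓ z (p e) (q e) := fun e he => Finset.mem_filter.1 he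
  -- One test line per removed level edge, in the unit gap at its left end. Unit edges miss these
  -- lines: at positive height they are vertical or lie at `x ≤ 0`.
  set G := L.image fun e => min (p e).1 (q e).1 with hG
  have hGcard : G.card = L.card := by
    refine Finset.card_image_of_injOn fun e he f hf hef => ?_
    exact hinj e (hLmem e he).1 f (hLmem f hf).1 ((hLmem e he).2.sym2_eq (hLmem f hf).2 hef)
  have hGcross : ∀ g ∈ G, (R.filter fun e => Crosses g (p e).1 (q e).1).card = 1 := by
    intro g hg
    obtain ⟨e, he, rfl⟩ := Finset.mem_image.1 hg
    obtain ⟨heR, heL⟩ := hLmem e he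
    obtain ⟨i, hi0, hi, hi'⟩ := heL.exists_min_eq
    rw [Finset.card_eq_one]
    refine ⟨e, ?_⟩
    ext f
    simp only [Finset.mem_filter, Finset.mem_singleton]
    constructor
    · rintro ⟨hfR, hf⟩
      rcases hR f hfR with hu | hl
      · exfalso
        have h1 := hy f hfR
        have h2 : 0 ≤ ℓ * i := mul_nonneg (by omega) hi0
        rcases hu with ⟨hu1, -, -⟩ | ⟨-, -, hu⟩
        · have := hf.1.trans_lt hf.2; omega
        · have := hf.2; omega
      · refine hinj f hfR e heR (hl.sym2_eq heL ?_)
        exact (hl.min_eq_of_crosses hf).trans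
          (heL.min_eq_of_crosses ⟨le_rfl, by omega⟩).symm
    · rintro rfl
      exact ⟨heR, le_rfl, by omega⟩
  have hcount := h.card_le_sum_crosses G hGcross
  have hgood : ∀ e ∈ A, ((p e).1 ≤ 0 ∨ ℓ ∣ (p e).1) ∧ ((q e).1 ≤ 0 ∨ ℓ ∣ (q e).1) := by
    refine h.forall_mem (P := fun v => v.1 ≤ 0 ∨ ℓ ∣ v.1) fun e he => ?_
    rcases hR e he with (⟨h1, -, h2⟩ | ⟨h1, h2, h3⟩) | hl
    · rw [← h1, and_self]
      rcases h2 with h2 | h2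
      · exact Or.inl h2
      · right; rw [h2]; exact hM
    · have := hy e he
      rcases h3 with h3 | h3
      · exact ⟨Or.inl h3.1, Or.inl h3.2⟩
      · omega
    · obtain ⟨-, -, h3, h4, -⟩ := hl
      refine ⟨Or.inr h4, Or.inr ?_⟩
      have : ℓ ∣ (p e).1 - (q e).1 := by rw [← dvd_abs, h3]
      exact (dvd_sub_right h4).1 this
  -- Endpoints of added edges have `x ≤ 0` or `ℓ ∣ x`, so an edge crossing `c ≥ 1` test lines has
  -- extent at least `c * ℓ ≥ 1 + (ℓ - 1) * c`. For `c = 0` distinct lattice points are at distance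
  -- at least 1.
  have hlower : ∀ e ∈ A, 1 + ((ℓ : ℝ) - 1) * (G.filter fun g => Crosses g (p e).1 (q e).1).card ≤
      latticeDist (p e) (q e) := by
    intro e he
    set c := (G.filter fun g => Crosses g (p e).1 (q e).1).card with hc
    rcases Nat.eq_zero_or_pos c with h0 | h0
    · rw [h0, Nat.cast_zero, mul_zero, add_zero]
      exact one_le_latticeDist (hloop e he)
    refine le_trans ?_ (abs_fst_sub_le_latticeDist _ _)
    have hdiv : ∀ x y : ℤ, (x ≤ 0 ∨ ℓ ∣ x) → (y ≤ 0 ∨ ℓ ∣ y) → x ≤ y →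
        ((G.filter fun g => x ≤ g ∧ g < y).card : ℤ) * ℓ ≤ y - x ∨
          (G.filter fun g => x ≤ g ∧ g < y).card = 0 := by
      intro x y hx hy' hxy
      rw [or_iff_not_imp_right]
      intro hne
      obtain ⟨g, hg⟩ := Finset.card_ne_zero.1 hne
      have hmemG : ∀ g ∈ G, ∃ i, 0 ≤ i ∧ g = ℓ * i := by
        intro g hg
        obtain ⟨f, hf, rfl⟩ := Finset.mem_image.1 hg
        obtain ⟨i, hi, hi', -⟩ := (hLmem f hf).2.exists_min_eq
        exact ⟨i, hi, hi'⟩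
      simp only [Finset.mem_filter] at hg
      obtain ⟨i, hi, rfl⟩ := hmemG g hg.1
      have hpos : 0 ≤ ℓ * i := mul_nonneg (by omega) hi
      obtain ⟨b, rfl⟩ : ℓ ∣ y := hy'.resolve_left (by omega)
      obtain ⟨a, ha0, ha⟩ : ∃ a, x ≤ ℓ * a ∧ ∀ j, 0 ≤ j → x ≤ ℓ * j → a ≤ j := by
        rcases hx with hx | ⟨a, rfl⟩
        · exact ⟨0, by omega, fun j hj _ => hj⟩
        · exact ⟨a, le_rfl, fun j _ hj => le_of_mul_le_mul_left hj (by omega)⟩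
      have hsub : (G.filter fun g => x ≤ g ∧ g < ℓ * b) ⊆ (Finset.Ico a b).image fun j => ℓ * j := by
        intro g hg
        obtain ⟨hgG, hg1, hg2⟩ := Finset.mem_filter.1 hg
        obtain ⟨j, hj, rfl⟩ := hmemG g hgG
        exact Finset.mem_image.2 ⟨j, Finset.mem_Ico.2 ⟨ha j hj hg1,
          lt_of_mul_lt_mul_left hg2 (by omega)⟩, rfl⟩
      have hcard := (Finset.card_le_card hsub).trans Finset.card_image_le
      rw [Int.card_Ico] at hcard
      have hab : a ≤ b := by
        have h1 := ha i hi hg.2.1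
        have h2 : i < b := lt_of_mul_lt_mul_left hg.2.2 (by omega)
        omega
      have hcard' : ((G.filter fun g => x ≤ g ∧ g < ℓ * b).card : ℤ) ≤ b - a := by omega
      nlinarith
    have hmm : c * ℓ ≤ |(p e).1 - (q e).1| := by
      rw [abs_sub_comm, ← max_sub_min_eq_abs]
      obtain ⟨h1, h2⟩ := hgood e he
      refine (hdiv _ _ ?_ ?_ min_le_max).resolve_right h0.ne'
      · rcases min_choice (p e).1 (q e).1 with h | h <;> rw [h] <;> assumption
      · rcases max_choice (p e).1 (q e).1 with h | h <;> rw [h] <;> assumption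
    have hmm' : (c : ℝ) * ℓ ≤ (|(p e).1 - (q e).1| : ℤ) := by exact_mod_cast hmm
    have : (1 : ℝ) ≤ c := by exact_mod_cast h0
    linarith
  have hupper : ∑ e ∈ R, latticeDist (p e) (q e) ≤ R.card + ((ℓ : ℝ) - 1) * L.card := by
    have h1 : ∀ e ∈ R, latticeDist (p e) (q e) ≤
        1 + ((ℓ : ℝ) - 1) * (if IsLevelEdge ℓ z (p e) (q e) then 1 else 0) := by
      intro e he
      have hℓ' : (1 : ℝ) ≤ ℓ := by exact_mod_cast hℓ
      rcases hR e he with hu | hl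
      · rw [hu.latticeDist_eq]
        split_ifs <;> linarith
      · rw [hl.latticeDist_eq, if_pos hl]; linarith
    refine (Finset.sum_le_sum h1).trans (le_of_eq ?_)
    rw [Finset.sum_add_distrib, ← Finset.mul_sum, Finset.sum_boole]
    simp [hL]
  have hℓ' : (0 : ℝ) ≤ (ℓ : ℝ) - 1 := by
    have : (1 : ℝ) ≤ ℓ := by exact_mod_cast hℓ
    linarith
  calc _ ≤ (R.card : ℝ) + ((ℓ : ℝ) - 1) * L.card := hupper
    _ ≤ A.card + ((ℓ : ℝ) - 1) *
        ∑ e ∈ A, ((G.filter fun g => Crosses g (p e).1 (q e).1).card : ℝ) := by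
        rw [h.card_eq, ← hGcard]
        gcongr
        exact_mod_cast hcount
    _ = ∑ e ∈ A, (1 + ((ℓ : ℝ) - 1) * (G.filter fun g => Crosses g (p e).1 (q e).1).card) := by
        rw [Finset.sum_add_distrib, ← Finset.mul_sum]; simp
    _ ≤ _ := Finset.sum_le_sum hlower

/-- The heights of the levels of the staircase polygon. -/
def levelHeight (k b : ℕ) : ℕ → ℤ
  | 0 => 0
  | t + 1 => levelHeight k b t + 4 * k * b ^ (2 * t + 1)

lemma levelHeight_mono (k b : ℕ) : Monotone (levelHeight k b) :=
  monotone_nat_of_le_succ fun t => by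
    have : (0 : ℤ) ≤ 4 * k * b ^ (2 * t + 1) := by positivity
    simp only [levelHeight]; omega

lemma levelHeight_nonneg (k b t : ℕ) : 0 ≤ levelHeight k b t := levelHeight_mono k b (Nat.zero_le t)

/-- At most `k` edges of the staircase polygon cannot be replaced profitably. -/
theorem SameDegrees.sum_latticeDist_le {k b : ℕ} (hk : 1 ≤ k) (hkb : k ≤ b) {M : ℤ} {m : ℕ}
    (hM : (b : ℤ) ^ (2 * m) ∣ M) (h : SameDegrees p q R A) (hloop : ∀ e ∈ A, p e ≠ q e)
    (hcard : R.card ≤ k)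
    (hR : ∀ e ∈ R, IsUnitEdge M (p e) (q e) ∨
      ∃ t, 1 ≤ t ∧ t ≤ m ∧ IsLevelEdge (b ^ (2 * t)) (levelHeight k b t) (p e) (q e))
    (hinj : ∀ e ∈ R, ∀ f ∈ R, s(p e, q e) = s(p f, q f) → e = f) :
    ∑ e ∈ R, latticeDist (p e) (q e) ≤ ∑ e ∈ A, latticeDist (p e) (q e) := by
  classical
  induction m generalizing R A with
  | zero =>
    calc ∑ e ∈ R, latticeDist (p e) (q e) = R.card := by
          rw [Finset.sum_congr rfl fun e he => ?_, Finset.sum_const, nsmul_eq_mul, mul_one]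
          rcases hR e he with hu | ⟨t, h1, h2, -⟩
          · exact hu.latticeDist_eq
          · omega
      _ = ∑ e ∈ A, 1 := by rw [h.card_eq]; simp
      _ ≤ _ := Finset.sum_le_sum fun e he => one_le_latticeDist (hloop e he)
  | succ j ih =>
    set ℓ : ℤ := (b : ℤ) ^ (2 * (j + 1)) with hℓ
    set ℓ' : ℤ := (b : ℤ) ^ (2 * j) with hℓ'
    set z := levelHeight k b (j + 1) with hz
    have hb1 : (1 : ℤ) ≤ b := by omega
    have hℓ'1 : 1 ≤ ℓ' := one_le_pow₀ hb1
    have hℓℓ' : ℓ = b * b * ℓ' := by rw [hℓ, hℓ']; ring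
    have hℓ1 : 1 ≤ ℓ := one_le_pow₀ hb1
    have hzz : z = levelHeight k b j + 4 * k * (b * ℓ') := by
      rw [hz, hℓ', levelHeight]; ring
    have hpowmono : ∀ t ≤ j, (b : ℤ) ^ (2 * t) ≤ ℓ' := fun t ht =>
      pow_le_pow_right₀ hb1 (by omega)
    set L := R.filter fun e => IsLevelEdge ℓ z (p e) (q e) with hL
    set U := R.filter fun e => ¬ IsLevelEdge ℓ z (p e) (q e) with hU
    have hLmem : ∀ e ∈ L, e ∈ R ∧ IsLevelEdge ℓ z (p e) (q e) := fun e he => Finset.mem_filter.1 he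
    have hUR : ∀ e ∈ U, e ∈ R ∧ (IsUnitEdge M (p e) (q e) ∨
        ∃ t, 1 ≤ t ∧ t ≤ j ∧ IsLevelEdge (b ^ (2 * t)) (levelHeight k b t) (p e) (q e)) := by
      intro e he
      obtain ⟨h1, h2⟩ := Finset.mem_filter.1 he
      refine ⟨h1, (hR e h1).imp_right ?_⟩
      rintro ⟨t, ht1, ht2, ht⟩
      refine ⟨t, ht1, ?_, ht⟩
      by_contra! hc
      obtain rfl : t = j + 1 := by omega
      exact h2 ht
    have hUx : ∀ e ∈ U, latticeDist (p e) (q e) ≤ ℓ' := by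
      intro e he
      rcases (hUR e he).2 with hu | ⟨t, -, ht, hl⟩
      · rw [hu.latticeDist_eq]; exact_mod_cast hℓ'1
      · rw [hl.latticeDist_eq]; exact_mod_cast hpowmono t ht
    have hUcard : (U.card : ℤ) ≤ k := by
      exact_mod_cast (Finset.card_filter_le _ _).trans hcard
    have hLcard : (L.card : ℤ) ≤ k := by
      exact_mod_cast (Finset.card_filter_le _ _).trans hcard
    -- Either the added edges cover at least half of the height between the two top levels, or some
    -- horizontal line between these levels is crossed by no edge and the exchange splits there.
    by_cases hY : 4 * k * (b * ℓ') ≤ 2 * ∑ e ∈ A, |(p e).2 - (q e).2|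
    · have hX : L.card * ℓ - k * ℓ' ≤ ∑ e ∈ A, |(p e).1 - (q e).1| := by
        set G1 := L.biUnion fun e => Finset.Ico (min (p e).1 (q e).1) (max (p e).1 (q e).1) with hG1
        set G2 := U.biUnion fun e => Finset.Ico (min (p e).1 (q e).1) (max (p e).1 (q e).1) with hG2
        have huniq : ∀ e ∈ L, ∀ f ∈ L, ∀ g, Crosses g (p e).1 (q e).1 → Crosses g (p f).1 (q f).1 →
            e = f := by
          intro e he f hf g hge hgf
          obtain ⟨heR, heL⟩ := hLmem e he
          obtain ⟨hfR, hfL⟩ := hLmem f hf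
          exact hinj e heR f hfR (heL.sym2_eq hfL
            ((heL.min_eq_of_crosses hge).trans (hfL.min_eq_of_crosses hgf).symm))
        have hc1 : (G1.card : ℤ) = L.card * ℓ := by
          rw [hG1, Finset.card_biUnion, Nat.cast_sum]
          · rw [Finset.sum_congr rfl fun e he => ?_, Finset.sum_const, nsmul_eq_mul]
            rw [card_crosses]; exact (hLmem e he).2.2.2.1
          · intro e he f hf hef
            rw [Function.onFun, Finset.disjoint_left]
            intro g hge hgf
            exact hef (huniq e he f hf g ((crosses_iff_mem _ _ _).2 hge) ((crosses_iff_mem _ _ _).2 hgf))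
        have hc2 : (G2.card : ℤ) ≤ k * ℓ' := by
          have h1 : (G2.card : ℤ) ≤ ∑ e ∈ U, |(p e).1 - (q e).1| := by
            refine le_trans (Int.ofNat_le.2 Finset.card_biUnion_le) (le_of_eq ?_)
            rw [Nat.cast_sum]
            exact Finset.sum_congr rfl fun e _ => card_crosses _ _
          refine h1.trans ((Finset.sum_le_card_nsmul _ _ ℓ' fun e he => ?_).trans ?_)
          · have := (abs_fst_sub_le_latticeDist (p e) (q e)).trans (hUx e he)
            exact_mod_cast this
          · rw [nsmul_eq_mul]
            exact mul_le_mul_of_nonneg_right hUcard (by omega)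
        have hcount := h.card_le_sum_crosses (G1 \ G2) (by
          intro g hg
          obtain ⟨hg1, hg2⟩ := Finset.mem_sdiff.1 hg
          obtain ⟨e, he, hge⟩ := Finset.mem_biUnion.1 hg1
          rw [← crosses_iff_mem] at hge
          rw [Finset.card_eq_one]
          refine ⟨e, ?_⟩
          ext f
          simp only [Finset.mem_filter, Finset.mem_singleton]
          constructor
          · rintro ⟨hfR, hf⟩
            by_cases hfL : IsLevelEdge ℓ z (p f) (q f)
            · exact huniq f (Finset.mem_filter.2 ⟨hfR, hfL⟩) e he g hf hge
            · exact absurd (Finset.mem_biUnion.2 ⟨f, Finset.mem_filter.2 ⟨hfR, hfL⟩,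
                (crosses_iff_mem _ _ _).1 hf⟩) hg2
          · rintro rfl
            exact ⟨(hLmem f he).1, hge⟩)
        have hle : ((∑ e ∈ A, ((G1 \ G2).filter fun g => Crosses g (p e).1 (q e).1).card : ℕ) : ℤ) ≤
            ∑ e ∈ A, |(p e).1 - (q e).1| := by
          rw [Nat.cast_sum]
          refine Finset.sum_le_sum fun e _ => ?_
          rw [← card_crosses]
          refine Int.ofNat_le.2 (Finset.card_le_card fun g hg => ?_)
          exact (crosses_iff_mem _ _ _).1 (Finset.mem_filter.1 hg).2
        have h3 := Finset.le_card_sdiff G2 G1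
        omega
      have hRle : ∑ e ∈ R, latticeDist (p e) (q e) ≤ ((L.card * ℓ + k * ℓ' : ℤ) : ℝ) := by
        rw [← Finset.sum_filter_add_sum_filter_not R fun e => IsLevelEdge ℓ z (p e) (q e)]
        push_cast
        refine add_le_add (le_of_eq ?_) ?_
        · rw [Finset.sum_congr rfl fun e he => (hLmem e he).2.latticeDist_eq, Finset.sum_const,
            nsmul_eq_mul]
        · refine (Finset.sum_le_card_nsmul _ _ (ℓ' : ℝ) hUx).trans ?_
          rw [nsmul_eq_mul]
          have h1 : ((U.card : ℤ) : ℝ) ≤ ((k : ℤ) : ℝ) := Int.cast_le.2 hUcard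
          have h2 : (0 : ℝ) ≤ ℓ' := by exact_mod_cast (by omega : 0 ≤ ℓ')
          push_cast at h1
          exact mul_le_mul_of_nonneg_right h1 h2
      refine hRle.trans (le_trans (Real.le_sqrt_of_sq_le ?_) (sqrt_le_sum_latticeDist A p q))
      set X := ∑ e ∈ A, |(p e).1 - (q e).1| with hXdef
      set Y := ∑ e ∈ A, |(p e).2 - (q e).2| with hYdef
      -- The squares of `L.card * ℓ ± k * ℓ'` differ by `4 * (L.card * ℓ) * (k * ℓ') ≤ (2 * k * b *
      -- ℓ') ^ 2`, as `ℓ = b ^ 2 * ℓ'` and `L.card ≤ k`. This dictates the spacing of the levels.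
      have hkey : (L.card * ℓ + k * ℓ') ^ 2 ≤ X ^ 2 + Y ^ 2 := by
        have hY2 : 2 * k * (b * ℓ') ≤ Y := by linarith
        have hY0 : 0 ≤ 2 * k * (b * ℓ') := by positivity
        have hYsq : (2 * k * (b * ℓ')) ^ 2 ≤ Y ^ 2 := pow_le_pow_left₀ hY0 hY2 2
        rcases Nat.eq_zero_or_pos L.card with h0 | h0
        · rw [h0]
          have h1 : (k : ℤ) * ℓ' ≤ 2 * k * (b * ℓ') := by
            have : (0 : ℤ) ≤ k * ℓ' := by positivity
            nlinarith
          have h2 : ((k : ℤ) * ℓ') ^ 2 ≤ (2 * k * (b * ℓ')) ^ 2 := pow_le_pow_left₀ (by positivity) h1 2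
          have := sq_nonneg X
          push_cast
          linarith
        · have hkℓ : k * ℓ' ≤ L.card * ℓ := by
            have h1 : (1 : ℤ) ≤ L.card := by exact_mod_cast h0
            have h2 : (k : ℤ) ≤ b * b := by nlinarith
            calc (k : ℤ) * ℓ' ≤ b * b * ℓ' := by gcongr
              _ = 1 * ℓ := by rw [hℓℓ', one_mul]
              _ ≤ _ := by gcongr
          have hXsq : (L.card * ℓ - k * ℓ') ^ 2 ≤ X ^ 2 := pow_le_pow_left₀ (by omega) hX 2
          have h3 : L.card * ℓ * (k * ℓ') ≤ (k * (b * ℓ')) ^ 2 := by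
            calc L.card * ℓ * (k * ℓ') ≤ k * ℓ * (k * ℓ') := by gcongr
              _ = _ := by rw [hℓℓ']; ring
          linarith
      exact_mod_cast hkey
    -- Of the `4 * k * b * ℓ'` unit gaps, `A` crosses fewer than half, and `R`, whose only
    -- nonhorizontal edges are unit edges, at most `k`.
    · have hgap : ∃ g ∈ Finset.Ico (levelHeight k b j) z,
          ∀ e ∈ R ∪ A, ¬ Crosses g (p e).2 (q e).2 := by
        by_contra! hall
        have hsub : Finset.Ico (levelHeight k b j) z ⊆
            (R.biUnion fun e => Finset.Ico (min (p e).2 (q e).2) (max (p e).2 (q e).2)) ∪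
            (A.biUnion fun e => Finset.Ico (min (p e).2 (q e).2) (max (p e).2 (q e).2)) := by
          intro g hg
          obtain ⟨e, he, hge⟩ := hall g hg
          rw [crosses_iff_mem] at hge
          rcases Finset.mem_union.1 he with he | he
          · exact Finset.mem_union_left _ (Finset.mem_biUnion.2 ⟨e, he, hge⟩)
          · exact Finset.mem_union_right _ (Finset.mem_biUnion.2 ⟨e, he, hge⟩)
        have hbi : ∀ B : Finset ι, ((B.biUnion fun e =>
            Finset.Ico (min (p e).2 (q e).2) (max (p e).2 (q e).2)).card : ℤ) ≤
            ∑ e ∈ B, |(p e).2 - (q e).2| := by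
          intro B
          refine le_trans (Int.ofNat_le.2 Finset.card_biUnion_le) (le_of_eq ?_)
          rw [Nat.cast_sum]
          exact Finset.sum_congr rfl fun e _ => card_crosses _ _
        have h1 := (Finset.card_le_card hsub).trans (Finset.card_union_le _ _)
        rw [Int.card_Ico] at h1
        have h2 := hbi R
        have h3 := hbi A
        have h4 : ∑ e ∈ R, |(p e).2 - (q e).2| ≤ k := by
          refine (Finset.sum_le_card_nsmul _ _ 1 fun e he => ?_).trans ?_
          · rcases hR e he with (hu | hu) | ⟨t, -, -, hl⟩
            · omega
            · rw [hu.1, sub_self, abs_zero]; omega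
            · rw [hl.1, hl.2.1, sub_self, abs_zero]; omega
          · rw [nsmul_eq_mul, mul_one]; exact_mod_cast hcard
        have h5 : (k : ℤ) ≤ k * (b * ℓ') := by
          have : (1 : ℤ) ≤ b * ℓ' := by nlinarith
          nlinarith
        have h6 : 4 * (k : ℤ) * (b * ℓ') = 4 * (k * (b * ℓ')) := by ring
        have h7 : (1 : ℤ) ≤ k := by exact_mod_cast hk
        rw [h6] at hY hzz
        omega
      obtain ⟨g, hg, hcross⟩ := hgap
      rw [Finset.mem_Ico] at hg
      have hside : ∀ e ∈ R ∪ A, ((p e).2 ≤ g ↔ (q e).2 ≤ g) := by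
        intro e he
        have := hcross e he
        unfold Crosses at this
        omega
      have hsR : ∀ e ∈ R, ((p e).2 ≤ g ↔ (q e).2 ≤ g) := fun e he =>
        hside e (Finset.mem_union_left _ he)
      have hsA : ∀ e ∈ A, ((p e).2 ≤ g ↔ (q e).2 ≤ g) := fun e he =>
        hside e (Finset.mem_union_right _ he)
      rw [← Finset.sum_filter_add_sum_filter_not R fun e => (p e).2 ≤ g,
        ← Finset.sum_filter_add_sum_filter_not A fun e => (p e).2 ≤ g]
      refine add_le_add ?_ ?_
      · refine ih ((pow_dvd_pow _ (by omega)).trans hM) (h.split (fun v => v.2 ≤ g) hsR hsA)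
          (fun e he => hloop e (Finset.mem_filter.1 he).1) ((Finset.card_filter_le _ _).trans hcard)
          (fun e he => ?_) (fun e he f hf => hinj e (Finset.mem_filter.1 he).1 f (Finset.mem_filter.1 hf).1)
        obtain ⟨heR, heg⟩ := Finset.mem_filter.1 he
        refine (hR e heR).imp_right ?_
        rintro ⟨t, ht1, ht2, ht⟩
        refine ⟨t, ht1, ?_, ht⟩
        by_contra! hc
        obtain rfl : t = j + 1 := by omega
        have := ht.1
        omega
      · refine (h.split (fun v => ¬ v.2 ≤ g) (fun e he => not_congr (hsR e he))
          (fun e he => not_congr (hsA e he))).sum_le_of_level (z := z) hℓ1 hM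
          (fun e he => hloop e (Finset.mem_filter.1 he).1) (fun e he => ?_) (fun e he => ?_)
          (fun e he f hf => hinj e (Finset.mem_filter.1 he).1 f (Finset.mem_filter.1 hf).1)
        · obtain ⟨heR, heg⟩ := Finset.mem_filter.1 he
          refine (hR e heR).imp_right ?_
          rintro ⟨t, ht1, ht2, ht⟩
          obtain rfl : t = j + 1 := by
            by_contra hne
            have h1 := levelHeight_mono k b (by omega : t ≤ j)
            have := ht.1
            omega
          exact ht
        · have := (Finset.mem_filter.1 he).2
          have := levelHeight_nonneg k b j
          omega

end Levels

end EuclideanTSP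

namespace EuclideanTSP

/-! ### Lengths of polygons and short closed polygons -/

section PathLength

/-- The length of the polygonal path through the points of a list. -/
noncomputable def pathLength (l : List Plane) : ℝ :=
  (List.zipWith (fun x y : Plane => dist x y) l l.tail).sum

@[simp] lemma pathLength_singleton (x : Plane) : pathLength [x] = 0 := by simp [pathLength]

@[simp] lemma pathLength_cons_cons (x y : Plane) (l : List Plane) :
    pathLength (x :: y :: l) = dist x y + pathLength (y :: l) := by simp [pathLength]

lemma pathLength_nonneg (l : List Plane) : 0 ≤ pathLength l := by
  induction l with
  | nil => simp [pathLength]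
  | cons x l ih =>
    cases l with
    | nil => simp
    | cons y l => rw [pathLength_cons_cons]; positivity

lemma cycLength_cons (x : Plane) (l : List Plane) :
    cycLength (x :: l) = pathLength (x :: l ++ [x]) := by
  have h := congrArg (fun m => (m.map (Sym2.lift ⟨fun x y : Plane => dist x y, dist_comm⟩)).sum)
    (cycEdges_cons x l)
  simp only [cycEdges, pathEdges, List.map_zipWith, Sym2.lift_mk] at h
  exact h

lemma cycLength_rotate (l : List Plane) (k : ℕ) : cycLength (l.rotate k) = cycLength l := by
  unfold cycLength
  rw [List.rotate_rotate, Nat.add_comm, ← List.rotate_rotate,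
    ← List.zipWith_rotate_distrib _ _ _ _ (by simp)]
  exact (List.rotate_perm _ _).sum_eq

lemma pathLength_append_singleton_le (l : List Plane) (u v : Plane) :
    pathLength (l ++ [v]) ≤ pathLength (l ++ [u]) + dist u v := by
  induction l with
  | nil => simp
  | cons x l ih =>
    cases l with
    | nil => simpa using dist_triangle x u v
    | cons y l =>
      simp only [List.cons_append, pathLength_cons_cons] at ih ⊢
      linarith

lemma pathLength_append (l r : List Plane) (x : Plane) :
    pathLength (l ++ [x] ++ r) = pathLength (l ++ [x]) + pathLength (x :: r) := by
  induction l with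
  | nil => simp
  | cons y l ih =>
    cases l with
    | nil => simp
    | cons z l =>
      simp only [List.cons_append, pathLength_cons_cons] at ih ⊢
      rw [ih]; ring

lemma dist_le_pathLength (x y : Plane) (r : List Plane) : dist x y ≤ pathLength (x :: (r ++ [y])) := by
  induction r generalizing x with
  | nil => simp
  | cons z r ih =>
    rw [List.cons_append, pathLength_cons_cons]
    exact (dist_triangle x z y).trans (by gcongr; exact ih z)

lemma pathLength_le_append (l r : List Plane) : pathLength l ≤ pathLength (l ++ r) := by
  rcases List.eq_nil_or_concat l with rfl | ⟨l, x, rfl⟩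
  · simpa [pathLength] using pathLength_nonneg r
  · rw [List.concat_eq_append, pathLength_append]
    linarith [pathLength_nonneg (x :: r)]

lemma pathLength_add_dist_le {l r : List Plane} {x y : Plane} (hl : l.getLast? = some x)
    (hr : r.getLast? = some y) : pathLength l + dist x y ≤ pathLength (l ++ r) := by
  obtain ⟨l, rfl⟩ := List.getLast?_eq_some_iff.1 hl
  obtain ⟨r, rfl⟩ := List.getLast?_eq_some_iff.1 hr
  rw [pathLength_append]
  gcongr
  exact dist_le_pathLength x y r

/-- The points of a list can be rearranged to a closed polygon of length at most `B`. -/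
def HasShortCycle (l : List Plane) (B : ℝ) : Prop := ∃ l', l'.Perm l ∧ cycLength l' ≤ B

/-- The polygon is rotated to start at `u` and `v` is put in front: one new edge, and the closing
edge now ends at `v`, each costing at most `dist u v` extra. -/
lemma HasShortCycle.concat {l : List Plane} {B : ℝ} (h : HasShortCycle l B) {u : Plane} (hu : u ∈ l)
    (v : Plane) : HasShortCycle (l ++ [v]) (B + 2 * dist u v) := by
  obtain ⟨l', hl, hB⟩ := h
  obtain ⟨s, t, rfl⟩ := List.append_of_mem (hl.mem_iff.2 hu)
  refine ⟨v :: u :: (t ++ s), ?_, ?_⟩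
  · refine (List.Perm.trans ?_ (hl.cons v)).trans (List.perm_append_singleton v l).symm
    exact (List.perm_append_comm (l₁ := u :: t) (l₂ := s)).cons v
  · have h1 := cycLength_rotate (s ++ u :: t) s.length
    rw [List.rotate_append_length_eq, List.cons_append, cycLength_cons] at h1
    rw [cycLength_cons, List.cons_append, List.cons_append, pathLength_cons_cons]
    have h2 := pathLength_append_singleton_le (u :: (t ++ s)) u v
    simp only [List.cons_append] at h1 h2 ⊢
    rw [dist_comm v u]
    linarith

/-- The bound by a doubled spanning tree: each new point hangs on an earlier one. -/
lemma HasShortCycle.append_map_range {l : List Plane} {B d : ℝ} (h : HasShortCycle l B)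
    (f : ℕ → Plane) (n : ℕ)
    (hd : ∀ i < n, ∃ u ∈ l ++ (List.range i).map f, dist u (f i) ≤ d) :
    HasShortCycle (l ++ (List.range n).map f) (B + n * (2 * d)) := by
  induction n with
  | zero => simpa using h
  | succ n ih =>
    obtain ⟨u, hu, hud⟩ := hd n (by omega)
    obtain ⟨l', hl', hB⟩ := (ih fun i hi => hd i (by omega)).concat hu (f n)
    refine ⟨l', ?_, hB.trans ?_⟩
    · rw [List.range_succ, List.map_append, ← List.append_assoc]
      exact hl'
    · push_cast; linarith

end PathLength

/-! ### From lattice polygons to k-optimal tours -/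

section LatticeTours

lemma exists_list_coe {V : Finset Plane} {l : List Plane} (hl : l.Nodup) (hV : ∀ x, x ∈ l ↔ x ∈ V) :
    ∃ l' : List V, l'.Nodup ∧ l'.map ((↑) : V → Plane) = l ∧ ∀ v, v ∈ l' := by
  have hmap : (l.attachWith (· ∈ V) fun x hx => (hV x).1 hx).map ((↑) : V → Plane) = l :=
    List.attachWith_map_subtype_val ..
  refine ⟨_, List.Nodup.of_map _ (by rw [hmap]; exact hl), hmap, fun v => ?_⟩
  have : (v : Plane) ∈ (l.attachWith (· ∈ V) fun x hx => (hV x).1 hx).map ((↑) : V → Plane) := by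
    rw [hmap]; exact (hV v).2 v.2
  obtain ⟨w, hw, hwv⟩ := List.mem_map.1 this
  rwa [← Subtype.ext hwv]

lemma sum_zipWith_add {α : Type*} (φ : α → ℤ) (l₁ l₂ : List α) (h : l₁.length = l₂.length) :
    (List.zipWith (fun x y => φ x + φ y) l₁ l₂).sum = (l₁.map φ).sum + (l₂.map φ).sum := by
  induction l₁ generalizing l₂ with
  | nil => simp [List.length_eq_zero_iff.1 h.symm]
  | cons x l₁ ih =>
    cases l₂ with
    | nil => simp at h
    | cons y l₂ =>
      simp only [List.zipWith_cons_cons, List.sum_cons, List.map_cons]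
      rw [ih l₂ (by simpa using h)]; ring

/-- Every vertex has degree two in a tour. -/
lemma IsTour.sum_lift_add {V : Finset Plane} {T : Finset (Sym2 V)} (hT : IsTour T) (φ : V → ℤ) :
    ∑ e ∈ T, Sym2.lift ⟨fun x y => φ x + φ y, fun _ _ => add_comm _ _⟩ e = 2 * ∑ v, φ v := by
  classical
  obtain ⟨l, hnd, h3, hm, rfl⟩ := hT.exists_list
  have hs : (l.map φ).sum = ∑ v, φ v := by
    rw [← List.sum_toFinset _ hnd]
    congr 1
    ext v; simp [hm]
  have he : ∑ e ∈ (cycEdges l).toFinset, Sym2.lift ⟨fun x y => φ x + φ y, fun _ _ => add_comm _ _⟩ e =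
      ((cycEdges l).map (Sym2.lift ⟨fun x y => φ x + φ y, fun _ _ => add_comm _ _⟩)).sum := by
    rw [← List.sum_toFinset _ (cycEdges_nodup hnd h3)]
  rw [he]
  unfold cycEdges
  rw [List.map_zipWith]
  simp only [Sym2.lift_mk]
  rw [sum_zipWith_add φ l _ (by simp), List.map_rotate, (List.rotate_perm _ _).sum_eq, hs]
  ring

lemma IsTour.not_isDiag {V : Finset Plane} {T : Finset (Sym2 V)} (hT : IsTour T) {e : Sym2 V}
    (he : e ∈ T) : ¬ e.IsDiag := by
  obtain ⟨v, p, -, hp⟩ := hT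
  exact SimpleGraph.not_isDiag_of_mem_edgeSet _ (p.edges_subset_edgeSet ((hp e).1 he))

/-- The edges of the staircase polygon with `m` levels. -/
def IsStairEdge (k b : ℕ) (M : ℤ) (m : ℕ) (v w : ℤ × ℤ) : Prop :=
  IsUnitEdge M v w ∨
    ∃ t, 1 ≤ t ∧ t ≤ m ∧ IsLevelEdge (b ^ (2 * t)) (levelHeight k b t) v w

lemma IsStairEdge.symm {k b : ℕ} {M : ℤ} {m : ℕ} {v w : ℤ × ℤ} (h : IsStairEdge k b M m v w) :
    IsStairEdge k b M m w v := by
  rcases h with (⟨h1, h2, h3⟩ | ⟨h1, h2, h3⟩) | ⟨t, h1, h2, h3, h4, h5, h6, h7, h8⟩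
  · exact Or.inl (Or.inl ⟨h1.symm, by rwa [abs_sub_comm], by rwa [← h1]⟩)
  · exact Or.inl (Or.inr ⟨h1.symm, by rwa [abs_sub_comm], by rw [← h1]; tauto⟩)
  · refine Or.inr ⟨t, h1, h2, h4, h3, by rwa [abs_sub_comm], ?_, h8, h7⟩
    have : (b : ℤ) ^ (2 * t) ∣ v.1 - w.1 := by rw [← dvd_abs, h5]
    exact (dvd_sub_right h6).1 this

/-- A tour that consists of edges of the staircase polygon is `k`-optimal. -/
lemma isKOptimal_of_isStairEdge {k b : ℕ} (hk : 1 ≤ k) (hkb : k ≤ b) {M : ℤ} {m : ℕ}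
    (hM : (b : ℤ) ^ (2 * m) ∣ M) {V : Finset Plane} {S : Finset (Sym2 V)} (hS : IsTour S)
    (π : V → ℤ × ℤ) (hπ : ∀ v, latticePoint (π v) = v)
    (hedge : ∀ v w : V, s(v, w) ∈ S → IsStairEdge k b M m (π v) (π w)) : IsKOptimal k S := by
  classical
  refine ⟨hS, ?_⟩
  rintro S' ⟨-, hS', hlt, R, A, hRS, hAS, hcard, hRk, rfl⟩
  rw [length_union_sdiff hRS hAS] at hlt
  have hout : ∀ e : Sym2 V, s((Quot.out e).1, (Quot.out e).2) = e := fun e => Quot.out_eq e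
  have hdist : ∀ e : Sym2 V, edgeLength e = latticeDist (π (Quot.out e).1) (π (Quot.out e).2) := by
    intro e
    conv_lhs => rw [← hout e]
    simp only [edgeLength, Sym2.lift_mk, latticeDist, hπ]
  have hinj : Function.Injective π := fun v w h => Subtype.ext (by rw [← hπ v, ← hπ w, h])
  -- Both tours have degree two everywhere and share `S \ R`, so the removed and the added edges
  -- have the same degrees.
  have hdeg : SameDegrees (fun e : Sym2 V => π (Quot.out e).1) (fun e => π (Quot.out e).2) R A := by
    intro φ
    have h1 := hS.sum_lift_add fun v => φ (π v)
    have h2 := hS'.sum_lift_add fun v => φ (π v)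
    have h3 : ∀ e : Sym2 V, Sym2.lift ⟨fun x y => φ (π x) + φ (π y), fun _ _ => add_comm _ _⟩ e =
        φ (π (Quot.out e).1) + φ (π (Quot.out e).2) := by
      intro e
      conv_lhs => rw [← hout e]
      rfl
    simp only [h3] at h1 h2
    rw [Finset.sum_union (Finset.disjoint_of_subset_left Finset.sdiff_subset hAS.symm)] at h2
    rw [← Finset.sum_sdiff hRS] at h1
    linarith
  have hloop : ∀ e ∈ A, π (Quot.out e).1 ≠ π (Quot.out e).2 := by
    intro e he heq
    refine hS'.not_isDiag (Finset.mem_union_right _ he) ?_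
    rw [← hout e]
    exact hinj heq
  have := hdeg.sum_latticeDist_le hk hkb hM hloop hRk
    (fun e he => hedge _ _ (by rw [hout]; exact hRS he)) (fun e _ f _ hef => by
      rw [← Sym2.map_mk, ← Sym2.map_mk, hout, hout] at hef
      exact Sym2.map.injective hinj hef)
  simp only [← hdist] at this
  unfold length at hlt
  linarith

/-- A closed staircase polygon yields a lower bound for the approximation ratio. -/
lemma le_kOptApproxRatio_of_isStairEdge {k b : ℕ} (hk : 1 ≤ k) (hkb : k ≤ b) {M : ℤ} {m : ℕ}
    (hM : (b : ℤ) ^ (2 * m) ∣ M) {l : List (ℤ × ℤ)} (hl : l.Nodup) (h3 : 3 ≤ l.length)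
    (hedge : ∀ v w, s(v, w) ∈ cycEdges l → IsStairEdge k b M m v w) {B : ℝ}
    (hB : HasShortCycle (l.map latticePoint) B) :
    cycLength (l.map latticePoint) ≤ B * kOptApproxRatio k l.length := by
  classical
  set L := l.map latticePoint with hL
  have hLnd : L.Nodup := hl.map latticePoint_injective
  set V : Finset Plane := L.toFinset with hV
  have hVcard : V.card = l.length := by
    rw [hV, List.toFinset_card_of_nodup hLnd, hL, List.length_map]
  obtain ⟨lS, hSnd, hSmap, hSmem⟩ := exists_list_coe (V := V) hLnd (by simp [hV])
  obtain ⟨L', hperm, hL'⟩ := hB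
  obtain ⟨lT, hTnd, hTmap, hTmem⟩ := exists_list_coe (V := V) (hperm.nodup_iff.2 hLnd)
    (fun x => by simp [hV, hperm.mem_iff])
  have hSlen : lS.length = l.length := by
    rw [← List.length_map (f := ((↑) : V → Plane)), hSmap, hL, List.length_map]
  have hTlen : lT.length = l.length := by
    rw [← List.length_map (f := ((↑) : V → Plane)), hTmap, hperm.length_eq, hL, List.length_map]
  have hS := isTour_of_list hSnd (by omega) hSmem
  have hT := isTour_of_list hTnd (by omega) hTmem
  have hpre : ∀ v : V, ∃ x, x ∈ l ∧ latticePoint x = v := fun v =>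
    List.mem_map.1 (List.mem_toFinset.1 v.2)
  choose π hπl hπ using hpre
  have hlS : lS.map π = l := by
    refine latticePoint_injective.list_map ?_
    rw [List.map_map, ← hL, ← hSmap]
    exact List.map_congr_left fun v _ => hπ v
  have hkopt : IsKOptimal k (cycEdges lS).toFinset := by
    refine isKOptimal_of_isStairEdge hk hkb hM hS π hπ fun v w hvw => hedge _ _ ?_
    have h1 : cycEdges l = (cycEdges lS).map (Sym2.map π) := by
      rw [← hlS]
      unfold cycEdges
      rw [List.map_zipWith, ← List.map_rotate, List.zipWith_map]
      rfl
    rw [h1]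
    exact List.mem_map.2 ⟨_, List.mem_toFinset.1 hvw, rfl⟩
  obtain ⟨T, hTopt⟩ := exists_isOptimalTour (V := V) (by omega)
  have hlenS : length (cycEdges lS).toFinset = cycLength L := by
    rw [length_cycEdges hSnd (by omega), hSmap]
  have hlenT : length T ≤ B := by
    refine (hTopt.2 _ hT).trans ?_
    rw [length_cycEdges hTnd (by omega), hTmap]
    exact hL'
  have hTpos : 0 < length T := by
    obtain ⟨u, hu, v, hv, huv⟩ := Finset.one_lt_card.1 (by omega : 1 < V.card)
    exact (dist_pos.2 huv).trans_le (hTopt.1.dist_le_length hu hv)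
  have hle : length (cycEdges lS).toFinset / length T ≤ kOptApproxRatio k l.length :=
    le_csSup (kOptRatios_bddAbove k _) ⟨V, hVcard, _, T, ⟨_, hS, .refl, hkopt⟩, hTopt, rfl⟩
  rw [div_le_iff₀ hTpos, hlenS] at hle
  have h0 : 0 ≤ kOptApproxRatio k l.length := by
    refine Real.sSup_nonneg ?_
    rintro _ ⟨V, -, S, T, -, -, rfl⟩
    exact div_nonneg (length_nonneg _) (length_nonneg _)
  nlinarith

end LatticeTours

end EuclideanTSP

namespace EuclideanTSP

/-! ### Construction of the staircase polygon -/

section Staircase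

/-- A path in the lattice from `a` to `x` through `n` distinct points, of length at least `C`, whose
points lie on a closed polygon of length at most `B`. -/
structure IsLatticePath (R : ℤ × ℤ → ℤ × ℤ → Prop) (l : List (ℤ × ℤ)) (a x : ℤ × ℤ) (n : ℤ)
    (C B : ℝ) : Prop where
  head : l.head? = some a
  last : l.getLast? = some x
  chain : l.IsChain R
  nodup : l.Nodup
  length_eq : (l.length : ℤ) = n
  le_pathLength : C ≤ pathLength (l.map latticePoint)
  short : HasShortCycle (l.map latticePoint) B

variable {R : ℤ × ℤ → ℤ × ℤ → Prop} {l : List (ℤ × ℤ)} {a x : ℤ × ℤ} {n : ℤ} {C B : ℝ}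

lemma isChain_map_range {α : Type*} {R : α → α → Prop} (f : ℕ → α) {N : ℕ}
    (h : ∀ i, i + 1 < N → R (f i) (f (i + 1))) : ((List.range N).map f).IsChain R := by
  rw [List.isChain_iff_getElem]
  intro i hi
  simp only [List.length_map, List.length_range] at hi
  simpa using h i hi

lemma getLast?_map_range_succ {α : Type*} (f : ℕ → α) (N : ℕ) :
    ((List.range (N + 1)).map f).getLast? = some (f N) := by
  simp [List.range_succ]

lemma head?_map_range_succ {α : Type*} (f : ℕ → α) (N : ℕ) :
    ((List.range (N + 1)).map f).head? = some (f 0) := by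
  simp [List.range_succ_eq_map]

/-- A new stretch adds the distance of its ends to the length bound, while each of its points adds
only `2 * d` to the short polygon. The ratio arises from the gap between the two. -/
lemma IsLatticePath.append (h : IsLatticePath R l a x n C B) (f : ℕ → ℤ × ℤ) (N : ℕ)
    (h0 : R x (f 0)) (hstep : ∀ i < N, R (f i) (f (i + 1)))
    (hinj : ∀ i ≤ N, ∀ j ≤ N, f i = f j → i = j) (hdisj : ∀ i ≤ N, f i ∉ l) (d : ℝ)
    (hd : ∀ i ≤ N, ∃ u ∈ l ++ (List.range i).map f, latticeDist u (f i) ≤ d) :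
    IsLatticePath R (l ++ (List.range (N + 1)).map f) a (f N) (n + (N + 1)) (C + latticeDist x (f N))
      (B + (N + 1) * (2 * d)) where
  head := by rw [List.head?_append, h.head]; rfl
  last := by rw [List.getLast?_append, getLast?_map_range_succ]; rfl
  chain := by
    rw [List.isChain_append]
    refine ⟨h.chain, isChain_map_range f fun i hi => hstep i (by omega), ?_⟩
    intro y hy w hw
    rw [h.last, Option.mem_some_iff] at hy
    rw [head?_map_range_succ, Option.mem_some_iff] at hw
    rwa [← hy, ← hw]
  nodup := by
    rw [List.nodup_append']
    refine ⟨h.nodup, ?_, ?_⟩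
    · refine List.Nodup.map_on ?_ List.nodup_range
      intro i hi j hj
      rw [List.mem_range] at hi hj
      exact hinj i (by omega) j (by omega)
    · intro v hv hv'
      obtain ⟨i, hi, rfl⟩ := List.mem_map.1 hv'
      exact hdisj i (by rw [List.mem_range] at hi; omega) hv
  length_eq := by
    rw [List.length_append, List.length_map, List.length_range]
    push_cast
    rw [h.length_eq]
  le_pathLength := by
    rw [List.map_append]
    refine le_trans ?_ (pathLength_add_dist_le (x := latticePoint x) (y := latticePoint (f N)) ?_ ?_)
    · exact add_le_add h.le_pathLength le_rfl
    · rw [List.getLast?_map, h.last]; rfl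
    · rw [List.getLast?_map, getLast?_map_range_succ]; rfl
  short := by
    have := h.short.append_map_range (d := d) (fun i => latticePoint (f i)) (N + 1) (by
      intro i hi
      obtain ⟨u, hu, hud⟩ := hd i (by omega)
      refine ⟨latticePoint u, ?_, hud⟩
      have := List.mem_map_of_mem (f := latticePoint) hu
      rwa [List.map_append, List.map_map] at this)
    rw [List.map_append, List.map_map]
    push_cast at this
    exact this

lemma IsLatticePath.append_of_dist_le_one (h : IsLatticePath R l a x n C B) (f : ℕ → ℤ × ℤ) (N : ℕ)
    (h0 : R x (f 0)) (hstep : ∀ i < N, R (f i) (f (i + 1)))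
    (hinj : ∀ i ≤ N, ∀ j ≤ N, f i = f j → i = j) (hdisj : ∀ i ≤ N, f i ∉ l)
    (hd0 : latticeDist x (f 0) ≤ 1) (hd : ∀ i < N, latticeDist (f i) (f (i + 1)) ≤ 1) :
    IsLatticePath R (l ++ (List.range (N + 1)).map f) a (f N) (n + (N + 1)) C
      (B + (N + 1) * 2) := by
  have h1 := h.append f N h0 hstep hinj hdisj 1 (by
    intro i hi
    cases i with
    | zero => exact ⟨x, List.mem_append_left _ (List.mem_of_getLast? h.last), hd0⟩
    | succ i =>
      exact ⟨f i, List.mem_append_right _ (List.mem_map_of_mem (List.mem_range.2 (by omega))),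
        hd i (by omega)⟩)
  refine { h1 with le_pathLength := le_trans ?_ h1.le_pathLength, short := ?_ }
  · have : 0 ≤ latticeDist x (f N) := dist_nonneg
    linarith
  · have := h1.short
    rwa [mul_one] at this

lemma isStairEdge_vertical {k b m : ℕ} {M : ℤ} {v w : ℤ × ℤ} (h : v.1 = w.1) (h1 : |v.2 - w.2| = 1)
    (hx : v.1 ≤ 0 ∨ v.1 = M) : IsStairEdge k b M m v w :=
  Or.inl (Or.inl ⟨h, h1, hx⟩)

lemma isStairEdge_horizontal {k b m : ℕ} {M : ℤ} {v w : ℤ × ℤ} (h : v.2 = w.2)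
    (h1 : |v.1 - w.1| = 1) (hx : (v.1 ≤ 0 ∧ w.1 ≤ 0) ∨ v.2 = 0) : IsStairEdge k b M m v w :=
  Or.inl (Or.inr ⟨h, h1, hx⟩)

lemma latticeDist_le_one_of_snd_eq {v w : ℤ × ℤ} (h : v.2 = w.2) (h1 : |v.1 - w.1| ≤ 1) :
    latticeDist v w ≤ 1 := by
  rw [latticeDist_of_snd_eq h]; exact_mod_cast h1

lemma latticeDist_le_one_of_fst_eq {v w : ℤ × ℤ} (h : v.1 = w.1) (h1 : |v.2 - w.2| ≤ 1) :
    latticeDist v w ≤ 1 := by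
  rw [latticeDist_of_fst_eq h]; exact_mod_cast h1

/-- The horizontal coordinate at which the staircase leaves level `t`. -/
def turnPoint (M : ℤ) (t : ℕ) : ℤ := if Even t then M else 0

/-- The lower part of the staircase polygon, up to level `t`. -/
lemma exists_isLatticePath_level {k b c m W : ℕ} (hk : 1 ≤ k) (hb : 1 ≤ b) (hc : 1 ≤ c) {M : ℕ}
    (hM : M = c * b ^ (2 * m)) :
    ∀ t ≤ m, ∃ l : List (ℤ × ℤ), IsLatticePath (IsStairEdge k b M m) l (-W, 0)
      (turnPoint M t, levelHeight k b t)
      (W + M + 1 + levelHeight k b t + ∑ s ∈ Finset.range t, (c : ℤ) * b ^ (2 * (m - (s + 1))))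
      (t * M)
      (2 * (W + M + levelHeight k b t) +
        ∑ s ∈ Finset.range t, (c : ℝ) * b ^ (2 * (m - (s + 1))) * (2 * levelHeight k b (s + 1))) ∧
      (∀ v ∈ l, 0 ≤ v.2 ∧ v.2 ≤ levelHeight k b t ∧ (0 < v.2 → 0 ≤ v.1)) ∧
      ∀ i : ℤ, 0 ≤ i → i ≤ M → (i, 0) ∈ l := by
  intro t
  induction t with
  | zero =>
    intro _
    have hstart : IsLatticePath (IsStairEdge k b M m) [((-W : ℤ), (0 : ℤ))] (-W, 0) (-W, 0) 1 0 0 := by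
      refine ⟨rfl, rfl, by simp, by simp, rfl, by simp, ⟨_, List.Perm.refl _, ?_⟩⟩
      simp [cycLength]
    have hM1 : 1 ≤ M := by rw [hM]; exact Nat.mul_pos hc (by positivity)
    obtain ⟨N, hN⟩ : ∃ N, W + M = N + 1 := ⟨W + M - 1, by omega⟩
    have hN' : (W : ℤ) + M = N + 1 := by exact_mod_cast hN
    have hN'' : (W : ℝ) + M = N + 1 := by exact_mod_cast hN
    have h := hstart.append_of_dist_le_one (fun i => ((i : ℤ) + 1 - W, 0)) N
      (isStairEdge_horizontal rfl (by
        have : -(W : ℤ) - (((0 : ℕ) : ℤ) + 1 - W) = -1 := by push_cast; ring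
        simp only [this, abs_neg, abs_one]) (Or.inr rfl))
      (fun i _ => isStairEdge_horizontal rfl (by simp) (Or.inr rfl))
      (fun i _ j _ hij => by have := congrArg Prod.fst hij; simp only at this; omega)
      (fun i _ hi => by simp at hi; omega)
      (latticeDist_le_one_of_snd_eq rfl (by
        have : -(W : ℤ) - (((0 : ℕ) : ℤ) + 1 - W) = -1 := by push_cast; ring
        simp only [this, abs_neg, abs_one, le_refl]))
      (fun i _ => latticeDist_le_one_of_snd_eq rfl (by simp))
    refine ⟨[((-W : ℤ), (0 : ℤ))] ++
      (List.range (N + 1)).map (fun i : ℕ => ((i : ℤ) + 1 - W, (0 : ℤ))), ?_, ?_, ?_⟩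
    · convert h using 1
      · simp only [turnPoint, levelHeight, Even.zero, if_true, Prod.mk.injEq, and_true]
        omega
      · simp only [levelHeight, Finset.range_zero, Finset.sum_empty]
        omega
      · simp
      · simp only [levelHeight, Finset.range_zero, Finset.sum_empty, Int.cast_zero]
        rw [add_zero, hN'']; ring
    · intro v hv
      have hv2 : v.2 = 0 := by
        rcases List.mem_append.1 hv with hv | hv
        · rw [List.mem_singleton.1 hv]
        · obtain ⟨i, -, rfl⟩ := List.mem_map.1 hv; rfl
      rw [hv2]
      simp [levelHeight]
    · intro i hi0 hiM
      by_cases h0 : i + W = 0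
      · refine List.mem_append_left _ (List.mem_singleton.2 ?_)
        rw [Prod.mk.injEq]; omega
      · refine List.mem_append_right _ (List.mem_map.2 ⟨(i + W - 1).toNat, ?_, ?_⟩)
        · rw [List.mem_range]; omega
        · rw [Prod.mk.injEq]; omega
  | succ t ih =>
    intro ht
    obtain ⟨l, hl, hbd, hrow⟩ := ih (by omega)
    set X := turnPoint M t with hX
    set z := levelHeight k b t with hz
    set z' := levelHeight k b (t + 1) with hz'
    have hM0 : (0 : ℤ) ≤ M := by positivity
    have hX' : X ≤ 0 ∨ X = M := by
      rw [hX, turnPoint]; split_ifs <;> simp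
    have hX0 : 0 ≤ X := by
      rw [hX, turnPoint]; split_ifs <;> omega
    have hz0 : 0 ≤ z := levelHeight_nonneg k b t
    obtain ⟨H, hH⟩ : ∃ H : ℕ, 4 * k * b ^ (2 * t + 1) = H + 1 :=
      ⟨4 * k * b ^ (2 * t + 1) - 1, by
        have : 0 < 4 * k * b ^ (2 * t + 1) := by positivity
        omega⟩
    have hzz : z' = z + (H + 1) := by
      rw [hz', levelHeight, ← hz]
      have : (4 * k * b ^ (2 * t + 1) : ℤ) = H + 1 := by exact_mod_cast hH
      rw [this]
    have h1 := hl.append_of_dist_le_one (fun i => (X, z + 1 + i)) H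
      (isStairEdge_vertical rfl (by simp) hX')
      (fun i _ => isStairEdge_vertical rfl (by simp) hX')
      (fun i _ j _ hij => by have := congrArg Prod.snd hij; simp only at this; omega)
      (fun i _ hi => by have := (hbd _ hi).2.1; simp only at this; omega)
      (latticeDist_le_one_of_fst_eq rfl (by simp))
      (fun i _ => latticeDist_le_one_of_fst_eq rfl (by simp))
    set l1 := l ++ (List.range (H + 1)).map (fun i : ℕ => ((X, z + 1 + i) : ℤ × ℤ)) with hl1
    have hbd1 : ∀ v ∈ l1, 0 ≤ v.2 ∧ v.2 ≤ z' ∧ (0 < v.2 → 0 ≤ v.1) ∧ (v.2 = z' → v.1 = X) := by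
      intro v hv
      rcases List.mem_append.1 hv with hv | hv
      · have := hbd v hv
        refine ⟨this.1, by omega, this.2.2, fun h => by omega⟩
      · obtain ⟨i, hi, rfl⟩ := List.mem_map.1 hv
        rw [List.mem_range] at hi
        refine ⟨by simp only; omega, by simp only; omega, fun _ => hX0, fun _ => rfl⟩
    set ℓ : ℕ := b ^ (2 * (t + 1)) with hℓ
    have hℓ1 : 1 ≤ ℓ := Nat.one_le_pow _ _ hb
    obtain ⟨K, hK⟩ : ∃ K : ℕ, c * b ^ (2 * (m - (t + 1))) = K + 1 :=
      ⟨c * b ^ (2 * (m - (t + 1))) - 1, by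
        have : 0 < c * b ^ (2 * (m - (t + 1))) := by positivity
        omega⟩
    have hKM : (K + 1) * ℓ = M := by
      rw [← hK, hM, hℓ, mul_assoc, ← pow_add]
      congr 3; omega
    have hKM' : ((K : ℤ) + 1) * ℓ = M := by exact_mod_cast hKM
    -- The direction alternates: the next level runs leftwards from `M` for even `t` and rightwards
    -- from `0` for odd `t`.
    obtain ⟨σ, hσ, hσ1, hσX⟩ : ∃ σ : ℤ, |σ| = 1 ∧ (∀ y : ℤ, 0 ≤ y → y ≤ M →
        0 ≤ X + σ * y ∧ X + σ * y ≤ M) ∧ X + σ * M = turnPoint M (t + 1) := by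
      rcases Nat.even_or_odd t with he | ho
      · refine ⟨-1, by simp, fun y h1 h2 => ?_, ?_⟩
        · rw [hX, turnPoint, if_pos he]; omega
        · rw [hX, turnPoint, turnPoint, if_pos he, if_neg (by simpa [Nat.even_add_one] using he)]
          ring
      · rw [← Nat.not_even_iff_odd] at ho
        refine ⟨1, by simp, fun y h1 h2 => ?_, ?_⟩
        · rw [hX, turnPoint, if_neg ho]; omega
        · rw [hX, turnPoint, turnPoint, if_neg ho, if_pos (by simpa [Nat.even_add_one] using ho)]
          ring
    have hσ0 : σ ≠ 0 := by rintro rfl; simp at hσ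
    have hℓX : (ℓ : ℤ) ∣ X := by
      rw [hX, turnPoint]
      split_ifs
      · exact ⟨K + 1, by rw [← hKM']; ring⟩
      · exact dvd_zero _
    set g : ℕ → ℤ × ℤ := fun i => (X + σ * (i * ℓ), z') with hg
    have hgbd : ∀ i ≤ K + 1, 0 ≤ (g i).1 ∧ (g i).1 ≤ M := by
      intro i hi
      refine hσ1 _ (by positivity) ?_
      rw [← hKM']
      have : (i : ℤ) ≤ K + 1 := by exact_mod_cast hi
      gcongr
    have hgedge : ∀ i ≤ K, IsStairEdge k b M m (g i) (g (i + 1)) := by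
      intro i hi
      refine Or.inr ⟨t + 1, by omega, ht, rfl, rfl, ?_, ?_, (hgbd i (by omega)).1,
        (hgbd (i + 1) (by omega)).1⟩
      · have : (g i).1 - (g (i + 1)).1 = -(σ * ℓ) := by
          simp only [hg]; push_cast; ring
        rw [this, abs_neg, abs_mul, hσ, one_mul, hℓ]
        push_cast
        exact abs_of_nonneg (by positivity)
      · have : (b : ℤ) ^ (2 * (t + 1)) = ℓ := by rw [hℓ]; push_cast; rfl
        rw [this]
        exact dvd_add hℓX (Dvd.intro_left (σ * i) (by ring))
    have hz'0 : 0 < z' := by omega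
    have hg0 : g 0 = (X, z + 1 + H) := by
      simp only [hg]
      rw [Prod.mk.injEq]
      refine ⟨by simp, by omega⟩
    have hginj : ∀ i j, (g i).1 = (g j).1 → i = j := by
      intro i j hij
      simp only [hg] at hij
      have h3 := mul_left_cancel₀ hσ0 (add_left_cancel hij)
      have h4 := mul_right_cancel₀ (by positivity : (ℓ : ℤ) ≠ 0) h3
      exact_mod_cast h4
    -- The point `g 0` is already the top of the vertical part. In the short polygon, each further
    -- point of the level hangs vertically on the bottom row, at distance `z'`.
    have h2 := h1.append (fun i => g (i + 1)) K (by rw [← hg0]; exact hgedge 0 (by omega))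
      (fun i hi => hgedge (i + 1) (by omega))
      (fun i _ j _ hij => by have := hginj _ _ (congrArg Prod.fst hij); omega)
      (fun i hi hmem => by
        have h3 := (hbd1 _ hmem).2.2.2 rfl
        have h4 : (g 0).1 = X := by rw [hg0]
        have := hginj _ _ (h3.trans h4.symm)
        omega)
      (z' : ℝ) (fun i hi => by
        refine ⟨((g (i + 1)).1, 0), List.mem_append_left _ (List.mem_append_left _
          (hrow _ (hgbd (i + 1) (by omega)).1 (hgbd (i + 1) (by omega)).2)), ?_⟩
        have h3 : latticeDist ((g (i + 1)).1, 0) (g (i + 1)) = (|0 - (g (i + 1)).2| : ℤ) :=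
          latticeDist_of_fst_eq rfl
        rw [h3]
        simp only [hg, zero_sub, abs_neg, abs_of_pos hz'0, le_refl])
    refine ⟨l1 ++ (List.range (K + 1)).map (fun i => g (i + 1)), ?_, ?_, ?_⟩
    · have hend : g (K + 1) = (turnPoint M (t + 1), z') := by
        simp only [hg]
        rw [← hσX, ← hKM']
        push_cast; rfl
      have hdist : latticeDist (X, z + 1 + (H : ℤ)) (g (K + 1)) = M := by
        rw [← hg0, latticeDist_of_snd_eq (show (g 0).2 = (g (K + 1)).2 from rfl)]
        have : (g 0).1 - (g (K + 1)).1 = -(σ * M) := by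
          simp only [hg]; rw [← hKM']; push_cast; ring
        rw [this, abs_neg, abs_mul, hσ, one_mul, abs_of_nonneg hM0]
        simp
      have hKz : (c : ℤ) * b ^ (2 * (m - (t + 1))) = K + 1 := by exact_mod_cast hK
      have hKr : (c : ℝ) * b ^ (2 * (m - (t + 1))) = K + 1 := by exact_mod_cast hK
      convert h2 using 1
      · exact hend.symm
      · rw [Finset.sum_range_succ, hKz, hzz]; ring
      · rw [hdist]; push_cast; ring
      · rw [Finset.sum_range_succ, hKr, ← hz', hzz]; push_cast; ring
    · intro v hv
      rcases List.mem_append.1 hv with hv | hv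
      · have := hbd1 v hv
        exact ⟨this.1, this.2.1, this.2.2.1⟩
      · obtain ⟨i, hi, rfl⟩ := List.mem_map.1 hv
        rw [List.mem_range] at hi
        exact ⟨hz'0.le, le_rfl, fun _ => (hgbd (i + 1) (by omega)).1⟩
    · intro i hi0 hiM
      exact List.mem_append_left _ (List.mem_append_left _ (hrow i hi0 hiM))

lemma rel_of_mem_pathEdges {α : Type*} {R : α → α → Prop} (hsymm : ∀ x y, R x y → R y x)
    {l : List α} (h : l.IsChain R) {v w : α} (hvw : s(v, w) ∈ pathEdges l) : R v w := by
  induction l with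
  | nil => simp [pathEdges] at hvw
  | cons x l ih =>
    cases l with
    | nil => simp at hvw
    | cons y l =>
      rw [List.isChain_cons_cons] at h
      rw [pathEdges_cons_cons, List.mem_cons] at hvw
      rcases hvw with hvw | hvw
      · rcases Sym2.eq_iff.1 hvw with ⟨rfl, rfl⟩ | ⟨rfl, rfl⟩
        · exact h.1
        · exact hsymm _ _ h.1
      · exact ih h.2 hvw

/-- The staircase polygon with an odd number `m` of levels. -/
theorem le_kOptApproxRatio_staircase {k b c m W n M : ℕ} (hk : 1 ≤ k) (hkb : k ≤ b) (hc : 1 ≤ c)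
    (hW : 1 ≤ W) (hm : Odd m) (hM : M = c * b ^ (2 * m))
    (hn : (n : ℤ) = M + 2 * W + 2 * levelHeight k b m +
      ∑ s ∈ Finset.range m, (c : ℤ) * b ^ (2 * (m - (s + 1)))) :
    (m * M : ℝ) ≤ (2 * n + ∑ s ∈ Finset.range m,
      (c : ℝ) * b ^ (2 * (m - (s + 1))) * (2 * levelHeight k b (s + 1))) * kOptApproxRatio k n := by
  obtain ⟨l, hl, hbd, hrow⟩ := exists_isLatticePath_level (W := W) hk (hk.trans hkb) hc hM m le_rfl
  set z := levelHeight k b m with hz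
  have hm0 : turnPoint M m = 0 := by rw [turnPoint, if_neg (Nat.not_even_iff_odd.2 hm)]
  rw [hm0] at hl
  have hz4 : 4 ≤ z := by
    obtain ⟨m', hm'⟩ := hm
    have h1 : levelHeight k b 1 ≤ z := levelHeight_mono k b (by omega)
    have h2 : levelHeight k b 1 = 4 * (k * b) := by simp [levelHeight]; ring
    have h3 : (1 : ℤ) ≤ k * b := by exact_mod_cast Nat.mul_pos hk (hk.trans hkb)
    omega
  obtain ⟨W', rfl⟩ : ∃ W', W = W' + 1 := ⟨W - 1, by omega⟩
  -- Since `m` is odd the top level ends at `x = 0`. The return runs `W` steps to the left and then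
  -- down at `x = -W`; `W` serves to adjust the number of points.
  have h1 := hl.append_of_dist_le_one (fun i => (-(i + 1 : ℤ), z)) W'
    (isStairEdge_horizontal rfl (by simp) (Or.inl ⟨le_rfl, by simp only; omega⟩))
    (fun i _ => isStairEdge_horizontal rfl (by simp)
      (Or.inl ⟨by simp only; omega, by simp only; omega⟩))
    (fun i _ j _ hij => by have := congrArg Prod.fst hij; simp only at this; omega)
    (fun i _ hi => by have := (hbd _ hi).2.2 (by simp only; omega); simp only at this; omega)
    (latticeDist_le_one_of_snd_eq rfl (by simp))
    (fun i _ => latticeDist_le_one_of_snd_eq rfl (by simp))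
  -- The descent stops at height 1; the closing edge leads to the starting point at height 0.
  obtain ⟨Z, hZ⟩ : ∃ Z : ℕ, z = Z + 2 := ⟨(z - 2).toNat, by omega⟩
  set l1 := l ++ (List.range (W' + 1)).map (fun i : ℕ => ((-(i + 1 : ℤ), z) : ℤ × ℤ)) with hl1
  have h2 := h1.append_of_dist_le_one (fun i => (-(W' + 1 : ℤ), z - 1 - i)) Z
    (isStairEdge_vertical rfl (by simp) (Or.inl (by simp only; omega)))
    (fun i _ => isStairEdge_vertical rfl (by simp) (Or.inl (by simp only; omega)))
    (fun i _ j _ hij => by have := congrArg Prod.snd hij; simp only at this; omega)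
    (fun i hi hmem => by
      rcases List.mem_append.1 hmem with hmem | hmem
      · have := (hbd _ hmem).2.2 (by simp only; omega); simp only at this; omega
      · obtain ⟨j, -, hj⟩ := List.mem_map.1 hmem
        have := congrArg Prod.snd hj; simp only at this; omega)
    (latticeDist_le_one_of_fst_eq rfl (by simp))
    (fun i _ => latticeDist_le_one_of_fst_eq rfl (by simp))
  set l2 := l1 ++ (List.range (Z + 1)).map (fun i : ℕ => ((-(W' + 1 : ℤ), z - 1 - i) : ℤ × ℤ)) with hl2
  have hlen : l2.length = n := by
    have := h2.length_eq
    push_cast at hn this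
    have h3 : (l2.length : ℤ) = n := by rw [this, hn, hZ]; ring
    exact_mod_cast h3
  have hlen3 : 3 ≤ l2.length := by
    rw [hl2, hl1]
    simp only [List.length_append, List.length_map, List.length_range]
    have : Z ≥ 2 := by omega
    omega
  have hM' : (b : ℤ) ^ (2 * m) ∣ M := by rw [hM]; push_cast; exact Dvd.intro_left _ rfl
  obtain ⟨r, hr⟩ := List.head?_eq_some_iff.1 h2.head
  have hclosed : (l2 ++ [(-((W' + 1 : ℕ) : ℤ), (0 : ℤ))]).IsChain (IsStairEdge k b M m) := by
    rw [List.isChain_append]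
    refine ⟨h2.chain, by simp, fun y hy w hw => ?_⟩
    rw [h2.last, Option.mem_some_iff] at hy
    simp only [List.head?_cons, Option.mem_some_iff] at hw
    rw [← hy, ← hw]
    refine isStairEdge_vertical (by push_cast; rfl) ?_ (Or.inl (by simp only; omega))
    have : z - 1 - (Z : ℤ) - 0 = 1 := by omega
    simp only [this, abs_one]
  have hfinal := le_kOptApproxRatio_of_isStairEdge hk hkb hM' h2.nodup hlen3 (fun v w hvw => by
    refine rel_of_mem_pathEdges (fun _ _ h => h.symm) hclosed ?_
    rw [hr] at hvw ⊢
    rwa [cycEdges_cons] at hvw) h2.short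
  have hcyc : pathLength (l2.map latticePoint) ≤ cycLength (l2.map latticePoint) := by
    rw [hr, List.map_cons, cycLength_cons]
    exact pathLength_le_append _ _
  rw [hlen] at hfinal
  refine (h2.le_pathLength.trans (hcyc.trans hfinal)).trans ?_
  have h0 : 0 ≤ kOptApproxRatio k n := by
    refine Real.sSup_nonneg ?_
    rintro _ ⟨V, -, S, T, -, -, rfl⟩
    exact div_nonneg (length_nonneg _) (length_nonneg _)
  refine mul_le_mul_of_nonneg_right ?_ h0
  have hn' : (n : ℝ) = M + 2 * (W' + 1 : ℕ) + 2 * z +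
      ∑ s ∈ Finset.range m, (c : ℝ) * b ^ (2 * (m - (s + 1))) := by exact_mod_cast hn
  have hZ' : (z : ℝ) = Z + 2 := by exact_mod_cast hZ
  have hsum : 0 ≤ ∑ s ∈ Finset.range m, (c : ℝ) * b ^ (2 * (m - (s + 1))) :=
    Finset.sum_nonneg fun _ _ => by positivity
  have hM1 : (0 : ℝ) ≤ M := by positivity
  rw [hn']
  push_cast
  linarith

end Staircase

end EuclideanTSP

namespace EuclideanTSP

/-! ### Choice of parameters in the lower bound -/

section LowerBound

/-- The gaps between levels grow by the factor `b ^ 2 ≥ 4`, so the last gap dominates the height. -/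
lemma mul_levelHeight_le {k b : ℕ} (hb : 2 ≤ b) (t : ℕ) :
    b * levelHeight k b t ≤ 8 * k * (b : ℤ) ^ (2 * t) := by
  induction t with
  | zero => simp only [levelHeight]; positivity
  | succ t ih =>
    have h1 : (b : ℤ) ^ (2 * (t + 1)) = b ^ 2 * b ^ (2 * t) := by ring
    have h2 : (b : ℤ) * levelHeight k b (t + 1) =
        b * levelHeight k b t + 4 * k * (b ^ 2 * b ^ (2 * t)) := by
      rw [levelHeight]; ring
    have h3 : (4 : ℤ) ≤ b ^ 2 := by
      have : (2 : ℤ) ≤ b := by exact_mod_cast hb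
      nlinarith
    have h4 : (0 : ℤ) ≤ k * b ^ (2 * t) := by positivity
    rw [h1, h2]
    nlinarith

/-- The base `2 * x` is even for the parity count below; maximality of `x` together with `m ≤ x`
keeps its power within a constant factor of `n`. -/
lemma exists_last_even_pow_le {m n : ℕ} (h : 8 * (2 * m) ^ (2 * m) + 2 ≤ n) (hm : 1 ≤ m) :
    ∃ x, m ≤ x ∧ 8 * (2 * x) ^ (2 * m) + 2 ≤ n ∧ n < 8 * (2 * x + 2) ^ (2 * m) + 2 := by
  have hex : ∃ x, n < 8 * (2 * x) ^ (2 * m) + 2 := by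
    refine ⟨n, ?_⟩
    have : 2 * n ≤ (2 * n) ^ (2 * m) := Nat.le_self_pow (by omega) _
    omega
  have hmlt : m < Nat.find hex := by
    by_contra! hc
    have h1 : (2 * Nat.find hex) ^ (2 * m) ≤ (2 * m) ^ (2 * m) := by gcongr
    have h2 := Nat.find_spec hex
    omega
  refine ⟨Nat.find hex - 1, by omega, ?_, ?_⟩
  · exact not_lt.1 (Nat.find_min hex (by omega))
  · have h2 := Nat.find_spec hex
    rwa [show 2 * (Nat.find hex - 1) + 2 = 2 * Nat.find hex by omega]

/-- Exactly `n` points are reached by padding with `2 * W` points. As `b` is even, `M` is even and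
`S` has the parity of `c`, so `c ∈ {1, 2}` is chosen with the parity of `n`. The constants 8 and 2
leave room for `W ≥ 1`, since `M`, `z` and `S` are at most `2 * b ^ (2 * m)`. -/
lemma le_mul_kOptApproxRatio {k m n : ℕ} (hk : 1 ≤ k) (hm : Odd m) (hkm : 4 * k ≤ m)
    (h : 8 * (2 * m) ^ (2 * m) + 2 ≤ n) : (m : ℝ) ≤ (148 + 8 * k) * kOptApproxRatio k n := by
  obtain ⟨x, hmx, hx1, hx2⟩ := exists_last_even_pow_le h (by omega)
  set b := 2 * x with hb
  obtain ⟨c, hc1, hc2, hcn⟩ : ∃ c : ℕ, 1 ≤ c ∧ c ≤ 2 ∧ (n : ℤ) % 2 = (c : ℤ) % 2 := by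
    rcases Nat.even_or_odd n with ⟨j, hj⟩ | ⟨j, hj⟩
    · exact ⟨2, by norm_num, le_rfl, by omega⟩
    · exact ⟨1, le_rfl, by norm_num, by omega⟩
  set M : ℕ := c * b ^ (2 * m) with hM
  set z := levelHeight k b m with hz
  set S : ℤ := ∑ s ∈ Finset.range m, (c : ℤ) * b ^ (2 * (m - (s + 1))) with hS
  have hb0 : (0 : ℤ) < b := by omega
  have hz0 : 0 ≤ z := levelHeight_nonneg k b m
  have hpM : (b : ℤ) ^ (2 * m) ≤ M := by
    rw [hM]; push_cast
    have : (1 : ℤ) ≤ c := by exact_mod_cast hc1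
    nlinarith [pow_pos hb0 (2 * m)]
  have hM2 : (M : ℤ) ≤ 2 * b ^ (2 * m) := by
    rw [hM]; push_cast
    have : (c : ℤ) ≤ 2 := by exact_mod_cast hc2
    nlinarith [pow_pos hb0 (2 * m)]
  have hzM : z ≤ M := by
    refine le_trans (le_of_mul_le_mul_left ?_ hb0) hpM
    refine (mul_levelHeight_le (by omega) m).trans ?_
    have : (8 * k : ℤ) ≤ b := by omega
    gcongr
  have hSM : S ≤ M := by
    have h1 : ∀ s ∈ Finset.range m, (c : ℤ) * b ^ (2 * (m - (s + 1))) ≤ c * b ^ (2 * (m - 1)) := by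
      intro s _
      have h2 : (1 : ℤ) ≤ b := hb0
      gcongr
      omega
    refine (Finset.sum_le_card_nsmul _ _ _ h1).trans ?_
    rw [Finset.card_range, nsmul_eq_mul, hM]
    have h3 : 2 * m = 2 * (m - 1) + 2 := by omega
    have h4 : (m : ℤ) ≤ b ^ 2 := by
      have : (m : ℤ) ≤ b := by omega
      nlinarith
    have h5 : (b : ℤ) ^ (2 * m) = b ^ (2 * (m - 1)) * b ^ 2 := by rw [← pow_add, ← h3]
    push_cast
    rw [h5]
    calc (m : ℤ) * (c * b ^ (2 * (m - 1))) ≤ b ^ 2 * (c * b ^ (2 * (m - 1))) := by gcongr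
      _ = _ := by ring
  have hM_even : (M : ℤ) % 2 = 0 := by
    rw [hM, show 2 * m = (2 * m - 1) + 1 by omega, pow_succ, hb]
    push_cast
    rw [show (c : ℤ) * ((2 * x) ^ (2 * m - 1) * (2 * x)) = 2 * (c * (2 * x) ^ (2 * m - 1) * x) by ring]
    exact Int.mul_emod_right 2 _
  have hS_parity : S % 2 = (c : ℤ) % 2 := by
    obtain ⟨m', rfl⟩ : ∃ m', m = m' + 1 := ⟨m - 1, by omega⟩
    rw [hS, Finset.sum_range_succ]
    have : (2 : ℤ) ∣ ∑ s ∈ Finset.range m', (c : ℤ) * b ^ (2 * (m' + 1 - (s + 1))) := by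
      refine Finset.dvd_sum fun s hs => ?_
      rw [Finset.mem_range] at hs
      refine Dvd.dvd.mul_left (dvd_pow ?_ (by omega)) _
      rw [hb]; push_cast; exact dvd_mul_right 2 _
    simp only [Nat.sub_self, mul_zero, pow_zero, mul_one]
    omega
  have hx1' : 8 * (b : ℤ) ^ (2 * m) + 2 ≤ n := by exact_mod_cast hx1
  obtain ⟨W, hW⟩ : ∃ W : ℕ, (n : ℤ) = M + 2 * W + 2 * z + S :=
    ⟨((n - M - 2 * z - S) / 2).toNat, by omega⟩
  have hmain := le_kOptApproxRatio_staircase (k := k) (b := b) (c := c) (m := m) (W := W) (n := n) hk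
    (by omega) hc1 (by omega) hm hM hW
  have hMpos : (0 : ℝ) < M := by
    have : 0 < b := by omega
    rw [hM]; positivity
  have hb0' : (0 : ℝ) < b := by exact_mod_cast hb0
  -- Level `s + 1` has about `M / b ^ (2 * (s + 1))` points at a height of order `k * b ^ (2 * s +
  -- 1)`. Each level costs `O(k * M / b)`, and there are `m ≤ b / 2` levels.
  have hsum : ∑ s ∈ Finset.range m, (c : ℝ) * b ^ (2 * (m - (s + 1))) *
      (2 * levelHeight k b (s + 1)) ≤ 8 * k * M := by
    have h1 : ∀ s ∈ Finset.range m, (c : ℝ) * b ^ (2 * (m - (s + 1))) *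
        (2 * levelHeight k b (s + 1)) ≤ 16 * k * M / b := by
      intro s hs
      rw [Finset.mem_range] at hs
      rw [le_div_iff₀ hb0']
      have h2 := mul_levelHeight_le (k := k) (b := b) (by omega) (s + 1)
      have h3 : (b : ℝ) * levelHeight k b (s + 1) ≤ 8 * k * b ^ (2 * (s + 1)) := by exact_mod_cast h2
      calc (c : ℝ) * b ^ (2 * (m - (s + 1))) * (2 * levelHeight k b (s + 1)) * b =
          2 * (c * b ^ (2 * (m - (s + 1)))) * (b * levelHeight k b (s + 1)) := by ring
        _ ≤ 2 * (c * b ^ (2 * (m - (s + 1)))) * (8 * k * b ^ (2 * (s + 1))) := by gcongr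
        _ = 16 * k * (c * (b ^ (2 * (m - (s + 1))) * b ^ (2 * (s + 1)))) := by ring
        _ = 16 * k * M := by
          rw [← pow_add, show 2 * (m - (s + 1)) + 2 * (s + 1) = 2 * m by omega, hM]
          push_cast; ring
    refine (Finset.sum_le_card_nsmul _ _ _ h1).trans ?_
    rw [Finset.card_range, nsmul_eq_mul, mul_div_assoc', div_le_iff₀ hb0']
    have h4 : (2 * m : ℝ) ≤ b := by exact_mod_cast (by omega : 2 * m ≤ b)
    have h5 : (0 : ℝ) ≤ k * M := by positivity
    nlinarith
  -- Passing from `x` to `x + 1` multiplies the power by at most `exp (2 * m / x) ≤ exp 2 ≤ 9`, and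
  -- `8 * 9 + 2 = 74`.
  have hnM : (n : ℝ) ≤ 74 * M := by
    have hx0 : (0 : ℝ) < x := by exact_mod_cast (by omega : 0 < x)
    have h1 : (n : ℝ) ≤ 8 * (2 * x + 2) ^ (2 * m) + 2 := by exact_mod_cast hx2.le
    have h2 : ((2 : ℝ) * x + 2) ^ (2 * m) ≤ b ^ (2 * m) * 9 := by
      have h3 : (2 : ℝ) * x + 2 = b * (1 / x + 1) := by rw [hb]; push_cast; field_simp; ring
      rw [h3, mul_pow]
      gcongr
      calc (1 / (x : ℝ) + 1) ^ (2 * m) ≤ (Real.exp (1 / x)) ^ (2 * m) := by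
            gcongr; exact Real.add_one_le_exp _
        _ = Real.exp ((2 * m : ℕ) * (1 / x)) := (Real.exp_nat_mul _ _).symm
        _ ≤ Real.exp (2 * 1) := by
            rw [Real.exp_le_exp, mul_one_div, div_le_iff₀ hx0]
            have : (m : ℝ) ≤ x := by exact_mod_cast hmx
            push_cast; linarith
        _ ≤ 9 := by
            rw [two_mul, Real.exp_add]
            have := Real.exp_one_lt_d9
            have := Real.exp_pos 1
            nlinarith
    have h4 : (b : ℝ) ^ (2 * m) ≤ M := by exact_mod_cast hpM
    have h5 : (1 : ℝ) ≤ M := by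
      have : 0 < M := by exact_mod_cast hMpos
      exact_mod_cast this
    linarith
  have h0 : 0 ≤ kOptApproxRatio k n := by
    refine Real.sSup_nonneg ?_
    rintro _ ⟨V, -, S, T, -, -, rfl⟩
    exact div_nonneg (length_nonneg _) (length_nonneg _)
  refine le_of_mul_le_mul_right (hmain.trans ?_) hMpos
  calc _ ≤ (148 * M + 8 * k * M) * kOptApproxRatio k n := by
        refine mul_le_mul_of_nonneg_right ?_ h0
        linarith
    _ = _ := by ring

lemma tendsto_log_div_log_log :
    Filter.Tendsto (fun n : ℕ => Real.log n / Real.log (Real.log n)) Filter.atTop Filter.atTop := by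
  have h1 : Filter.Tendsto (fun u : ℝ => u / Real.log u) Filter.atTop Filter.atTop := by
    refine Filter.tendsto_atTop_mono' _ ?_
      (Real.tendsto_sqrt_atTop.atTop_div_const (by norm_num : (0 : ℝ) < 2))
    filter_upwards [Filter.eventually_gt_atTop 1] with u hu
    have h2 := Real.log_pos hu
    rw [div_le_div_iff₀ (by norm_num) h2]
    have h3 : Real.log u ≤ 2 * Real.sqrt u := by
      have := Real.log_le_self (Real.sqrt_nonneg u)
      rw [Real.log_sqrt (by linarith)] at this
      linarith
    have h4 := Real.mul_self_sqrt (by linarith : 0 ≤ u)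
    nlinarith [Real.sqrt_nonneg u]
  exact h1.comp (Real.tendsto_log_atTop.comp tendsto_natCast_atTop_atTop)

/-- The approximation ratio of `k`-Opt is `Ω(log n / log log n)`. -/
theorem exists_le_kOptApproxRatio {k : ℕ} (hk : 2 ≤ k) : ∃ c : ℝ, 0 < c ∧ ∃ n₀ : ℕ,
    ∀ n : ℕ, n₀ ≤ n → c * (Real.log n / Real.log (Real.log n)) ≤ kOptApproxRatio k n := by
  refine ⟨1 / (16 * (148 + 8 * k)), by positivity, Filter.eventually_atTop.1 ?_⟩
  have hlog : ∀ᶠ n : ℕ in Filter.atTop, 1 ≤ Real.log (Real.log n) :=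
    ((Real.tendsto_log_atTop.comp Real.tendsto_log_atTop).comp
      tendsto_natCast_atTop_atTop).eventually_ge_atTop 1
  filter_upwards [tendsto_log_div_log_log.eventually_ge_atTop (64 * k), hlog,
    Filter.eventually_ge_atTop 2] with n hy hll hn
  set y := Real.log n / Real.log (Real.log n) with hydef
  have hk' : (2 : ℝ) ≤ k := by exact_mod_cast hk
  -- This makes `m` odd and about `y / 8`. Since `2 * m ≤ y / 2`, even the square of `(2 * m) ^ (2 *
  -- m)` is at most `n`, which absorbs the factor 8 and the summand 2.
  set r := ⌊y / 16⌋₊ with hr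
  set m := 2 * r + 1 with hm
  have hr1 : (r : ℝ) ≤ y / 16 := Nat.floor_le (by linarith)
  have hr2 : y / 16 < r + 1 := Nat.lt_floor_add_one _
  have hmr : (m : ℝ) = 2 * r + 1 := by rw [hm]; push_cast; ring
  have hm1 : y / 16 ≤ m := by rw [hmr]; linarith
  have hm4 : 4 * k ≤ m := by
    have : (4 * k : ℝ) ≤ m := by linarith
    exact_mod_cast this
  have hm2 : 2 * (m : ℝ) ≤ y / 2 := by rw [hmr]; linarith
  have hnpos : (0 : ℝ) < n := by exact_mod_cast (by omega : 0 < n)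
  have hlogn : y * Real.log (Real.log n) = Real.log n := by
    rw [hydef]; exact div_mul_cancel₀ _ (by linarith)
  have hylog : y / 2 ≤ Real.log n := by nlinarith
  have hpow : ((2 * m) ^ (2 * m)) ^ 2 ≤ n := by
    have hpos : (0 : ℝ) < 2 * m := by rw [hmr]; positivity
    have h1 : Real.log (((2 * m : ℝ) ^ (2 * m)) ^ 2) ≤ Real.log n := by
      rw [Real.log_pow, Real.log_pow]
      push_cast
      have h2 : Real.log (2 * m) ≤ Real.log (Real.log n) :=
        Real.log_le_log hpos (hm2.trans hylog)
      have h3 : 2 * (m : ℝ) * Real.log (2 * m) ≤ y / 2 * Real.log (Real.log n) := by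
        calc 2 * (m : ℝ) * Real.log (2 * m) ≤ 2 * m * Real.log (Real.log n) := by gcongr
          _ ≤ _ := by gcongr
      linarith
    have h2 := (Real.log_le_log_iff (by positivity) hnpos).1 h1
    exact_mod_cast h2
  have hbound : 8 * (2 * m) ^ (2 * m) + 2 ≤ n := by
    have h1 : 2 * m ≤ (2 * m) ^ (2 * m) := Nat.le_self_pow (by omega) _
    nlinarith
  have hfinal := le_mul_kOptApproxRatio (by omega) ⟨r, hm⟩ hm4 hbound
  rw [one_div_mul_eq_div, div_le_iff₀ (by positivity)]
  linarith

end LowerBound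

end EuclideanTSP


theorem mainTheorem2 (k : ℕ) (hk : 2 ≤ k) :
    (∀ n : ℕ, 3 ≤ n →
      IsLUB (EuclideanTSP.kOptRatios k n) (EuclideanTSP.kOptApproxRatio k n)) ∧
    Asymptotics.IsTheta Filter.atTop
      (fun n : ℕ => EuclideanTSP.kOptApproxRatio k n)
      (fun n : ℕ => Real.log (n : ℝ) / Real.log (Real.log (n : ℝ))) := by
  refine ⟨fun n hn => EuclideanTSP.isLUB_kOptApproxRatio k hn, ?_, ?_⟩
  · obtain ⟨C, hC, h⟩ := EuclideanTSP.exists_kOptApproxRatio_le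
    refine Asymptotics.IsBigO.of_bound C ?_
    filter_upwards [Filter.eventually_ge_atTop (2 ^ 2 ^ 8)] with n hn
    have h1 : 0 ≤ EuclideanTSP.kOptApproxRatio k n := Real.sSup_nonneg (by
      rintro _ ⟨V, -, S, T, -, -, rfl⟩
      exact div_nonneg (EuclideanTSP.length_nonneg _) (EuclideanTSP.length_nonneg _))
    rw [Real.norm_of_nonneg h1]
    exact (h n hn k hk).trans (mul_le_mul_of_nonneg_left (Real.le_norm_self _) hC.le)
  · obtain ⟨c, hc, n₀, h⟩ := EuclideanTSP.exists_le_kOptApproxRatio hk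
    refine Asymptotics.IsBigO.of_bound c⁻¹ ?_
    have hlog : ∀ᶠ n : ℕ in Filter.atTop, 1 ≤ Real.log (Real.log n) :=
      ((Real.tendsto_log_atTop.comp Real.tendsto_log_atTop).comp
        tendsto_natCast_atTop_atTop).eventually_ge_atTop 1
    filter_upwards [Filter.eventually_ge_atTop n₀, Filter.eventually_ge_atTop 1, hlog] with n hn h1 h2
    have h3 : 0 ≤ Real.log n / Real.log (Real.log n) :=
      div_nonneg (Real.log_natCast_nonneg n) (by linarith)
    rw [Real.norm_of_nonneg h3, le_inv_mul_iff₀ hc]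
    exact (h n hn).trans (Real.le_norm_self _)
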